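/- **Setting.** Let $m>0$ and $q\in\mathbb R$, and let $\vec E,\vec B\in\mathbb R^3$ be constant fields in four dimensions. Let $F$ be the Euclidean field strength, $F_{ij}=\epsilon_{ijk}B_k$, $F_{4i}=-iE_i=-F_{i4}$. Put $\mathcal F=\tfrac12(\vec B^2-\vec E^2)$, $\mathcal G=\vec E\cdot\vec B$ and $K_\pm=\sqrt{\sqrt{\mathcal F^2+\mathcal G^2}\pm\mathcal F}$. The one-loop effective Lagrangian of a charged particle of spin $s\in\{0,1\}$ is defined by the Gaussian worldline path integral $$\mathcal L_s=\int\frac{dT}{T}\,\frac{e^{-m^2T}}{(4\pi T)^2}\,P_s(T),$$ $$P_s(T)=\mathrm{Det}^{-1/2}\big(\Delta^{(t)}\big)\int_0^{2\pi}\frac{d\theta}{2\pi}\,e^{i(\frac32+s)\theta}\,\frac{\mathrm{Det}(\partial_\tau-i\theta)\,\mathrm{Det}(\partial_\tau+i\theta)}{\mathrm{Det}\big(\partial_\tau+i\theta+2iqTF\big)\,\mathrm{Det}(\partial_\tau+i\theta)} .$$ - Here $\Delta^{(t)}=-\frac1{2T}\partial_\tau^2-iqF\partial_\tau$ acts on $[0,1]$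 with Dirichlet conditions, and the first-order operators are taken with periodic conditions. - Functional determinants are continuum limits of time-sliced (midpoint rule) determinants, relative to the free operators without zero modes. The square root is the branch analytic in $T$ that equals $1$ at $T=0$. - The $\theta$-contour is shifted to $\theta-i\Lambda$ with $\Lambda$ large, so that in $w=e^{-i\theta}$ only the pole $w=0$ is enclosed. - The proper-time contour is $T=\varepsilon+re^{i\varphi}$, $r>0$, where $\varepsilon\ge0$, $|q|\varepsilon K_-<\pi$ and $0\le\varphi<\pi/2$, with $\varphi>0$ if $qK_-\ne0$ (so that it passes above the poles on the positive real axis). For $s=1$ one also requires $|q|\,|K_+\cos\varphi-K_-\sin\varphi|<m^2\cos\varphi$. Such $\varphi$ and $\varepsilon$ are called admissible. A positive $\varepsilon$ is an ultraviolet cutoff. - The Minkowskian Lagrangian is $-\mathcal L_s$. **Theorem.** All the limits above exist (the square root exists, and the $\theta$-integral does not depend on $\Lambda$ for large $\Lambda$), and the following holds, with $x/\sin x$ and $y/\sinh y$ read as $1$ at $0$. 1. (Effective Lagrangians.) For complex $T\neq0$ away from the poles, $$P_0(T)=-\frac{q^2T^2K_-K_+}{\sinh(qTK_+)\sin(qTK_-)},$$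 $$P_1(T)=\frac{q^2T^2K_-K_+}{\sinh(qTK_+)\sin(qTK_-)}\big[1-2\cosh(2qTK_+)-2\cos(2qTK_-)\big].$$ For all admissible contours with $\varepsilon>0$, $\mathcal L_0$ (the Weisskopf Lagrangian) and $\mathcal L_1$ are the absolutely convergent proper-time integrals of these expressions. 2. (Pair production.) Let $\vec B=0$, $q>0$ and $E=|\vec E|>0$. For every admissible contour with $\varepsilon>0$, the spin-1 Minkowskian Lagrangian satisfies $$\operatorname{Im}\mathcal L=\frac{3(qE)^2}{16\pi^3}\sum_{n=1}^\infty(-1)^{n+1}\frac{e^{-m^2\pi n/(qE)}}{n^2}.$$ The rate $2\operatorname{Im}\mathcal L$ equals $-\frac{3}{8\pi^3}(qE)^2\,\mathrm{Li}_2\big(-e^{-m^2\pi/(qE)}\big)$, which is three times the rate for spin 0. 3. (Weak fields.) For every fixed $T$, as $q\to0$, $$P_1(T)=-3+\tfrac74q^2T^2\,\mathrm{tr}F^2+\tfrac5{32}q^4T^4(\mathrm{tr}F^2)^2-\tfrac{27}{40}q^4T^4\,\mathrm{tr}F^4+O(q^6).$$ Moreover $-\mathrm{tr}F^2=2(\vec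 B^2-\vec E^2)$ and $\mathrm{tr}F^4=2(\vec E^2-\vec B^2)^2+4(\vec E\cdot\vec B)^2$. Renormalize by replacing $P_s$ with $P_s-d_s$, where $d_1=-3+\frac74q^2T^2\mathrm{tr}F^2$ and $d_0=-1-\frac1{12}q^2T^2\mathrm{tr}F^2$ are the terms of order $q^0$ and $q^2$, and by adding the Euclidean Maxwell term $-\frac14\mathrm{tr}F^2$. The resulting integrals converge absolutely for admissible contours with $\varepsilon=0$. For every fixed $\varphi\in[0,\pi/2)$, with $\varphi>0$ if $K_-\neq0$, and with $\alpha=q^2/4\pi$, the renormalized Minkowskian Lagrangians satisfy, as $q\to0$, $$\begin{aligned}\mathcal L^{\rm ren}_{s=1}&=\tfrac14\mathrm{tr}F^2+\frac{q^4}{16\pi^2m^4}\Big(-\tfrac5{32}(\mathrm{tr}F^2)^2+\tfrac{27}{40}\mathrm{tr}F^4\Big)+O(q^6)\\&=\tfrac12(\vec E^2-\vec B^2)+\frac{\alpha^2}{40m^4}\big(29(\vec E^2-\vec B^2)^2+108(\vec E\cdot\vec B)^2\big)+O(q^6),\end{aligned}$$ $$\begin{aligned}\mathcal L^{\rm ren}_{s=0}&=\tfrac14\mathrm{tr}F^2+\frac{q^4}{16\pi^2m^4}\Big(\tfrac1{288}(\mathrm{tr}F^2)^2+\tfrac1{360}\mathrm{tr}F^4\Big)+O(q^6)\\&=\tfrac12(\vec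 E^2-\vec B^2)+\frac{\alpha^2}{360m^4}\big(7(\vec E^2-\vec B^2)^2+4(\vec E\cdot\vec B)^2\big)+O(q^6).\end{aligned}$$ -/

import Mathlib

open Filter Topology Asymptotics
open scoped Kronecker BigOperators

namespace Worldline

noncomputable section

/-- Euclidean three-space, in which the constant fields `E` and `B` take their values. -/
abbrev Vec3 := EuclideanSpace ℝ (Fin 3)

/-! ### The constant background field -/

/-- The Euclidean field strength: `F_{ij} = ε_{ijk} B_k`, `F_{4i} = -i E_i`
(indices `1,2,3,4` are `0,1,2,3 : Fin 4`). -/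
def fieldStrength (E B : Vec3) : Matrix (Fin 4) (Fin 4) ℂ :=
  !![0, (B 2 : ℂ), -(B 1 : ℂ), Complex.I * (E 0 : ℂ);
     -(B 2 : ℂ), 0, (B 0 : ℂ), Complex.I * (E 1 : ℂ);
     (B 1 : ℂ), -(B 0 : ℂ), 0, Complex.I * (E 2 : ℂ);
     -(Complex.I * (E 0 : ℂ)), -(Complex.I * (E 1 : ℂ)), -(Complex.I * (E 2 : ℂ)), 0]

/-- The Maxwell invariant `(B² - E²) / 2`. -/
def maxwellF (E B : Vec3) : ℝ := (‖B‖ ^ 2 - ‖E‖ ^ 2) / 2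

/-- The Maxwell invariant `E · B`. -/
def maxwellG (E B : Vec3) : ℝ := inner ℝ E B

/-- `K₊ = √(√(𝓕² + 𝓖²) + 𝓕)`. -/
def Kplus (E B : Vec3) : ℝ :=
  √(√(maxwellF E B ^ 2 + maxwellG E B ^ 2) + maxwellF E B)

/-- `K₋ = √(√(𝓕² + 𝓖²) - 𝓕)`. -/
def Kminus (E B : Vec3) : ℝ :=
  √(√(maxwellF E B ^ 2 + maxwellG E B ^ 2) - maxwellF E B)

/-! ### Functional determinants of the Gaussian worldline path integral

Both determinants are continuum limits of time-sliced determinants with the midpoint rule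
(Weyl ordering), normalized by the free operator without its zero modes. -/

/-- The lattice second derivative on `N` interior points of `[0,1]`, with Dirichlet boundary
conditions. -/
def latticeD2 (N : ℕ) : Matrix (Fin N) (Fin N) ℂ := fun i j =>
  ((N : ℂ) + 1) ^ 2 *
    (if (j : ℕ) = i + 1 ∨ (i : ℕ) = j + 1 then 1 else if i = j then -2 else 0)

/-- The central lattice first derivative on `N` interior points of `[0,1]`, with Dirichlet boundary
conditions. -/
def latticeD1 (N : ℕ) : Matrix (Fin N) (Fin N) ℂ := fun i j =>
  ((N : ℂ) + 1) / 2 *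
    (if (j : ℕ) = i + 1 then 1 else if (i : ℕ) = j + 1 then -1 else 0)

/-- The time-sliced `2T · Δ^{(t)} = -d²/dτ² - 2 i q T F d/dτ`, the kinetic operator of the
fluctuations `t^μ(τ)`, `t(0) = t(1) = 0`, in the worldline action
`∫ (ẋ²/(4T) - i q A·ẋ) dτ` in Fock--Schwinger gauge. The factor `2T` drops out of the ratio with
the free operator. -/
def coordOperator (q : ℝ) (F : Matrix (Fin 4) (Fin 4) ℂ) (T : ℂ) (N : ℕ) :
    Matrix (Fin N × Fin 4) (Fin N × Fin 4) ℂ :=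
  (-latticeD2 N) ⊗ₖ (1 : Matrix (Fin 4) (Fin 4) ℂ)
    - (2 * Complex.I * (q : ℂ) * T) • (latticeD1 N ⊗ₖ F)

/-- Time-sliced determinant of the coordinate fluctuations, relative to the free one. -/
def coordDetSliced (q : ℝ) (F : Matrix (Fin 4) (Fin 4) ℂ) (T : ℂ) (N : ℕ) : ℂ :=
  (coordOperator q F T N).det / (coordOperator 0 F T N).det

/-- `Det Δ^{(t)}` with Dirichlet boundary conditions, relative to the free operator. -/
def coordDet (q : ℝ) (F : Matrix (Fin 4) (Fin 4) ℂ) (T : ℂ) : ℂ :=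
  limUnder atTop (coordDetSliced q F T)

open Classical in
/-- The entire square root `g` of `D` with `g 0 = 1` (unique if it exists). -/
def analyticSqrt (D : ℂ → ℂ) : ℂ → ℂ :=
  if h : ∃ g : ℂ → ℂ, Differentiable ℂ g ∧ g 0 = 1 ∧ ∀ z, g z ^ 2 = D z then h.choose else 0

/-- `Det^{1/2} Δ^{(t)}`, as a function of the proper time, on the branch that is `1` at `T = 0`. -/
def sqrtCoordDet (q : ℝ) (F : Matrix (Fin 4) (Fin 4) ℂ) : ℂ → ℂ :=
  analyticSqrt (coordDet q F)

/-- The lattice derivative on the circle with `N + 1` sites (subtraction in `Fin (N + 1)` is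
cyclic). -/
def circleD (N : ℕ) : Matrix (Fin (N + 1)) (Fin (N + 1)) ℂ := fun i j =>
  ((N : ℂ) + 1) * ((if j = i then 1 else 0) - (if j = i - 1 then 1 else 0))

/-- The midpoint average of neighbouring sites on the circle with `N + 1` sites. -/
def circleAvg (N : ℕ) : Matrix (Fin (N + 1)) (Fin (N + 1)) ℂ := fun i j =>
  (1 / 2 : ℂ) * ((if j = i then 1 else 0) + (if j = i - 1 then 1 else 0))

/-- The product of the nonzero eigenvalues `(N+1)(1 - e^{2πik/(N+1)})`, `k = 1, …, N`, of
`circleD N` (eigenvectors: the Fourier modes). -/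
def circleFreeDet (N : ℕ) : ℂ :=
  ∏ k ∈ Finset.range N, ((N : ℂ) + 1) *
    (1 - Complex.exp (2 * Real.pi * Complex.I * ((k : ℂ) + 1) / ((N : ℂ) + 1)))

/-- Time-sliced determinant of `d/dτ + M` on `ℂ^d`-valued periodic functions, relative to the free
operator `d/dτ` without its zero modes. -/
def circleDetSliced {d : ℕ} (M : Matrix (Fin d) (Fin d) ℂ) (N : ℕ) : ℂ :=
  (circleD N ⊗ₖ (1 : Matrix (Fin d) (Fin d) ℂ) + circleAvg N ⊗ₖ M).det / circleFreeDet N ^ d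

/-- `Det (d/dτ + M)` with periodic boundary conditions. -/
def circleDet {d : ℕ} (M : Matrix (Fin d) (Fin d) ℂ) : ℂ :=
  limUnder atTop (circleDetSliced M)

/-- The zeroth-order part of `Δ^{(α)} = d/dτ + iθ + 2 i q T F`, the kinetic operator of the
oscillators `α^μ, ᾱ^μ`. -/
def oscMatrix (q : ℝ) (F : Matrix (Fin 4) (Fin 4) ℂ) (T θ : ℂ) : Matrix (Fin 4) (Fin 4) ℂ :=
  (Complex.I * θ) • (1 : Matrix (Fin 4) (Fin 4) ℂ) + (2 * Complex.I * (q : ℂ) * T) • F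

/-- `Det (d/dτ + iθ)` for one complex variable: the oscillator `β, β̄`, and with `±θ` the two
Faddeev--Popov determinants. -/
def scalarDet (θ : ℂ) : ℂ := circleDet (fun _ _ : Fin 1 => Complex.I * θ)

/-! ### The worldline effective Lagrangian -/

/-- The integrand over the `U(1)` modulus `θ`, with Chern--Simons coupling `c = 3/2 + s`. -/
def modularIntegrand (s : ℕ) (q : ℝ) (F : Matrix (Fin 4) (Fin 4) ℂ) (T θ : ℂ) : ℂ :=
  Complex.exp (Complex.I * (3 / 2 + (s : ℂ)) * θ) * scalarDet (-θ) * scalarDet θ *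
    (circleDet (oscMatrix q F T θ))⁻¹ * (scalarDet θ)⁻¹

/-- The average over the modulus along `θ ∈ [0, 2π] - iΛ`; the Wilson variable `w = e^{-iθ}` runs
over the circle `|w| = e^{-Λ}`. -/
def modularAverage (s : ℕ) (q : ℝ) (F : Matrix (Fin 4) (Fin 4) ℂ) (T : ℂ) (Λ : ℝ) : ℂ :=
  (1 / (2 * Real.pi) : ℂ) *
    ∫ θ in (0 : ℝ)..(2 * Real.pi), modularIntegrand s q F T ((θ : ℂ) - Complex.I * (Λ : ℂ))

/-- The integral over the modulus, on a contour that separates `w = 0` from all other poles; it does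
not depend on `Λ` once `Λ` is large. -/
def modularIntegral (s : ℕ) (q : ℝ) (F : Matrix (Fin 4) (Fin 4) ℂ) (T : ℂ) : ℂ :=
  limUnder atTop (modularAverage s q F T)

/-- The Gaussian worldline path integral over all fluctuations and over the modulus `θ`, relative to
the free-particle normalization `(4πT)⁻²`. -/
def worldlineFactor (s : ℕ) (q : ℝ) (F : Matrix (Fin 4) (Fin 4) ℂ) (T : ℂ) : ℂ :=
  (sqrtCoordDet q F T)⁻¹ * modularIntegral s q F T

/-- The proper-time measure of a particle of mass `m` in four dimensions,
`(1/T) e^{-m²T} / (4πT)²`. -/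
def properTimeWeight (m : ℝ) (T : ℂ) : ℂ :=
  1 / T * (Complex.exp (-((m : ℂ) ^ 2 * T)) / (4 * Real.pi * T) ^ 2)

/-- The point `ε + r e^{iφ}` of the proper-time contour. -/
def contourPoint (ε φ r : ℝ) : ℂ := (ε : ℂ) + (r : ℂ) * Complex.exp (Complex.I * (φ : ℂ))

/-- `f(T) dT/dr` along the contour. -/
def contourPullback (ε φ : ℝ) (f : ℂ → ℂ) (r : ℝ) : ℂ :=
  f (contourPoint ε φ r) * Complex.exp (Complex.I * (φ : ℂ))

/-- The integral of `f` over the contour `T = ε + r e^{iφ}`, `0 < r < ∞`. -/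
def contourIntegral (ε φ : ℝ) (f : ℂ → ℂ) : ℂ :=
  ∫ r in Set.Ioi (0 : ℝ), contourPullback ε φ f r

/-- Proper-time contours on which the spin-`s` integral (`s = 0, 1`) makes sense at large `T`: the
contour starts at `ε`, before the first pole of the integrand on the positive axis, is rotated by the
angle `φ` towards Minkowskian proper time, so that it passes above the poles when there are any, and
the integrand decays along it. -/
def AdmissibleContour (s : ℕ) (m q : ℝ) (E B : Vec3) (ε φ : ℝ) : Prop :=
  0 ≤ ε ∧ |q| * ε * Kminus E B < Real.pi ∧ 0 ≤ φ ∧ φ < Real.pi / 2 ∧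
    (q * Kminus E B ≠ 0 → 0 < φ) ∧
    (s = 1 → |q| * |Kplus E B * Real.cos φ - Kminus E B * Real.sin φ| < m ^ 2 * Real.cos φ)

/-- The (unrenormalized, Euclidean) one-loop effective Lagrangian of the charged spin-`s` particle,
with ultraviolet proper-time cutoff `ε`. -/
def effectiveLagrangian (s : ℕ) (m q : ℝ) (E B : Vec3) (ε φ : ℝ) : ℂ :=
  contourIntegral ε φ
    (fun T => properTimeWeight m T * worldlineFactor s q (fieldStrength E B) T)

/-- The Minkowskian one-loop effective Lagrangian: `𝓛 → -𝓛`. -/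
def minkowskiLagrangian (s : ℕ) (m q : ℝ) (E B : Vec3) (ε φ : ℝ) : ℂ :=
  -effectiveLagrangian s m q E B ε φ

/-- Pair-production probability per unit volume and time, to leading order: twice the imaginary part
of the Minkowskian effective Lagrangian. -/
def pairRate (s : ℕ) (m q : ℝ) (E B : Vec3) (ε φ : ℝ) : ℝ :=
  2 * (minkowskiLagrangian s m q E B ε φ).im

/-! ### Closed forms -/

/-- `z / sin z`, continued by `1` to `z = 0`. -/
def divSin (z : ℂ) : ℂ := if z = 0 then 1 else z / Complex.sin z

/-- `z / sinh z`, continued by `1` to `z = 0`. -/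
def divSinh (z : ℂ) : ℂ := if z = 0 then 1 else z / Complex.sinh z

/-- `q² T² K₋ K₊ / (sinh(qTK₊) sin(qTK₋))`. -/
def weisskopfFactor (q : ℝ) (E B : Vec3) (T : ℂ) : ℂ :=
  divSinh ((q : ℂ) * T * (Kplus E B : ℂ)) * divSin ((q : ℂ) * T * (Kminus E B : ℂ))

/-- `1 - 2 cosh(2qTK₊) - 2 cos(2qTK₋)`. -/
def spinOneBracket (q : ℝ) (E B : Vec3) (T : ℂ) : ℂ :=
  1 - 2 * Complex.cosh (2 * (q : ℂ) * T * (Kplus E B : ℂ))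
    - 2 * Complex.cos (2 * (q : ℂ) * T * (Kminus E B : ℂ))

/-- The dilogarithm `Li₂(x) = ∑_{n ≥ 1} xⁿ/n²`, for `|x| ≤ 1`. -/
def dilog (x : ℝ) : ℝ := ∑' n : ℕ, x ^ (n + 1) / ((n : ℝ) + 1) ^ 2

/-! ### Renormalization -/

/-- The terms of order `q⁰` and `q²` of the spin-0 and spin-1 worldline factors, which give the
ultraviolet divergent vacuum energy and photon self-energy. -/
def divergentPart (s : ℕ) (q : ℝ) (F : Matrix (Fin 4) (Fin 4) ℂ) (T : ℂ) : ℂ :=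
  if s = 0 then -1 - 1 / 12 * (q : ℂ) ^ 2 * T ^ 2 * (F ^ 2).trace
  else -3 + 7 / 4 * (q : ℂ) ^ 2 * T ^ 2 * (F ^ 2).trace

/-- The renormalized proper-time integrand. -/
def renormalizedIntegrand (s : ℕ) (m q : ℝ) (F : Matrix (Fin 4) (Fin 4) ℂ) (T : ℂ) : ℂ :=
  properTimeWeight m T * (worldlineFactor s q F T - divergentPart s q F T)

/-- The renormalized Euclidean effective Lagrangian, with the Maxwell term
`(1/4) F_{μν} F^{μν} = -(1/4) tr F²`. -/
def renormalizedLagrangian (s : ℕ) (m q : ℝ) (E B : Vec3) (φ : ℝ) : ℂ :=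
  -(1 / 4) * (fieldStrength E B ^ 2).trace
    + contourIntegral 0 φ (renormalizedIntegrand s m q (fieldStrength E B))

/-- The renormalized Minkowskian effective Lagrangian. -/
def renormalizedMinkowski (s : ℕ) (m q : ℝ) (E B : Vec3) (φ : ℝ) : ℂ :=
  -renormalizedLagrangian s m q E B φ

/-- The fine-structure constant `q²/(4π)`. -/
def fineStructure (q : ℝ) : ℝ := q ^ 2 / (4 * Real.pi)

end

end Worldline

open Worldline

namespace Worldline

/-! Every Gaussian factor reduces to the spectrum of `fieldStrength`, namely ±K₋ and ±iK₊. A null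
field is a nonzero nilpotent matrix, so diagonalization is not available in general. The sliced
operators are instead treated as block matrices A ⊗ 1 + B ⊗ F with commuting blocks, for which
`det_kronecker_one_add` needs only the characteristic polynomial of F. What remains is one scalar
determinant per eigenvalue, a bidiagonal circulant (periodic) or a tridiagonal Toeplitz one
(Dirichlet). Both have closed forms, and (1 + z/n)ⁿ → eᶻ turns them into 2 sinh(μ/2) and sin c / c.
The eigenvalues come in opposite pairs, so the Dirichlet determinant is the square of an entire
function, and its root with value 1 at 0 is unique.

In w = e^{-iθ} the modular integrand is w⁻ˢ times a function holomorphic near 0. Its average over a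
small circle is the Taylor coefficient of order s: -1 for s = 0 and 1 - ∑ uᵢ for s = 1. The
resulting worldline factor depends on q and T only through x = qT; this function is `profile`.

With A = K₊|Re x| and D = K₋|Im x|, the two quotients in `profile` decay like e^{-A-D} and the
spin-1 bracket grows at most like e^{A+D+|A-D|}. Admissibility for s = 1 says exactly that the mass
term beats e^{|A-D|}. For weak fields, `profile` minus its quartic Taylor polynomial is bounded
along a ray by C r⁶ e^{μr}; rescaling r by |q| extracts q⁶, while the quartic term is integrated
exactly (`integral_quartic_contour`).

For B = 0 the spin-1 bracket equals -3 + 4 sin², so spin 1 is three times spin 0 plus a term without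
poles, which becomes real once its contour is rotated to the real axis. The spin-0 contour is
rotated to a vertical half-line. By reflection its imaginary part is half of an integral over a full
vertical line, and pushing this line to the right past all poles produces the series, one jump per
pole (`verticalIntegral_midPole_sub`). -/

/-! ### Block determinants and periodic time-sliced determinants -/

/-- If the characteristic polynomial of `F` is `∏ (x - μ i)`, then the determinant of
`A ⊗ 1 + B ⊗ F` is the product of the determinants of `A + μ i B`. -/
theorem det_kronecker_one_add {n d : ℕ} (A B : Matrix (Fin n) (Fin n) ℂ)
    (F : Matrix (Fin d) (Fin d) ℂ) {ι : Type*} [Fintype ι] (μ : ι → ℂ)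
    (hF : ∀ x : ℂ, (x • (1 : Matrix (Fin d) (Fin d) ℂ) - F).det = ∏ i, (x - μ i))
    (hcard : Fintype.card ι = d) :
    (A ⊗ₖ (1 : Matrix (Fin d) (Fin d) ℂ) + B ⊗ₖ F).det = ∏ i, (A + μ i • B).det := by
  classical
  let M : Matrix (Fin n) (Fin n) (Polynomial ℂ) :=
    A.map Polynomial.C + (Polynomial.X : Polynomial ℂ) • B.map Polynomial.C
  let f : Polynomial ℂ →+* Matrix (Fin d) (Fin d) ℂ := (Polynomial.aeval F).toRingHom
  have hev : ∀ x : ℂ, M.det.eval x = (A + x • B).det := by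
    intro x
    rw [← Polynomial.coe_evalRingHom, RingHom.map_det]
    congr 1
    ext i j
    simp [M, mul_comm x]
  have hcomp : (Matrix.comp (Fin n) (Fin n) (Fin d) (Fin d) ℂ (M.map f)).det =
      (A ⊗ₖ (1 : Matrix (Fin d) (Fin d) ℂ) + B ⊗ₖ F).det := by
    congr 1
    ext ⟨i, k⟩ ⟨j, l⟩
    simp [M, f, Matrix.kroneckerMap_apply, Matrix.algebraMap_eq_diagonal, Matrix.diagonal_apply,
      Matrix.one_apply, Matrix.mul_apply]
  -- All blocks are polynomials in `F` and commute, so the block determinant is det p(F) with p the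
  -- polynomial determinant of `M`.
  rw [← hcomp, ← Matrix.det_det, show f M.det = Polynomial.aeval F M.det from rfl]
  simp_rw [← hev]
  generalize M.det = p
  have key : ∀ x : ℂ, (F - algebraMap ℂ _ x).det = ∏ i, (μ i - x) := by
    intro x
    have h1 : F - algebraMap ℂ _ x = -(x • (1 : Matrix (Fin d) (Fin d) ℂ) - F) := by
      rw [Algebra.algebraMap_eq_smul_one]; abel
    rw [h1, Matrix.det_neg, hF, Fintype.card_fin, ← hcard, ← Finset.card_univ,
      ← Finset.prod_const, ← Finset.prod_mul_distrib]
    exact Finset.prod_congr rfl fun i _ => by ring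
  -- Splitting p into linear factors reduces det p(F) = ∏ p(μ i) to `key` and multiplicativity.
  have hs := IsAlgClosed.splits p
  have hp := hs.eq_prod_roots
  generalize p.roots = s at hp
  generalize p.leadingCoeff = a at hp
  subst hp
  have h2 : ∀ s : Multiset ℂ,
      (Polynomial.aeval F (s.map fun a => Polynomial.X - Polynomial.C a).prod).det =
        ∏ i, ((s.map fun a => Polynomial.X - Polynomial.C a).prod).eval (μ i) := by
    intro s
    induction s using Multiset.induction with
    | empty => simp
    | cons a s ih =>
      simp [Multiset.map_cons, Multiset.prod_cons, Matrix.det_mul, ih, Finset.prod_mul_distrib,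
        key]
  rw [map_mul, Matrix.det_mul, h2]
  simp [Finset.prod_mul_distrib, Matrix.algebraMap_eq_diagonal, Matrix.det_diagonal, hcard]

/-- The determinant of the bidiagonal circulant matrix `a I + b S`, `S` the cyclic shift. -/
theorem det_cyclic_bidiagonal (a b : ℂ) (N : ℕ) :
    (Matrix.of fun i j : Fin (N + 2) =>
      a * (if j = i then 1 else 0) + b * (if j = i - 1 then 1 else 0)).det =
      a ^ (N + 2) - (-b) ^ (N + 2) := by
  have hlast : (0 : Fin (N + 2)) - 1 = Fin.last (N + 1) := by
    rw [sub_eq_iff_eq_add, Fin.last_add_one]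
  have hsucc : ∀ i : Fin (N + 1), i.succ - 1 = i.castSucc := fun i => by
    rw [sub_eq_iff_eq_add, Fin.coeSucc_eq_succ]
  -- Row 0 meets only the diagonal and, by cyclicity, the last column; the two remaining minors are
  -- triangular.
  rw [Matrix.det_succ_row_zero, Fin.sum_univ_succ, Fin.sum_univ_castSucc]
  have hz : ∀ j : Fin N, (-1 : ℂ) ^ ((j.castSucc.succ : Fin (N + 2)) : ℕ) *
      (Matrix.of fun i j : Fin (N + 2) =>
        a * (if j = i then 1 else 0) + b * (if j = i - 1 then 1 else 0)) 0 j.castSucc.succ *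
      ((Matrix.of fun i j : Fin (N + 2) =>
        a * (if j = i then 1 else 0) + b * (if j = i - 1 then 1 else 0)).submatrix Fin.succ
          (Fin.succAbove j.castSucc.succ)).det = 0 := by
    intro j
    have h1 : j.castSucc.succ ≠ Fin.last (N + 1) := by
      intro h
      have := congrArg Fin.val h
      simp at this
      omega
    simp [hlast, h1, Fin.succ_ne_zero]
  rw [Finset.sum_eq_zero fun j _ => hz j, zero_add]
  have h0 : ((Matrix.of fun i j : Fin (N + 2) =>
        a * (if j = i then 1 else 0) + b * (if j = i - 1 then 1 else 0)).submatrix Fin.succ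
          (Fin.succAbove 0)).det = a ^ (N + 1) := by
    rw [Matrix.det_of_isLowerTriangular]
    · simp [hsucc, Fin.ext_iff]
    · intro i j hij
      have hij' : i < j := hij
      simp [hsucc, Fin.ext_iff, (show ¬((j : ℕ) = i) by omega), (show ¬((j : ℕ) + 1 = i) by omega)]
  have h1 : ((Matrix.of fun i j : Fin (N + 2) =>
        a * (if j = i then 1 else 0) + b * (if j = i - 1 then 1 else 0)).submatrix Fin.succ
          (Fin.succAbove (Fin.last N).succ)).det = b ^ (N + 1) := by
    rw [Fin.succ_last, Fin.succAbove_last, Matrix.det_of_isUpperTriangular]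
    · simp [hsucc, Fin.ext_iff]
    · intro i j hij
      have hij' : j < i := hij
      simp [hsucc, Fin.ext_iff, (show ¬((j : ℕ) = i) by omega), (show ¬((j : ℕ) = i + 1) by omega)]
  rw [h0, h1]
  simp [hlast, Fin.ext_iff]
  ring

theorem circleD_add_smul_circleAvg_det (μ : ℂ) (N : ℕ) :
    (circleD (N + 1) + μ • circleAvg (N + 1)).det =
      ((N : ℂ) + 2 + μ / 2) ^ (N + 2) - ((N : ℂ) + 2 - μ / 2) ^ (N + 2) := by
  have h : circleD (N + 1) + μ • circleAvg (N + 1) = Matrix.of fun i j : Fin (N + 2) =>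
      ((N : ℂ) + 2 + μ / 2) * (if j = i then 1 else 0) +
        (-((N : ℂ) + 2 - μ / 2)) * (if j = i - 1 then 1 else 0) := by
    ext i j
    simp only [circleD, circleAvg, Matrix.add_apply, Matrix.smul_apply, smul_eq_mul,
      Matrix.of_apply]
    push_cast
    ring
  rw [h, det_cyclic_bidiagonal, neg_neg]

/-- The product of 1 - ζᵏ over the nontrivial roots of unity equals their order N + 1, which raises
the power of N + 1 from N to N + 1. -/
theorem circleFreeDet_eq (N : ℕ) : circleFreeDet N = ((N : ℂ) + 1) ^ (N + 1) := by
  have hp := (Complex.isPrimitiveRoot_exp (N + 1) N.succ_ne_zero).prod_one_sub_pow_eq_order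
  have h : ∏ k ∈ Finset.range N,
      (1 - Complex.exp (2 * Real.pi * Complex.I * ((k : ℂ) + 1) / ((N : ℂ) + 1))) = N + 1 := by
    refine Eq.trans ?_ hp
    refine Finset.prod_congr rfl fun k _ => ?_
    rw [← Complex.exp_nat_mul]
    congr 2
    push_cast
    ring
  rw [circleFreeDet, Finset.prod_mul_distrib, Finset.prod_const, Finset.card_range, pow_succ, h]

/-- The continuum limit of the determinant of `d/dτ + M` is the product of `2 sinh (μ / 2)` over the
eigenvalues `μ` of `M`. -/
theorem tendsto_circleDetSliced {d : ℕ} (M : Matrix (Fin d) (Fin d) ℂ) (μ : Fin d → ℂ)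
    (hM : ∀ x : ℂ, (x • (1 : Matrix (Fin d) (Fin d) ℂ) - M).det = ∏ i, (x - μ i)) :
    Tendsto (circleDetSliced M) atTop (𝓝 (∏ i, (2 * Complex.sinh (μ i / 2)))) := by
  -- The circulant formula is stated for at least two sites, hence the shift by one.
  rw [← tendsto_add_atTop_iff_nat 1]
  have h : ∀ N : ℕ, circleDetSliced M (N + 1) =
      ∏ i, ((1 + μ i / 2 / ((N + 2 : ℕ) : ℂ)) ^ (N + 2) -
        (1 + -(μ i / 2) / ((N + 2 : ℕ) : ℂ)) ^ (N + 2)) := by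
    intro N
    have hN : ((N + 2 : ℕ) : ℂ) ≠ 0 := by exact_mod_cast (Nat.succ_ne_zero (N + 1))
    rw [circleDetSliced, det_kronecker_one_add _ _ M μ hM (Fintype.card_fin d), circleFreeDet_eq]
    have h2 : ((((N + 1 : ℕ) : ℂ) + 1) ^ (N + 1 + 1)) ^ d =
        ∏ _i : Fin d, ((N + 2 : ℕ) : ℂ) ^ (N + 2) := by
      simp only [Finset.prod_const, Finset.card_univ, Fintype.card_fin]
      push_cast
      ring
    rw [h2, ← Finset.prod_div_distrib]
    refine Finset.prod_congr rfl fun i _ => ?_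
    rw [circleD_add_smul_circleAvg_det, sub_div, ← div_pow, ← div_pow]
    push_cast at hN ⊢
    congr 2 <;> field_simp
    ring
  simp_rw [h]
  refine tendsto_finsetProd _ fun i _ => ?_
  have h1 := (Complex.tendsto_one_add_div_pow_exp (μ i / 2)).comp (tendsto_add_atTop_nat 2)
  have h2 := (Complex.tendsto_one_add_div_pow_exp (-(μ i / 2))).comp (tendsto_add_atTop_nat 2)
  rw [Complex.two_sinh]
  exact h1.sub h2

/-! ### Tridiagonal determinants and the Dirichlet continuum limit -/

/-- The tridiagonal Toeplitz matrix with entries `c`, `a`, `b` below, on and above the diagonal. -/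
def tridiagonal (a b c : ℂ) (N : ℕ) : Matrix (Fin N) (Fin N) ℂ := Matrix.of fun i j =>
  if (j : ℕ) = i + 1 then b else if (i : ℕ) = j + 1 then c else if i = j then a else 0

theorem tridiagonal_det_succ_succ (a b c : ℂ) (N : ℕ) :
    (tridiagonal a b c (N + 2)).det =
      a * (tridiagonal a b c (N + 1)).det - b * c * (tridiagonal a b c N).det := by
  rw [Matrix.det_succ_row_zero, Fin.sum_univ_succ, Fin.sum_univ_succ]
  have hz : ∀ j : Fin N, (-1 : ℂ) ^ ((j.succ.succ : Fin (N + 2)) : ℕ) *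
      tridiagonal a b c (N + 2) 0 j.succ.succ * ((tridiagonal a b c (N + 2)).submatrix Fin.succ
          (Fin.succAbove j.succ.succ)).det = 0 := by
    intro j
    simp [tridiagonal, Fin.ext_iff]
  have h0 : (tridiagonal a b c (N + 2)).submatrix Fin.succ (Fin.succAbove 0) =
      tridiagonal a b c (N + 1) := by
    ext i j
    simp [tridiagonal, Fin.ext_iff]
  have h1 : ((tridiagonal a b c (N + 2)).submatrix Fin.succ
      (Fin.succAbove (Fin.succ 0))).det = c * (tridiagonal a b c N).det := by
    rw [Matrix.det_succ_column_zero, Fin.sum_univ_succ]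
    have hz' : ∀ j : Fin N, (-1 : ℂ) ^ ((j.succ : Fin (N + 1)) : ℕ) *
        (tridiagonal a b c (N + 2)).submatrix Fin.succ (Fin.succAbove (Fin.succ 0)) j.succ 0 *
        (((tridiagonal a b c (N + 2)).submatrix Fin.succ
          (Fin.succAbove (Fin.succ 0))).submatrix (Fin.succAbove j.succ) Fin.succ).det = 0 := by
      intro j
      simp [tridiagonal, Fin.ext_iff]
    have h2 : ((tridiagonal a b c (N + 2)).submatrix Fin.succ
        (Fin.succAbove (Fin.succ 0))).submatrix (Fin.succAbove 0) Fin.succ =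
        tridiagonal a b c N := by
      ext i j
      have : (Fin.succAbove (1 : Fin (N + 2)) j.succ) = j.succ.succ := by
        rw [Fin.succAbove_of_le_castSucc]
        simp [Fin.le_def]
      simp [tridiagonal, Fin.ext_iff, this]
    rw [Finset.sum_eq_zero fun j _ => hz' j, h2]
    simp [tridiagonal]
  rw [Finset.sum_eq_zero fun j _ => hz j, h0, h1]
  simp [tridiagonal]
  ring

/-- `r` and `s` are the characteristic roots of the three-term recursion. The factor r - s stays on
the left to avoid division; the identity is empty at a double root, which is why the free operator
is computed separately in `tridiagonal_det_two`. -/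
theorem tridiagonal_det_mul_sub (a b c r s : ℂ) (ha : r + s = a) (hbc : r * s = b * c) (N : ℕ) :
    (tridiagonal a b c N).det * (r - s) = r ^ (N + 1) - s ^ (N + 1) := by
  induction N using Nat.strong_induction_on with
  | _ N ih =>
    match N with
    | 0 => simp
    | 1 => simp [tridiagonal, ← ha]; ring
    | N + 2 =>
      rw [tridiagonal_det_succ_succ, sub_mul, mul_assoc, mul_assoc, ih (N + 1) (by omega),
        ih N (by omega), ← ha, ← hbc]
      ring

theorem tridiagonal_det_two (N : ℕ) (x : ℂ) :
    (tridiagonal (2 * x) (-x) (-x) N).det = (N + 1) * x ^ N := by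
  induction N using Nat.strong_induction_on with
  | _ N ih =>
    match N with
    | 0 => simp
    | 1 => simp [tridiagonal, one_add_one_eq_two]
    | N + 2 =>
      rw [tridiagonal_det_succ_succ, ih (N + 1) (by omega), ih N (by omega)]
      push_cast
      ring

/-- `sin z / z`, continued by `1` to `z = 0`. -/
noncomputable def sinc (z : ℂ) : ℂ := if z = 0 then 1 else Complex.sin z / z

/-- `sinh z / z`, continued by `1` to `z = 0`. -/
noncomputable def sinhc (z : ℂ) : ℂ := if z = 0 then 1 else Complex.sinh z / z

theorem coordBlock_eq (N : ℕ) (t : ℂ) :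
    -latticeD2 N + t • latticeD1 N = tridiagonal (2 * ((N : ℂ) + 1) ^ 2)
      (-((N : ℂ) + 1) ^ 2 + t * ((N + 1) / 2)) (-((N : ℂ) + 1) ^ 2 - t * ((N + 1) / 2)) N := by
  ext i j
  simp only [latticeD1, latticeD2, tridiagonal, Matrix.add_apply, Matrix.neg_apply,
    Matrix.smul_apply, Matrix.of_apply, smul_eq_mul]
  by_cases h1 : (j : ℕ) = i + 1
  · simp [h1]
  · by_cases h2 : (i : ℕ) = j + 1
    · have h1' : ¬(j : ℕ) = j + 1 + 1 := by omega
      simp [h2, h1']; ring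
    · by_cases h3 : i = j
      · subst h3; simp; ring
      · simp [h1, h2, h3]

/-- With n = N + 1 the characteristic roots are n² ± i c n. Dividing by the free value n · n^{2N}
leaves ((1 + ic/n)ⁿ - (1 - ic/n)ⁿ)/(2ic). At c = 0 the roots coincide and the ratio is identically
1. -/
theorem tendsto_coordBlock_det (c : ℂ) :
    Tendsto (fun N : ℕ => (-latticeD2 N + (-(2 * Complex.I * c)) • latticeD1 N).det /
      (-latticeD2 N + (0 : ℂ) • latticeD1 N).det) atTop (𝓝 (sinc c)) := by
  have hN : ∀ N : ℕ, (N : ℂ) + 1 ≠ 0 := fun N => by exact_mod_cast N.succ_ne_zero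
  have hfree : ∀ N : ℕ, (-latticeD2 N + (0 : ℂ) • latticeD1 N).det =
      (N + 1) * (((N : ℂ) + 1) ^ 2) ^ N := by
    intro N
    rw [coordBlock_eq, zero_mul, add_zero, sub_zero, tridiagonal_det_two]
  by_cases hc : c = 0
  · subst hc
    refine tendsto_const_nhds.congr fun N => ?_
    rw [mul_zero, neg_zero, div_self, sinc, if_pos rfl]
    rw [hfree]
    exact mul_ne_zero (hN N) (pow_ne_zero _ (pow_ne_zero _ (hN N)))
  · have h : ∀ N : ℕ, (-latticeD2 N + (-(2 * Complex.I * c)) • latticeD1 N).det /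
        (-latticeD2 N + (0 : ℂ) • latticeD1 N).det =
        ((1 + Complex.I * c / ((N + 1 : ℕ) : ℂ)) ^ (N + 1) -
          (1 + -(Complex.I * c) / ((N + 1 : ℕ) : ℂ)) ^ (N + 1)) / (2 * Complex.I * c) := by
      intro N
      have h2 : (2 * Complex.I * c) ≠ 0 := by simp [hc]
      have h3 := tridiagonal_det_mul_sub (2 * ((N : ℂ) + 1) ^ 2)
        (-((N : ℂ) + 1) ^ 2 + -(2 * Complex.I * c) * ((N + 1) / 2))
        (-((N : ℂ) + 1) ^ 2 - -(2 * Complex.I * c) * ((N + 1) / 2))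
        (((N : ℂ) + 1) ^ 2 + Complex.I * c * (N + 1)) (((N : ℂ) + 1) ^ 2 - Complex.I * c * (N + 1))
        (by ring) (by ring) N
      rw [hfree, coordBlock_eq, eq_div_iff h2, div_mul_eq_mul_div,
        div_eq_iff (mul_ne_zero (hN N) (pow_ne_zero _ (pow_ne_zero _ (hN N))))]
      have h4 : ∀ t : ℂ, (1 + t / ((N + 1 : ℕ) : ℂ)) ^ (N + 1) *
          (((N : ℂ) + 1) ^ 2 * (((N : ℂ) + 1) ^ 2) ^ N) =
            (((N : ℂ) + 1) ^ 2 + t * (N + 1)) ^ (N + 1) := by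
        intro t
        rw [← pow_succ', ← mul_pow]
        congr 1
        have := hN N
        push_cast
        field_simp
      have h5 := h4 (Complex.I * c)
      have h6 := h4 (-(Complex.I * c))
      apply mul_right_cancel₀ (hN N)
      rw [show (((N : ℂ) + 1) ^ 2 - Complex.I * c * (N + 1)) =
        (((N : ℂ) + 1) ^ 2 + -(Complex.I * c) * (N + 1)) by ring, ← h5, ← h6] at h3
      linear_combination h3
    simp_rw [h]
    have h1 := (Complex.tendsto_one_add_div_pow_exp (Complex.I * c)).comp (tendsto_add_atTop_nat 1)
    have h2 := (Complex.tendsto_one_add_div_pow_exp (-(Complex.I * c))).comp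
      (tendsto_add_atTop_nat 1)
    have h3 : sinc c = (Complex.exp (Complex.I * c) - Complex.exp (-(Complex.I * c))) /
        (2 * Complex.I * c) := by
      rw [sinc, if_neg hc, Complex.sin, mul_comm Complex.I c, neg_mul]
      have := Complex.I_sq
      field_simp
      rw [this]
      ring
    rw [h3]
    exact (h1.sub h2).div_const _

/-! ### Spectrum of the field strength and the coordinate determinant -/

/-- The eigenvalues `±K₋`, `±i K₊` of the field strength. -/
noncomputable def fieldEigenvalue (E B : Vec3) : Fin 4 → ℂ :=
  ![(Kminus E B : ℂ), -(Kminus E B : ℂ), Complex.I * (Kplus E B : ℂ),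
    -(Complex.I * (Kplus E B : ℂ))]

theorem abs_maxwellF_le (E B : Vec3) :
    |maxwellF E B| ≤ √(maxwellF E B ^ 2 + maxwellG E B ^ 2) :=
  Real.abs_le_sqrt (by nlinarith [sq_nonneg (maxwellG E B)])

theorem Kplus_sq (E B : Vec3) :
    Kplus E B ^ 2 = √(maxwellF E B ^ 2 + maxwellG E B ^ 2) + maxwellF E B :=
  Real.sq_sqrt (by linarith [neg_abs_le (maxwellF E B), abs_maxwellF_le E B])

theorem Kminus_sq (E B : Vec3) :
    Kminus E B ^ 2 = √(maxwellF E B ^ 2 + maxwellG E B ^ 2) - maxwellF E B :=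
  Real.sq_sqrt (by linarith [le_abs_self (maxwellF E B), abs_maxwellF_le E B])

theorem Kplus_sq_sub_Kminus_sq (E B : Vec3) :
    Kplus E B ^ 2 - Kminus E B ^ 2 = ‖B‖ ^ 2 - ‖E‖ ^ 2 := by
  rw [Kplus_sq, Kminus_sq, maxwellF]; ring

theorem Kplus_sq_mul_Kminus_sq (E B : Vec3) :
    Kplus E B ^ 2 * Kminus E B ^ 2 = inner ℝ E B ^ 2 := by
  have h := Real.sq_sqrt (add_nonneg (sq_nonneg (maxwellF E B)) (sq_nonneg (maxwellG E B)))
  rw [Kplus_sq, Kminus_sq]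
  rw [← maxwellG]
  linear_combination h

theorem inner_eq_sum (E B : Vec3) : inner ℝ E B = E 0 * B 0 + E 1 * B 1 + E 2 * B 2 := by
  simp [PiLp.inner_apply, Fin.sum_univ_three]
  ring

theorem norm_sq_eq_sum (E : Vec3) : ‖E‖ ^ 2 = E 0 ^ 2 + E 1 ^ 2 + E 2 ^ 2 := by
  rw [EuclideanSpace.norm_sq_eq]
  simp [Fin.sum_univ_three]

/-- Both sides are x⁴ + (B² - E²)x² - (E·B)²: the coefficients are the difference and the product of
K₊² and K₋². -/
theorem fieldStrength_charpoly (E B : Vec3) (x : ℂ) :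
    (x • (1 : Matrix (Fin 4) (Fin 4) ℂ) - fieldStrength E B).det =
      ∏ i, (x - fieldEigenvalue E B i) := by
  have h1 := congrArg (Complex.ofReal) (Kplus_sq_sub_Kminus_sq E B)
  have h2 := congrArg (Complex.ofReal) (Kplus_sq_mul_Kminus_sq E B)
  rw [norm_sq_eq_sum, norm_sq_eq_sum] at h1
  rw [inner_eq_sum] at h2
  push_cast at h1 h2
  have hr : ∏ i, (x - fieldEigenvalue E B i) = x ^ 4 +
      ((Kplus E B : ℂ) ^ 2 - (Kminus E B : ℂ) ^ 2) * x ^ 2 -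
        (Kplus E B : ℂ) ^ 2 * (Kminus E B : ℂ) ^ 2 := by
    simp only [fieldEigenvalue, Fin.prod_univ_four, Matrix.cons_val]
    linear_combination (-(x ^ 2 - (Kminus E B : ℂ) ^ 2) * (Kplus E B : ℂ) ^ 2) * Complex.I_sq
  rw [hr, h1, h2]
  simp [fieldStrength, Matrix.det_succ_row_zero, Fin.sum_univ_succ, Matrix.one_apply,
    Fin.succAbove]
  ring_nf
  simp only [Complex.I_sq]
  ring

/-- Difference quotients of holomorphic functions have removable singularities, so this form makes
`sinc` entire. -/
theorem sinc_eq_dslope : sinc = dslope Complex.sin 0 := by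
  funext z
  by_cases hz : z = 0
  · subst hz; simp [sinc]
  · rw [dslope_of_ne _ hz, slope_def_field]; simp [sinc, hz]

theorem differentiable_sinc : Differentiable ℂ sinc := by
  rw [sinc_eq_dslope, ← differentiableOn_univ, Complex.differentiableOn_dslope univ_mem]
  exact Complex.differentiable_sin.differentiableOn

theorem sinhc_eq_sinc (z : ℂ) : sinhc z = sinc (Complex.I * z) := by
  by_cases hz : z = 0
  · subst hz; simp [sinc, sinhc]
  · rw [sinc, sinhc, if_neg hz, if_neg (by simp [hz]), mul_comm Complex.I, Complex.sin_mul_I]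
    field_simp

theorem differentiable_sinhc : Differentiable ℂ sinhc := by
  rw [funext sinhc_eq_sinc]
  exact differentiable_sinc.comp (differentiable_id.const_mul _)

theorem sinc_neg (z : ℂ) : sinc (-z) = sinc z := by simp [sinc]

theorem divSin_eq_inv (z : ℂ) : divSin z = (sinc z)⁻¹ := by
  by_cases hz : z = 0 <;> simp [divSin, sinc, hz]

theorem divSinh_eq_inv (z : ℂ) : divSinh z = (sinhc z)⁻¹ := by
  by_cases hz : z = 0 <;> simp [divSinh, sinhc, hz]

/-- `sinc` is even, so opposite eigenvalues contribute equal factors; this is what makes the limit a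
perfect square. -/
theorem tendsto_coordDetSliced (q : ℝ) (E B : Vec3) (T : ℂ) :
    Tendsto (coordDetSliced q (fieldStrength E B) T) atTop
      (𝓝 ((sinc (q * T * Kminus E B) * sinhc (q * T * Kplus E B)) ^ 2)) := by
  have hop : ∀ (q : ℝ) (N : ℕ), (coordOperator q (fieldStrength E B) T N).det =
      ∏ i, (-latticeD2 N +
        (-(2 * Complex.I * (q * T * fieldEigenvalue E B i))) • latticeD1 N).det := by
    intro q N
    have h : coordOperator q (fieldStrength E B) T N =
        (-latticeD2 N) ⊗ₖ (1 : Matrix (Fin 4) (Fin 4) ℂ) +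
          (-(2 * Complex.I * q * T) • latticeD1 N) ⊗ₖ fieldStrength E B := by
      rw [coordOperator, Matrix.smul_kronecker, neg_smul, sub_eq_add_neg]
    rw [h, det_kronecker_one_add _ _ _ _ (fieldStrength_charpoly E B) (Fintype.card_fin 4)]
    refine Finset.prod_congr rfl fun i _ => ?_
    rw [smul_smul]
    congr 3
    ring
  have h : ∀ N, coordDetSliced q (fieldStrength E B) T N =
      ∏ i, ((-latticeD2 N +
        (-(2 * Complex.I * (q * T * fieldEigenvalue E B i))) • latticeD1 N).det /
          (-latticeD2 N + (0 : ℂ) • latticeD1 N).det) := by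
    intro N
    rw [coordDetSliced, hop, hop, ← Finset.prod_div_distrib]
    simp
  rw [funext h]
  have h2 := tendsto_finsetProd Finset.univ
    fun (i : Fin 4) _ => tendsto_coordBlock_det (q * T * fieldEigenvalue E B i)
  convert h2 using 2
  rw [Fin.prod_univ_four]
  simp only [fieldEigenvalue, Matrix.cons_val, mul_neg, sinc_neg, sinhc_eq_sinc]
  rw [mul_left_comm Complex.I (q * T : ℂ)]
  ring

theorem coordDet_eq (q : ℝ) (E B : Vec3) (T : ℂ) :
    coordDet q (fieldStrength E B) T =
      (sinc (q * T * Kminus E B) * sinhc (q * T * Kplus E B)) ^ 2 :=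
  (tendsto_coordDetSliced q E B T).limUnder_eq

/-- Entire functions with equal squares which agree at a point where they do not vanish are
equal. -/
theorem eq_of_sq_eq_sq {g h : ℂ → ℂ} (hg : Differentiable ℂ g) (hh : Differentiable ℂ h)
    (hsq : ∀ z, g z ^ 2 = h z ^ 2) (h0 : g 0 = h 0) (hne : h 0 ≠ 0) : g = h := by
  have hgA : AnalyticOnNhd ℂ g Set.univ := fun z _ => hg.analyticAt z
  have hhA : AnalyticOnNhd ℂ h Set.univ := fun z _ => hh.analyticAt z
  have hev : g =ᶠ[𝓝 0] h := by
    have hc : ContinuousAt (fun z => g z + h z) 0 := (hg.continuous.add hh.continuous).continuousAt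
    have hne' : g 0 + h 0 ≠ 0 := by
      rw [h0, ← two_mul]; exact mul_ne_zero two_ne_zero hne
    filter_upwards [hc.eventually_ne hne'] with z hz
    -- Near 0 the sum g + h does not vanish, so g = h there; the identity theorem then extends the
    -- equality.
    have : (g z - h z) * (g z + h z) = 0 := by linear_combination hsq z
    exact sub_eq_zero.1 ((mul_eq_zero.1 this).resolve_right hz)
  exact hgA.eq_of_eventuallyEq hhA hev

/-- The definition selects a root by choice; uniqueness allows any explicit normalized root to
replace it. -/
theorem analyticSqrt_sq {g : ℂ → ℂ} (hg : Differentiable ℂ g) (h0 : g 0 = 1) :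
    analyticSqrt (fun z => g z ^ 2) = g := by
  have hex : ∃ f : ℂ → ℂ, Differentiable ℂ f ∧ f 0 = 1 ∧ ∀ z, f z ^ 2 = g z ^ 2 :=
    ⟨g, hg, h0, fun _ => rfl⟩
  rw [analyticSqrt, dif_pos hex]
  obtain ⟨h1, h2, h3⟩ := hex.choose_spec
  exact eq_of_sq_eq_sq h1 hg h3 (h2.trans h0.symm) (by rw [h0]; exact one_ne_zero)

theorem differentiable_sinc_mul_sinhc (q : ℝ) (E B : Vec3) :
    Differentiable ℂ fun T : ℂ => sinc (q * T * Kminus E B) * sinhc (q * T * Kplus E B) :=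
  (differentiable_sinc.comp ((differentiable_id.const_mul _).mul_const _)).mul
    (differentiable_sinhc.comp ((differentiable_id.const_mul _).mul_const _))

theorem sqrtCoordDet_eq (q : ℝ) (E B : Vec3) :
    sqrtCoordDet q (fieldStrength E B) =
      fun T : ℂ => sinc (q * T * Kminus E B) * sinhc (q * T * Kplus E B) := by
  rw [sqrtCoordDet, funext (coordDet_eq q E B)]
  exact analyticSqrt_sq (differentiable_sinc_mul_sinhc q E B) (by simp [sinc, sinhc])

theorem inv_sqrtCoordDet (q : ℝ) (E B : Vec3) (T : ℂ) :
    (sqrtCoordDet q (fieldStrength E B) T)⁻¹ = weisskopfFactor q E B T := by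
  rw [sqrtCoordDet_eq, weisskopfFactor, divSin_eq_inv, divSinh_eq_inv, mul_inv, mul_comm]

theorem tendsto_circleDetSliced_oscMatrix (q : ℝ) (E B : Vec3) (T θ : ℂ) :
    Tendsto (circleDetSliced (oscMatrix q (fieldStrength E B) T θ)) atTop
      (𝓝 (∏ i, (2 * Complex.sinh
        ((Complex.I * θ + 2 * Complex.I * q * T * fieldEigenvalue E B i) / 2)))) := by
  refine tendsto_circleDetSliced _ _ fun x => ?_
  -- Otherwise the coefficient of F can be divided out, and the eigenvalues are affine images of
  -- those of F.
  by_cases ha : 2 * Complex.I * q * T = 0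
  · have : (x • (1 : Matrix (Fin 4) (Fin 4) ℂ) - oscMatrix q (fieldStrength E B) T θ) =
        (x - Complex.I * θ) • (1 : Matrix (Fin 4) (Fin 4) ℂ) := by
      rw [oscMatrix, ha, zero_smul, add_zero, sub_smul]
    rw [this, ha, Matrix.det_smul, Matrix.det_one]
    simp
  · have : (x • (1 : Matrix (Fin 4) (Fin 4) ℂ) - oscMatrix q (fieldStrength E B) T θ) =
        (2 * Complex.I * q * T) •
          (((x - Complex.I * θ) / (2 * Complex.I * q * T)) • (1 : Matrix (Fin 4) (Fin 4) ℂ) -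
            fieldStrength E B) := by
      rw [oscMatrix, smul_sub, smul_smul, mul_div_cancel₀ _ ha, sub_smul]
      abel
    rw [this, Matrix.det_smul, fieldStrength_charpoly, ← Finset.card_univ, ← Finset.prod_const,
      ← Finset.prod_mul_distrib]
    refine Finset.prod_congr rfl fun i _ => ?_
    rw [mul_sub, mul_div_cancel₀ _ ha]
    ring

theorem circleDet_oscMatrix (q : ℝ) (E B : Vec3) (T θ : ℂ) :
    circleDet (oscMatrix q (fieldStrength E B) T θ) = ∏ i, (2 * Complex.sinh
        ((Complex.I * θ + 2 * Complex.I * q * T * fieldEigenvalue E B i) / 2)) :=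
  (tendsto_circleDetSliced_oscMatrix q E B T θ).limUnder_eq

theorem tendsto_circleDetSliced_scalar (θ : ℂ) :
    Tendsto (circleDetSliced (fun _ _ : Fin 1 => Complex.I * θ)) atTop
      (𝓝 (2 * Complex.sinh (Complex.I * θ / 2))) := by
  have h := tendsto_circleDetSliced (fun _ _ : Fin 1 => Complex.I * θ) (fun _ => Complex.I * θ)
    (fun x => by
      rw [Matrix.det_unique]
      change x • (1 : Matrix (Fin 1) (Fin 1) ℂ) 0 0 - Complex.I * θ = _
      simp)
  simpa using h

theorem scalarDet_eq (θ : ℂ) : scalarDet θ = 2 * Complex.sinh (Complex.I * θ / 2) :=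
  (tendsto_circleDetSliced_scalar θ).limUnder_eq

theorem trace_fieldStrength_sq (E B : Vec3) :
    (fieldStrength E B ^ 2).trace = 2 * ((Kminus E B : ℂ) ^ 2 - (Kplus E B : ℂ) ^ 2) := by
  have h1 := congrArg (Complex.ofReal) (Kplus_sq_sub_Kminus_sq E B)
  rw [norm_sq_eq_sum, norm_sq_eq_sum] at h1
  push_cast at h1
  rw [← neg_sub, h1]
  simp [fieldStrength, Matrix.trace, sq, Fin.sum_univ_four]
  ring_nf
  simp only [Complex.I_sq]
  ring

theorem trace_fieldStrength_pow_four (E B : Vec3) :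
    (fieldStrength E B ^ 4).trace = 2 * ((Kminus E B : ℂ) ^ 4 + (Kplus E B : ℂ) ^ 4) := by
  have h1 := congrArg (Complex.ofReal) (Kplus_sq_sub_Kminus_sq E B)
  have h2 := congrArg (Complex.ofReal) (Kplus_sq_mul_Kminus_sq E B)
  rw [norm_sq_eq_sum, norm_sq_eq_sum] at h1
  rw [inner_eq_sum] at h2
  push_cast at h1 h2
  have hr : 2 * ((Kminus E B : ℂ) ^ 4 + (Kplus E B : ℂ) ^ 4) =
    2 * ((Kplus E B : ℂ) ^ 2 - (Kminus E B : ℂ) ^ 2) ^ 2 +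
      4 * ((Kplus E B : ℂ) ^ 2 * (Kminus E B : ℂ) ^ 2) := by ring
  have hM : fieldStrength E B ^ 4 =
      (fieldStrength E B * fieldStrength E B) * (fieldStrength E B * fieldStrength E B) := by
    rw [← sq, ← sq, ← pow_mul]
  rw [hr, h1, h2, hM]
  simp [fieldStrength, Matrix.trace, Fin.sum_univ_four]
  ring_nf
  simp only [Complex.I_sq, Complex.I_pow_four]
  ring

/-! ### The modular integral as a Taylor coefficient in the Wilson variable -/

/-- The integrand over the modulus, in terms of the Wilson variable `w`, without the factor
`w⁻ˢ`. -/
noncomputable def wilsonFunction (u : Fin 4 → ℂ) (w : ℂ) : ℂ :=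
  -((1 - w) * (∏ i, (1 - w * u i))⁻¹)

/-- Each determinant becomes a phase times a factor linear in w = e^{-iθ}. -/
theorem two_sinh_half (a : ℂ) :
    2 * Complex.sinh (a / 2) = Complex.exp (a / 2) * (1 - Complex.exp (-a)) := by
  rw [Complex.two_sinh, mul_sub, ← Complex.exp_add, mul_one]
  congr 2
  ring

theorem sum_fieldEigenvalue (E B : Vec3) : ∑ i, fieldEigenvalue E B i = 0 := by
  simp [Fin.sum_univ_four, fieldEigenvalue]

/-- F is traceless, so the four phases e^{μ/2} combine to e^{2iθ} without dependence on the field.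
-/
theorem circleDet_oscMatrix_eq (q : ℝ) (E B : Vec3) (T θ : ℂ) :
    circleDet (oscMatrix q (fieldStrength E B) T θ) = Complex.exp (2 * Complex.I * θ) *
      ∏ i, (1 - Complex.exp (-(Complex.I * θ)) *
        Complex.exp (-(2 * Complex.I * q * T * fieldEigenvalue E B i))) := by
  simp_rw [circleDet_oscMatrix, two_sinh_half, Finset.prod_mul_distrib, ← Complex.exp_sum,
    ← Complex.exp_add, ← neg_add]
  congr 2
  rw [← Finset.sum_div, Finset.sum_add_distrib, ← Finset.mul_sum Finset.univ (fieldEigenvalue E B),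
    sum_fieldEigenvalue]
  simp
  ring

/-- The Chern–Simons coupling 3/2 + s is tuned to this: e^{i(3/2+s)θ} times the surviving ghost
phase e^{iθ/2}, divided by e^{2iθ}, is w⁻ˢ. The condition w ≠ 1 permits cancelling one ghost
determinant against that of the β oscillator. -/
theorem modularIntegrand_eq (s : ℕ) (q : ℝ) (E B : Vec3) (T θ : ℂ)
    (hθ : Complex.exp (-(Complex.I * θ)) ≠ 1) :
    modularIntegrand s q (fieldStrength E B) T θ =
      (Complex.exp (-(Complex.I * θ)))⁻¹ ^ s *
        wilsonFunction (fun i => Complex.exp (-(2 * Complex.I * q * T * fieldEigenvalue E B i)))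
          (Complex.exp (-(Complex.I * θ))) := by
  have h1 : scalarDet θ = Complex.exp (Complex.I * θ / 2) *
      (1 - Complex.exp (-(Complex.I * θ))) := by rw [scalarDet_eq, two_sinh_half]
  have h2 : scalarDet (-θ) = -scalarDet θ := by
    rw [scalarDet_eq, scalarDet_eq, mul_neg, neg_div, Complex.sinh_neg, mul_neg]
  have h3 : scalarDet θ ≠ 0 := by
    rw [h1]
    exact mul_ne_zero (Complex.exp_ne_zero _) (sub_ne_zero.2 hθ.symm)
  have h4 : Complex.exp (Complex.I * (3 / 2 + (s : ℂ)) * θ) * Complex.exp (Complex.I * θ / 2) =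
      (Complex.exp (-(Complex.I * θ)))⁻¹ ^ s * Complex.exp (2 * Complex.I * θ) := by
    rw [← Complex.exp_neg, neg_neg, ← Complex.exp_nat_mul, ← Complex.exp_add, ← Complex.exp_add]
    congr 1
    ring
  rw [modularIntegrand, circleDet_oscMatrix_eq, h2, wilsonFunction, mul_inv]
  have h5 := Complex.exp_ne_zero (2 * Complex.I * θ)
  generalize (∏ i, (1 - Complex.exp (-(Complex.I * θ)) *
        Complex.exp (-(2 * Complex.I * q * T * fieldEigenvalue E B i))))⁻¹ = P
  calc _ = -(Complex.exp (Complex.I * (3 / 2 + (s : ℂ)) * θ) * scalarDet θ *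
        (Complex.exp (2 * Complex.I * θ))⁻¹ * P) := by field_simp
    _ = -((Complex.exp (Complex.I * (3 / 2 + (s : ℂ)) * θ) * Complex.exp (Complex.I * θ / 2)) *
        (1 - Complex.exp (-(Complex.I * θ))) * (Complex.exp (2 * Complex.I * θ))⁻¹ * P) := by
        rw [h1]; ring
    _ = _ := by rw [h4]; field_simp

/-- As θ increases, w runs clockwise; the substitution θ ↦ 2π - θ restores the standard orientation.
Since |w| = e^{-Λ} < 1, the point w = 1 is avoided. -/
theorem modularAverage_eq_circleAverage (s : ℕ) (q : ℝ) (E B : Vec3) (T : ℂ) {Λ : ℝ}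
    (hΛ : 0 < Λ) :
    modularAverage s q (fieldStrength E B) T Λ = Real.circleAverage (fun w => w⁻¹ ^ s *
      wilsonFunction (fun i => Complex.exp (-(2 * Complex.I * q * T * fieldEigenvalue E B i))) w)
        0 (Real.exp (-Λ)) := by
  set G : ℂ → ℂ := fun w => w⁻¹ ^ s *
    wilsonFunction (fun i => Complex.exp (-(2 * Complex.I * q * T * fieldEigenvalue E B i))) w
  have h1 : ∀ θ : ℝ, Complex.exp (-(Complex.I * ((θ : ℂ) - Complex.I * Λ))) =
      circleMap 0 (Real.exp (-Λ)) (2 * Real.pi - θ) := by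
    intro θ
    rw [circleMap, zero_add, Complex.ofReal_exp, ← Complex.exp_add]
    rw [Complex.exp_eq_exp_iff_exists_int]
    refine ⟨-1, ?_⟩
    push_cast
    linear_combination (Λ : ℂ) * Complex.I_sq
  have h2 : ∀ θ : ℝ, modularIntegrand s q (fieldStrength E B) T ((θ : ℂ) - Complex.I * (Λ : ℂ)) =
      G (circleMap 0 (Real.exp (-Λ)) (2 * Real.pi - θ)) := by
    intro θ
    rw [modularIntegrand_eq, h1]
    rw [h1]
    intro h
    have := congrArg norm h
    rw [norm_circleMap_zero, abs_of_pos (Real.exp_pos _), norm_one, Real.exp_eq_one_iff] at this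
    linarith
  rw [modularAverage, Real.circleAverage_def]
  simp_rw [h2]
  rw [intervalIntegral.integral_comp_sub_left (fun x => G (circleMap 0 (Real.exp (-Λ)) x))]
  simp

/-- The poles satisfy w uᵢ = 1 and so lie outside this disc, which contains the circle |w| = e^{-Λ}
once Λ is large. -/
theorem differentiableOn_wilsonFunction (u : Fin 4 → ℂ) :
    DifferentiableOn ℂ (wilsonFunction u) (Metric.ball 0 (1 + ∑ i, ‖u i‖)⁻¹) := by
  intro w hw
  have hpos : 0 < 1 + ∑ i, ‖u i‖ := by positivity
  have hne : ∏ i, (1 - w * u i) ≠ 0 := by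
    refine Finset.prod_ne_zero_iff.2 fun i _ h => ?_
    have h1 : ‖w * u i‖ = 1 := by rw [← sub_eq_zero.1 h, norm_one]
    rw [norm_mul] at h1
    have h2 : ‖u i‖ ≤ ∑ i, ‖u i‖ := Finset.single_le_sum (fun i _ => norm_nonneg (u i))
      (Finset.mem_univ i)
    have h3 : ‖w‖ < (1 + ∑ i, ‖u i‖)⁻¹ := by simpa using hw
    rw [lt_inv_comm₀ (by
      rcases (norm_nonneg w).eq_or_lt with h | h
      · rw [← h, zero_mul] at h1; exact absurd h1 zero_ne_one
      · exact h) hpos, ← one_div, lt_div_iff₀ (by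
      rcases (norm_nonneg w).eq_or_lt with h | h
      · rw [← h, zero_mul] at h1; exact absurd h1 zero_ne_one
      · exact h)] at h3
    nlinarith [norm_nonneg w]
  refine DifferentiableAt.differentiableWithinAt ?_
  unfold wilsonFunction
  simp only [Fin.prod_univ_four] at hne ⊢
  fun_prop (disch := exact hne)

theorem hasDerivAt_wilsonFunction (u : Fin 4 → ℂ) :
    HasDerivAt (wilsonFunction u) (1 - ∑ i, u i) 0 := by
  have h : ∀ i, HasDerivAt (fun w : ℂ => 1 - w * u i) (-(u i)) 0 := fun i => by
    simpa using ((hasDerivAt_id (0 : ℂ)).mul_const (u i)).const_sub 1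
  have h1 : HasDerivAt (fun w : ℂ => 1 - w) (-1) 0 := by
    simpa using (hasDerivAt_id (0 : ℂ)).const_sub 1
  have h2 := (h1.mul (((((h 0).mul (h 1)).mul (h 2)).mul (h 3)).inv (by simp))).neg
  convert! h2 using 1
  · funext w
    simp [wilsonFunction, Fin.prod_univ_four]
  · simp [Fin.sum_univ_four]
    ring

/-- The coefficient of `wˢ` in the Wilson function, for `s = 0, 1`. -/
theorem eventually_modularAverage_eq (s : ℕ) (hs : s ≤ 1) (q : ℝ) (E B : Vec3) (T : ℂ) :
    ∀ᶠ Λ : ℝ in atTop, modularAverage s q (fieldStrength E B) T Λ =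
      if s = 0 then -1 else 1 - 2 * Complex.cosh (2 * (q * T * Kplus E B))
        - 2 * Complex.cos (2 * (q * T * Kminus E B)) := by
  set u : Fin 4 → ℂ := fun i => Complex.exp (-(2 * Complex.I * q * T * fieldEigenvalue E B i))
    with hu
  have hsum : ∑ i, u i = 2 * Complex.cosh (2 * (q * T * Kplus E B))
        + 2 * Complex.cos (2 * (q * T * Kminus E B)) := by
    rw [Complex.two_cosh, Complex.two_cos, Fin.sum_univ_four]
    simp only [hu, fieldEigenvalue, Matrix.cons_val]
    have h1 : -(2 * Complex.I * q * T * (Complex.I * Kplus E B)) = 2 * (q * T * Kplus E B) := by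
      linear_combination (-2 * q * T * Kplus E B) * Complex.I_sq
    have h2 : -(2 * Complex.I * q * T * -(Complex.I * Kplus E B)) = -(2 * (q * T * Kplus E B)) := by
      linear_combination (2 * q * T * Kplus E B) * Complex.I_sq
    rw [h1, h2]
    ring_nf
  have hR : 0 < (1 + ∑ i, ‖u i‖)⁻¹ := by positivity
  have hlim : Tendsto (fun Λ : ℝ => Real.exp (-Λ)) atTop (𝓝 0) :=
    Real.tendsto_exp_neg_atTop_nhds_zero
  filter_upwards [hlim.eventually_lt_const hR, eventually_gt_atTop 0] with Λ hΛ hΛ0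
  rw [modularAverage_eq_circleAverage s q E B T hΛ0,
    Real.circleAverage_eq_circleIntegral (Real.exp_pos _).ne']
  have hsub : Metric.closedBall (0 : ℂ) (Real.exp (-Λ)) ⊆ Metric.ball 0 (1 + ∑ i, ‖u i‖)⁻¹ :=
    Metric.closedBall_subset_ball hΛ
  have hmem : (0 : ℂ) ∈ Metric.ball (0 : ℂ) (Real.exp (-Λ)) :=
    Metric.mem_ball_self (Real.exp_pos _)
  -- A circle average carries a further factor 1/w, so s = 0 is Cauchy's formula for the value at 0
  -- and s = 1 is the one for the derivative.
  have hs' : s = 0 ∨ s = 1 := by omega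
  rcases hs' with rfl | rfl
  · have h := ((differentiableOn_wilsonFunction u).mono
      hsub).diffContOnCl_ball (U := Metric.closedBall 0 (Real.exp (-Λ))) subset_rfl
      |>.two_pi_i_inv_smul_circleIntegral_sub_inv_smul hmem
    simpa [wilsonFunction] using h
  · have h := Complex.two_pi_I_inv_smul_circleIntegral_sub_sq_inv_smul_of_differentiable
      Metric.isOpen_ball hsub (differentiableOn_wilsonFunction u) hmem
    rw [(hasDerivAt_wilsonFunction u).deriv, hsum] at h
    rw [if_neg one_ne_zero, sub_sub, ← h]
    congr 2
    funext z
    simp only [sub_zero, pow_one, smul_eq_mul, sq, mul_inv]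
    exact (mul_assoc _ _ _).symm

theorem modularIntegral_eq (s : ℕ) (hs : s ≤ 1) (q : ℝ) (E B : Vec3) (T : ℂ) :
    modularIntegral s q (fieldStrength E B) T =
      if s = 0 then -1 else 1 - 2 * Complex.cosh (2 * (q * T * Kplus E B))
        - 2 * Complex.cos (2 * (q * T * Kminus E B)) :=
  (tendsto_const_nhds.congr'
    ((eventually_modularAverage_eq s hs q E B T).mono fun _ h => h.symm)).limUnder_eq

/-! ### Closed form of the worldline factor and its growth -/

/-- The worldline factor as a function of `x = q T`. -/
noncomputable def profile (s : ℕ) (E B : Vec3) (x : ℂ) : ℂ :=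
  divSinh (x * Kplus E B) * divSin (x * Kminus E B) *
    (if s = 0 then -1 else 1 - 2 * Complex.cosh (2 * (x * Kplus E B))
      - 2 * Complex.cos (2 * (x * Kminus E B)))

theorem worldlineFactor_eq_profile (s : ℕ) (hs : s ≤ 1) (q : ℝ) (E B : Vec3) (T : ℂ) :
    worldlineFactor s q (fieldStrength E B) T = profile s E B (q * T) := by
  rw [worldlineFactor, inv_sqrtCoordDet, modularIntegral_eq s hs, profile, weisskopfFactor]

theorem worldlineFactor_zero (q : ℝ) (E B : Vec3) (T : ℂ) :
    worldlineFactor 0 q (fieldStrength E B) T = -weisskopfFactor q E B T := by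
  rw [worldlineFactor_eq_profile 0 (by norm_num), profile, weisskopfFactor, if_pos rfl, mul_neg_one]

theorem worldlineFactor_one (q : ℝ) (E B : Vec3) (T : ℂ) :
    worldlineFactor 1 q (fieldStrength E B) T =
      weisskopfFactor q E B T * spinOneBracket q E B T := by
  rw [worldlineFactor_eq_profile 1 le_rfl, profile, weisskopfFactor, spinOneBracket,
    if_neg one_ne_zero]
  simp only [mul_assoc]

theorem norm_sinh_sq (z : ℂ) :
    ‖Complex.sinh z‖ ^ 2 = Real.sinh z.re ^ 2 + Real.sin z.im ^ 2 := by
  have h : Complex.sinh z = ((Real.sinh z.re * Real.cos z.im : ℝ) : ℂ) +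
      ((Real.cosh z.re * Real.sin z.im : ℝ) : ℂ) * Complex.I := by
    conv_lhs => rw [← Complex.re_add_im z]
    rw [Complex.sinh_add, Complex.sinh_mul_I, Complex.cosh_mul_I]
    push_cast
    ring
  rw [h, Complex.sq_norm, Complex.normSq_add_mul_I]
  nlinarith [Real.cosh_sq z.re, Real.sin_sq_add_cos_sq z.im]

theorem sinh_abs_re_le_norm_sinh (z : ℂ) : Real.sinh |z.re| ≤ ‖Complex.sinh z‖ := by
  refine le_of_sq_le_sq ?_ (norm_nonneg _)
  rw [norm_sinh_sq, ← Real.abs_sinh, sq_abs]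
  nlinarith [sq_nonneg (Real.sin z.im)]

theorem div_sinh_le {x : ℝ} (hx : 0 < x) : x / Real.sinh x ≤ (1 + 2 * x) * Real.exp (-x) := by
  rw [div_le_iff₀ (Real.sinh_pos_iff.2 hx), Real.sinh_eq]
  have h1 : Real.exp (-x) * Real.exp x = 1 := by rw [← Real.exp_add]; simp
  have h2 : (1 + 2 * x) * (Real.exp (-x) * Real.exp (-x)) ≤ 1 := by
    have h3 := Real.add_one_le_exp (2 * x)
    have h4 : Real.exp (2 * x) * (Real.exp (-x) * Real.exp (-x)) = 1 := by
      rw [← Real.exp_add, ← Real.exp_add]; ring_nf; simp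
    have h5 := mul_pos (Real.exp_pos (-x)) (Real.exp_pos (-x))
    nlinarith
  nlinarith

/-- In a sector around the real axis |z| is comparable to |Re z|, while |sinh z| ≥ sinh |Re z|. The
poles, all on the imaginary axis, stay outside. -/
theorem norm_divSinh_le {κ : ℝ} (hκ : 0 ≤ κ) {z : ℂ} (hz : |z.im| ≤ κ * |z.re|) :
    ‖divSinh z‖ ≤ (1 + κ) * (1 + 2 * |z.re|) * Real.exp (-|z.re|) := by
  by_cases h0 : z = 0
  · subst h0; simp [divSinh, hκ]
  · have hre : 0 < |z.re| := by
      refine abs_pos.2 fun h => h0 (Complex.ext h ?_)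
      rw [h, abs_zero, mul_zero] at hz
      exact abs_nonpos_iff.1 hz
    rw [divSinh, if_neg h0, norm_div]
    have h1 : ‖z‖ ≤ (1 + κ) * |z.re| := (Complex.norm_le_abs_re_add_abs_im z).trans (by linarith)
    have hs : 0 < Real.sinh |z.re| := Real.sinh_pos_iff.2 hre
    calc ‖z‖ / ‖Complex.sinh z‖ ≤ ((1 + κ) * |z.re|) / Real.sinh |z.re| :=
          div_le_div₀ (by positivity) h1 hs (sinh_abs_re_le_norm_sinh z)
      _ = (1 + κ) * (|z.re| / Real.sinh |z.re|) := by ring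
      _ ≤ (1 + κ) * ((1 + 2 * |z.re|) * Real.exp (-|z.re|)) := by
          gcongr; exact div_sinh_le hre
      _ = _ := by ring

theorem divSin_eq_divSinh (z : ℂ) : divSin z = divSinh (Complex.I * z) := by
  rw [divSin_eq_inv, divSinh_eq_inv, sinhc_eq_sinc, ← mul_assoc, Complex.I_mul_I, neg_one_mul,
    sinc_neg]

theorem norm_divSin_le {κ : ℝ} (hκ : 0 ≤ κ) {z : ℂ} (hz : |z.re| ≤ κ * |z.im|) :
    ‖divSin z‖ ≤ (1 + κ) * (1 + 2 * |z.im|) * Real.exp (-|z.im|) := by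
  rw [divSin_eq_divSinh]
  have := norm_divSinh_le hκ (z := Complex.I * z) (by simpa using hz)
  simpa using this

theorem norm_cosh_le (z : ℂ) : ‖Complex.cosh z‖ ≤ Real.exp |z.re| := by
  have h : 2 * ‖Complex.cosh z‖ ≤ 2 * Real.exp |z.re| := by
    have h1 : ‖2 * Complex.cosh z‖ ≤ ‖Complex.exp z‖ + ‖Complex.exp (-z)‖ := by
      rw [Complex.two_cosh]; exact norm_add_le _ _
    rw [norm_mul, Complex.norm_two, Complex.norm_exp, Complex.norm_exp, Complex.neg_re] at h1
    have h2 := Real.exp_le_exp.2 (le_abs_self z.re)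
    have h3 := Real.exp_le_exp.2 (neg_le_abs z.re)
    linarith
  linarith

theorem norm_cos_le (z : ℂ) : ‖Complex.cos z‖ ≤ Real.exp |z.im| := by
  have := norm_cosh_le (z * Complex.I)
  rwa [Complex.cosh_mul_I, Complex.mul_I_re, abs_neg] at this

theorem sinhc_ne_zero {z : ℂ} (h : z.re = 0 → z = 0) : sinhc z ≠ 0 := by
  by_cases h0 : z = 0
  · simp [sinhc, h0]
  · rw [sinhc, if_neg h0]
    refine div_ne_zero (fun hs => ?_) h0
    have h1 := norm_sinh_sq z
    rw [hs, norm_zero, zero_pow two_ne_zero] at h1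
    have h2 : Real.sinh z.re = 0 := by
      nlinarith [sq_nonneg (Real.sinh z.re), sq_nonneg (Real.sin z.im)]
    exact h0 (h (Real.sinh_eq_zero.1 h2))

theorem sinc_ne_zero {z : ℂ} (h : z.im = 0 → |z.re| < Real.pi) : sinc z ≠ 0 := by
  by_cases h0 : z = 0
  · simp [sinc, h0]
  · rw [sinc, if_neg h0]
    refine div_ne_zero (fun hs => ?_) h0
    obtain ⟨k, rfl⟩ := Complex.sin_eq_zero_iff.1 hs
    have h1 := h (by simp)
    simp only [Complex.mul_re, Complex.intCast_re, Complex.ofReal_re, Complex.intCast_im,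
      Complex.ofReal_im, mul_zero, sub_zero, abs_mul, abs_of_pos Real.pi_pos] at h1
    have h2 : |(k : ℝ)| < 1 := by
      by_contra! h3
      nlinarith [Real.pi_pos]
    have h3 : k = 0 := by
      rw [← Int.cast_abs] at h2
      exact Int.abs_lt_one_iff.1 (by exact_mod_cast h2)
    exact h0 (by simp [h3])

theorem Kplus_nonneg (E B : Vec3) : 0 ≤ Kplus E B := Real.sqrt_nonneg _

theorem Kminus_nonneg (E B : Vec3) : 0 ≤ Kminus E B := Real.sqrt_nonneg _

/-- The exponential growth rate of the spin-`s` profile in the direction `x`. -/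
noncomputable def growthRate (s : ℕ) (E B : Vec3) (x : ℂ) : ℝ :=
  if s = 0 then 0 else |(Kplus E B * |x.re| - Kminus E B * |x.im|)|

theorem growthRate_nonneg (s : ℕ) (E B : Vec3) (x : ℂ) : 0 ≤ growthRate s E B x := by
  unfold growthRate
  split_ifs
  exacts [le_rfl, abs_nonneg _]

/-- With A = K₊|Re x| and D = K₋|Im x|, the quotients give e^{-A-D}. The bracket is controlled by
e^{2A} and e^{2D}, both at most e^{A+D+|A-D|}, so only e^{|A-D|} survives. -/
theorem norm_profile_le (s : ℕ) (E B : Vec3) {κ : ℝ} (hκ : 0 ≤ κ) {x : ℂ}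
    (h1 : Kplus E B * |x.im| ≤ κ * (Kplus E B * |x.re|))
    (h2 : Kminus E B * |x.re| ≤ κ * (Kminus E B * |x.im|)) :
    ‖profile s E B x‖ ≤ 5 * (1 + κ) ^ 2 * (1 + 2 * (Kplus E B * |x.re|)) *
      (1 + 2 * (Kminus E B * |x.im|)) * Real.exp (growthRate s E B x) := by
  have ha := Kplus_nonneg E B
  have hb := Kminus_nonneg E B
  set a := Kplus E B
  set b := Kminus E B
  have e1 : |(x * a).re| = a * |x.re| := by
    rw [Complex.re_mul_ofReal, abs_mul, abs_of_nonneg ha, mul_comm]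
  have e2 : |(x * a).im| = a * |x.im| := by
    rw [Complex.im_mul_ofReal, abs_mul, abs_of_nonneg ha, mul_comm]
  have e3 : |(x * b).re| = b * |x.re| := by
    rw [Complex.re_mul_ofReal, abs_mul, abs_of_nonneg hb, mul_comm]
  have e4 : |(x * b).im| = b * |x.im| := by
    rw [Complex.im_mul_ofReal, abs_mul, abs_of_nonneg hb, mul_comm]
  have b1 := norm_divSinh_le hκ (z := x * a) (by rwa [e1, e2])
  have b2 := norm_divSin_le hκ (z := x * b) (by rwa [e3, e4])
  rw [e1] at b1
  rw [e4] at b2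
  set A := a * |x.re|
  set D := b * |x.im|
  have hA : 0 ≤ A := by positivity
  have hD : 0 ≤ D := by positivity
  have b3 : ‖(if s = 0 then -1 else 1 - 2 * Complex.cosh (2 * (x * a))
      - 2 * Complex.cos (2 * (x * b)) : ℂ)‖ ≤
        5 * Real.exp (A + D + growthRate s E B x) := by
    split_ifs with hs
    · rw [norm_neg, norm_one, growthRate, if_pos hs]
      have := Real.add_one_le_exp (A + D + 0)
      linarith
    · rw [growthRate, if_neg hs]
      have c1 := norm_cosh_le (2 * (x * a))
      have c2 := norm_cos_le (2 * (x * b))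
      have d1 : |(2 * (x * a)).re| = 2 * A := by
        rw [← e1, show (2 : ℂ) = ((2 : ℝ) : ℂ) by simp, Complex.re_ofReal_mul, abs_mul, abs_two]
      have d2 : |(2 * (x * b)).im| = 2 * D := by
        rw [← e4, show (2 : ℂ) = ((2 : ℝ) : ℂ) by simp, Complex.im_ofReal_mul, abs_mul, abs_two]
      rw [d1] at c1
      rw [d2] at c2
      have f1 : Real.exp (2 * A) ≤ Real.exp (A + D + |A - D|) :=
        Real.exp_le_exp.2 (by linarith [le_abs_self (A - D)])
      have f2 : Real.exp (2 * D) ≤ Real.exp (A + D + |A - D|) :=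
        Real.exp_le_exp.2 (by linarith [neg_abs_le (A - D)])
      have f3 : 1 ≤ Real.exp (A + D + |A - D|) := Real.one_le_exp (by positivity)
      calc _ ≤ ‖(1 : ℂ)‖ + ‖2 * Complex.cosh (2 * (x * a))‖ + ‖2 * Complex.cos (2 * (x * b))‖ :=
            (norm_sub_le _ _).trans (by gcongr; exact norm_sub_le _ _)
        _ = 1 + 2 * ‖Complex.cosh (2 * (x * a))‖ + 2 * ‖Complex.cos (2 * (x * b))‖ := by
            rw [norm_one, norm_mul, norm_mul, Complex.norm_two]
        _ ≤ _ := by linarith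
  rw [profile, norm_mul, norm_mul]
  calc _ ≤ ((1 + κ) * (1 + 2 * A) * Real.exp (-A)) * ((1 + κ) * (1 + 2 * D) * Real.exp (-D)) *
        (5 * Real.exp (A + D + growthRate s E B x)) := by gcongr
    _ = 5 * (1 + κ) ^ 2 * (1 + 2 * A) * (1 + 2 * D) *
        (Real.exp (-A) * Real.exp (-D) * Real.exp (A + D + growthRate s E B x)) := by ring
    _ = _ := by
        rw [← Real.exp_add, ← Real.exp_add]
        congr 2
        ring

theorem differentiableAt_profile (s : ℕ) (E B : Vec3) {x : ℂ}
    (h1 : sinhc (x * Kplus E B) ≠ 0) (h2 : sinc (x * Kminus E B) ≠ 0) :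
    DifferentiableAt ℂ (profile s E B) x := by
  unfold profile
  simp_rw [divSinh_eq_inv, divSin_eq_inv]
  have d1 : DifferentiableAt ℂ (fun x => sinhc (x * Kplus E B)) x :=
    (differentiable_sinhc _).comp x (by fun_prop)
  have d2 : DifferentiableAt ℂ (fun x => sinc (x * Kminus E B)) x :=
    (differentiable_sinc _).comp x (by fun_prop)
  refine ((d1.inv h1).mul (d2.inv h2)).mul ?_
  split_ifs
  · fun_prop
  · fun_prop

/-! ### Proper-time contours and the poles of the profile -/

theorem contourPoint_re (ε φ r : ℝ) : (contourPoint ε φ r).re = ε + r * Real.cos φ := by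
  rw [contourPoint, mul_comm Complex.I, Complex.exp_mul_I]
  simp [← Complex.ofReal_cos, ← Complex.ofReal_sin]

theorem contourPoint_im (ε φ r : ℝ) : (contourPoint ε φ r).im = r * Real.sin φ := by
  rw [contourPoint, mul_comm Complex.I, Complex.exp_mul_I]
  simp [← Complex.ofReal_cos, ← Complex.ofReal_sin]

theorem continuous_contourPoint (ε φ : ℝ) : Continuous (contourPoint ε φ) := by
  unfold contourPoint; fun_prop

theorem le_norm_contourPoint {ε φ r : ℝ} (hε : 0 ≤ ε) (hφ0 : 0 ≤ φ) (hφ : φ ≤ Real.pi / 2)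
    (hr : 0 ≤ r) : r ≤ ‖contourPoint ε φ r‖ := by
  have hc : 0 ≤ Real.cos φ := Real.cos_nonneg_of_mem_Icc ⟨by linarith, hφ⟩
  refine le_of_sq_le_sq ?_ (norm_nonneg _)
  rw [Complex.sq_norm, Complex.normSq_apply, contourPoint_re, contourPoint_im]
  have : 0 ≤ ε * (r * Real.cos φ) := by positivity
  nlinarith [Real.sin_sq_add_cos_sq φ, sq_nonneg ε]

/-- Away from T = 0 the contour has positive real part and misses the zeros of sinh on the imaginary
axis. For φ > 0 it meets the real axis only at ε, before the first zero of the sine; if q K₋ = 0 the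
sine factor is trivial. -/
theorem differentiableAt_profile_contour (s : ℕ) (E B : Vec3) {q ε φ r : ℝ} (hε : 0 ≤ ε)
    (hε' : |q| * ε * Kminus E B < Real.pi) (hφ0 : 0 ≤ φ) (hφ : φ < Real.pi / 2)
    (hK : q * Kminus E B ≠ 0 → 0 < φ) (hr : 0 ≤ r) :
    DifferentiableAt ℂ (profile s E B) (q * contourPoint ε φ r) := by
  have hc : 0 < Real.cos φ := Real.cos_pos_of_mem_Ioo ⟨by linarith [Real.pi_pos], hφ⟩
  apply differentiableAt_profile
  · apply sinhc_ne_zero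
    rw [Complex.re_mul_ofReal, Complex.re_ofReal_mul, contourPoint_re]
    intro h
    rcases mul_eq_zero.1 h with h | h
    · rcases mul_eq_zero.1 h with h | h
      · simp [h]
      · have h1 : 0 ≤ r * Real.cos φ := by positivity
        have h2 : ε = 0 := by linarith
        have h3 : r = 0 := by
          have : r * Real.cos φ = 0 := by linarith
          exact (mul_eq_zero.1 this).resolve_right hc.ne'
        simp [contourPoint, h2, h3]
    · simp [h]
  · apply sinc_ne_zero
    rw [Complex.im_mul_ofReal, Complex.re_mul_ofReal, Complex.im_ofReal_mul,
      Complex.re_ofReal_mul, contourPoint_im, contourPoint_re]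
    intro h
    by_cases hqK : q * Kminus E B = 0
    · rw [show q * (ε + r * Real.cos φ) * Kminus E B =
        (q * Kminus E B) * (ε + r * Real.cos φ) by ring, hqK]
      simp [Real.pi_pos]
    · have hs : 0 < Real.sin φ := Real.sin_pos_of_pos_of_lt_pi (hK hqK)
        (by linarith [Real.pi_pos])
      have hr0 : r = 0 := by
        have h1 : (q * Kminus E B) * (r * Real.sin φ) = 0 := by linarith
        exact (mul_eq_zero.1 ((mul_eq_zero.1 h1).resolve_left hqK)).resolve_right hs.ne'
      rw [hr0, zero_mul, add_zero, abs_mul, abs_mul, abs_of_nonneg hε,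
        abs_of_nonneg (Kminus_nonneg E B)]
      exact hε'

/-- Absorbs linear prefactors into an exponential of arbitrarily small rate η. -/
theorem one_add_mul_le_exp {a η r : ℝ} (ha : 0 ≤ a) (hη : 0 < η) (hr : 0 ≤ r) :
    1 + a * r ≤ (1 + a / η) * Real.exp (η * r) := by
  have h1 : 1 ≤ Real.exp (η * r) := Real.one_le_exp (by positivity)
  have h2 : η * r ≤ Real.exp (η * r) := by linarith [Real.add_one_le_exp (η * r)]
  have h3 : a * r = a / η * (η * r) := by field_simp
  have h4 : a / η * (η * r) ≤ a / η * Real.exp (η * r) := by gcongr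
  linarith

/-! ### Taylor expansion of the profile at the origin -/

theorem exp_sub_sum_isBigO {n : ℕ} (hn : 0 < n) :
    (fun z : ℂ => Complex.exp z - ∑ m ∈ Finset.range n, z ^ m / m.factorial)
      =O[𝓝 0] fun z => z ^ n := by
  refine IsBigO.of_bound ((n.succ : ℝ) * (n.factorial * n : ℝ)⁻¹) ?_
  filter_upwards [Metric.closedBall_mem_nhds (0 : ℂ) one_pos] with z hz
  rw [norm_pow, mul_comm]
  exact Complex.exp_bound (by simpa using hz) hn

theorem exp_neg_sub_sum_isBigO {n : ℕ} (hn : 0 < n) :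
    (fun z : ℂ => Complex.exp (-z) - ∑ m ∈ Finset.range n, (-z) ^ m / m.factorial)
      =O[𝓝 0] fun z => z ^ n := by
  have h : Tendsto (fun z : ℂ => -z) (𝓝 0) (𝓝 0) := by
    simpa using (continuous_neg (G := ℂ)).tendsto 0
  refine ((exp_sub_sum_isBigO hn).comp_tendsto h).trans (IsBigO.of_bound 1 ?_)
  simp

theorem cosh_taylor :
    (fun z : ℂ => Complex.cosh z - (1 + z ^ 2 / 2 + z ^ 4 / 24)) =O[𝓝 0] fun z => z ^ 6 := by
  refine (((exp_sub_sum_isBigO (n := 6) (by norm_num)).add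
    (exp_neg_sub_sum_isBigO (n := 6) (by norm_num))).const_mul_left (1 / 2)).congr_left fun z => ?_
  rw [Complex.cosh]
  simp only [Finset.sum_range_succ, Finset.sum_range_zero, Nat.factorial]
  push_cast
  ring

theorem sinh_taylor :
    (fun z : ℂ => Complex.sinh z - (z + z ^ 3 / 6 + z ^ 5 / 120)) =O[𝓝 0] fun z => z ^ 7 := by
  refine (((exp_sub_sum_isBigO (n := 7) (by norm_num)).sub
    (exp_neg_sub_sum_isBigO (n := 7) (by norm_num))).const_mul_left (1 / 2)).congr_left fun z => ?_
  rw [Complex.sinh]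
  simp only [Finset.sum_range_succ, Finset.sum_range_zero, Nat.factorial]
  push_cast
  ring

theorem sinhc_taylor :
    (fun z : ℂ => sinhc z - (1 + z ^ 2 / 6 + z ^ 4 / 120)) =O[𝓝 0] fun z => z ^ 6 := by
  obtain ⟨C, hC⟩ := sinh_taylor.bound
  refine IsBigO.of_bound C ?_
  filter_upwards [hC] with z hz
  by_cases h0 : z = 0
  · subst h0; simp [sinhc]
  · have h1 : Complex.sinh z - (z + z ^ 3 / 6 + z ^ 5 / 120) =
        z * (sinhc z - (1 + z ^ 2 / 6 + z ^ 4 / 120)) := by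
      rw [sinhc, if_neg h0]; field_simp
    rw [h1, norm_mul, pow_succ' z 6, norm_mul, mul_left_comm] at hz
    exact le_of_mul_le_mul_left hz (norm_pos_iff.2 h0)

theorem isBigO_mul_sub_mul {f p g r e : ℂ → ℂ} (hf : (fun z => f z - p z) =O[𝓝 0] e)
    (hg : (fun z => g z - r z) =O[𝓝 0] e) (hgc : ContinuousAt g 0) (hpc : ContinuousAt p 0) :
    (fun z => f z * g z - p z * r z) =O[𝓝 0] e := by
  have h1 := hf.mul (hgc.tendsto.isBigO_one ℂ)
  have h2 := (hpc.tendsto.isBigO_one ℂ).mul hg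
  simp only [mul_one, one_mul] at h1 h2
  refine (h1.add h2).congr_left fun z => ?_
  ring

theorem isBigO_of_eq_mul {f g h : ℂ → ℂ} (hfg : ∀ z, f z = g z * h z) (hg : ContinuousAt g 0) :
    f =O[𝓝 0] h := by
  have h1 := (hg.tendsto.isBigO_one ℂ).mul (isBigO_refl h (𝓝 0))
  simp only [one_mul] at h1
  exact h1.congr_left fun z => (hfg z).symm

theorem continuousAt_divSinh : ContinuousAt divSinh 0 := by
  rw [funext divSinh_eq_inv]
  exact (differentiable_sinhc 0).continuousAt.inv₀ (by simp [sinhc])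

theorem divSinh_taylor :
    (fun z : ℂ => divSinh z - (1 - z ^ 2 / 6 + 7 * z ^ 4 / 360)) =O[𝓝 0] fun z => z ^ 6 := by
  have hc : ContinuousAt (fun z : ℂ => 1 - z ^ 2 / 6 + 7 * z ^ 4 / 360) 0 := by fun_prop
  have h1 := (hc.tendsto.isBigO_one ℂ).mul sinhc_taylor
  simp only [one_mul] at h1
  -- The candidate polynomial inverts the Taylor polynomial of `sinhc` up to order 6; multiplying by
  -- `divSinh`, bounded near 0, transfers this to `divSinh` itself.
  have h2 : (fun z : ℂ => (1 - z ^ 2 / 6 + 7 * z ^ 4 / 360) * (1 + z ^ 2 / 6 + z ^ 4 / 120) - 1)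
      =O[𝓝 0] fun z => z ^ 6 := by
    refine isBigO_of_eq_mul (g := fun z => -1 / 720 + 7 / 2160 + 7 / 43200 * z ^ 2)
      (fun z => by ring) (by fun_prop)
  have h3 := (continuousAt_divSinh.tendsto.isBigO_one ℂ).mul (h1.add h2)
  simp only [one_mul] at h3
  refine h3.neg_left.congr' ?_ EventuallyEq.rfl
  have hne : sinhc 0 ≠ 0 := by simp [sinhc]
  filter_upwards [(differentiable_sinhc 0).continuousAt.eventually_ne hne] with z hz
  rw [divSinh_eq_inv]
  field_simp
  ring

theorem tendsto_mul_const_zero (k : ℂ) : Tendsto (fun x : ℂ => x * k) (𝓝 0) (𝓝 0) := by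
  simpa using (continuous_id.mul_const k).tendsto (0 : ℂ)

theorem IsBigO.comp_mul_const {f : ℂ → ℂ} {n : ℕ} (h : f =O[𝓝 0] fun z => z ^ n) (k : ℂ) :
    (fun x => f (x * k)) =O[𝓝 0] fun x => x ^ n :=
  (h.comp_tendsto (tendsto_mul_const_zero k)).trans
    (isBigO_of_eq_mul (g := fun _ => k ^ n) (fun z => by simp [mul_pow, mul_comm])
      continuousAt_const)

/-- The quartic Taylor polynomial of the spin-`s` profile, `s = 0, 1`, without its quartic term. -/
noncomputable def profileLow (s : ℕ) (E B : Vec3) (x : ℂ) : ℂ :=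
  if s = 0 then -1 - 1 / 6 * ((Kminus E B : ℂ) ^ 2 - (Kplus E B : ℂ) ^ 2) * x ^ 2
  else -3 + 7 / 2 * ((Kminus E B : ℂ) ^ 2 - (Kplus E B : ℂ) ^ 2) * x ^ 2

/-- The coefficient of `x⁴` in the spin-`s` profile, `s = 0, 1`. -/
noncomputable def profileQuartic (s : ℕ) (E B : Vec3) : ℂ :=
  if s = 0 then -(7 / 360 * ((Kminus E B : ℂ) ^ 4 + (Kplus E B : ℂ) ^ 4)
    - 1 / 36 * ((Kminus E B : ℂ) ^ 2 * (Kplus E B : ℂ) ^ 2))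
  else -(29 / 40 * ((Kminus E B : ℂ) ^ 4 + (Kplus E B : ℂ) ^ 4)
    + 5 / 4 * ((Kminus E B : ℂ) ^ 2 * (Kplus E B : ℂ) ^ 2))

theorem profile_taylor (s : ℕ) (E B : Vec3) :
    (fun x => profile s E B x - (profileLow s E B x + profileQuartic s E B * x ^ 4))
      =O[𝓝 0] fun x => x ^ 6 := by
  set a : ℂ := (Kplus E B : ℂ) with ha
  set b : ℂ := (Kminus E B : ℂ) with hb
  have hI2 := Complex.I_sq
  have hI4 := Complex.I_pow_four
  have t1 := IsBigO.comp_mul_const divSinh_taylor a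
  -- The trigonometric factors are hyperbolic ones at an imaginary argument, so two expansions serve
  -- all four factors.
  have t2 := IsBigO.comp_mul_const divSinh_taylor (Complex.I * b)
  have t3 := IsBigO.comp_mul_const cosh_taylor (2 * a)
  have t4 := IsBigO.comp_mul_const cosh_taylor (2 * b * Complex.I)
  have c2 : ContinuousAt (fun x => divSinh (x * (Complex.I * b))) 0 := by
    refine ContinuousAt.comp_of_eq continuousAt_divSinh (by fun_prop) (by simp)
  have t12 := isBigO_mul_sub_mul t1 t2 c2 (by fun_prop)
  have key : ∀ x, profile s E B x = divSinh (x * a) * divSinh (x * (Complex.I * b)) *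
      (if s = 0 then -1 else 1 - 2 * Complex.cosh (x * (2 * a))
        - 2 * Complex.cosh (x * (2 * b * Complex.I))) := by
    intro x
    rw [profile, divSin_eq_divSinh, ← ha, ← hb]
    rw [show Complex.I * (x * b) = x * (Complex.I * b) by ring,
      show 2 * (x * a) = x * (2 * a) by ring,
      show x * (2 * b * Complex.I) = (2 * (x * b)) * Complex.I by ring, Complex.cosh_mul_I]
  simp_rw [key]
  by_cases hs : s = 0
  · simp only [profileLow, profileQuartic, if_pos hs, ← ha, ← hb]
    have t5 : (fun x : ℂ => (1 - (x * a) ^ 2 / 6 + 7 * (x * a) ^ 4 / 360) *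
        (1 - (x * (Complex.I * b)) ^ 2 / 6 + 7 * (x * (Complex.I * b)) ^ 4 / 360) * (-1) -
        (-1 - 1 / 6 * (b ^ 2 - a ^ 2) * x ^ 2 +
          -(7 / 360 * (b ^ 4 + a ^ 4) - 1 / 36 * (b ^ 2 * a ^ 2)) * x ^ 4)) =O[𝓝 0]
          fun x => x ^ 6 := by
      refine isBigO_of_eq_mul (g := fun x => 7 / 2160 * (a ^ 2 * b ^ 4 - a ^ 4 * b ^ 2) -
        49 / 129600 * a ^ 4 * b ^ 4 * x ^ 2) (fun x => ?_) (by fun_prop)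
      simp only [mul_pow, hI2, hI4]
      ring
    refine ((t12.const_mul_left (-1)).add t5).congr_left fun x => ?_
    ring
  · simp only [profileLow, profileQuartic, if_neg hs, ← ha, ← hb]
    have t34 : (fun x : ℂ => (1 - 2 * Complex.cosh (x * (2 * a))
        - 2 * Complex.cosh (x * (2 * b * Complex.I))) -
        (1 - 2 * (1 + (x * (2 * a)) ^ 2 / 2 + (x * (2 * a)) ^ 4 / 24) -
          2 * (1 + (x * (2 * b * Complex.I)) ^ 2 / 2 + (x * (2 * b * Complex.I)) ^ 4 / 24)))
        =O[𝓝 0] fun x => x ^ 6 :=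
      ((t3.const_mul_left (-2)).add (t4.const_mul_left (-2))).congr_left fun x => by ring
    have t5 := isBigO_mul_sub_mul t12 t34 (by
      refine Continuous.continuousAt ?_
      fun_prop) (by fun_prop)
    have t6 : (fun x : ℂ => (1 - (x * a) ^ 2 / 6 + 7 * (x * a) ^ 4 / 360) *
        (1 - (x * (Complex.I * b)) ^ 2 / 6 + 7 * (x * (Complex.I * b)) ^ 4 / 360) *
        (1 - 2 * (1 + (x * (2 * a)) ^ 2 / 2 + (x * (2 * a)) ^ 4 / 24) -
          2 * (1 + (x * (2 * b * Complex.I)) ^ 2 / 2 + (x * (2 * b * Complex.I)) ^ 4 / 24)) -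
        (-3 + 7 / 2 * (b ^ 2 - a ^ 2) * x ^ 2 +
          -(29 / 40 * (b ^ 4 + a ^ 4) + 5 / 4 * (b ^ 2 * a ^ 2)) * x ^ 4)) =O[𝓝 0]
          fun x => x ^ 6 := by
      have hI : ∀ x : ℂ, (x * (Complex.I * b)) ^ 2 = -(x ^ 2 * b ^ 2) ∧
          (x * (Complex.I * b)) ^ 4 = x ^ 4 * b ^ 4 ∧
          (x * (2 * b * Complex.I)) ^ 2 = -4 * (x ^ 2 * b ^ 2) ∧
          (x * (2 * b * Complex.I)) ^ 4 = 16 * (x ^ 4 * b ^ 4) := fun x => by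
        refine ⟨?_, ?_, ?_, ?_⟩ <;> simp only [mul_pow, hI2, hI4] <;> ring
      -- The witness lists the coefficients of x⁶, x⁸, x¹⁰ and x¹² in the product of the three
      -- Taylor polynomials, divided by x⁶.
      refine isBigO_of_eq_mul (g := fun x =>
        (-(a ^ 2 - b ^ 2) / 6) * (-(4 / 3) * (a ^ 4 + b ^ 4)) +
        (7 / 360 * (a ^ 4 + b ^ 4) - a ^ 2 * b ^ 2 / 36) * (-4 * (a ^ 2 - b ^ 2)) -
        3 * (7 / 2160 * (a ^ 4 * b ^ 2 - a ^ 2 * b ^ 4)) +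
        ((7 / 360 * (a ^ 4 + b ^ 4) - a ^ 2 * b ^ 2 / 36) * (-(4 / 3) * (a ^ 4 + b ^ 4)) +
          (7 / 2160 * (a ^ 4 * b ^ 2 - a ^ 2 * b ^ 4)) * (-4 * (a ^ 2 - b ^ 2)) -
          3 * (49 / 129600 * a ^ 4 * b ^ 4)) * x ^ 2 +
        ((7 / 2160 * (a ^ 4 * b ^ 2 - a ^ 2 * b ^ 4)) * (-(4 / 3) * (a ^ 4 + b ^ 4)) +
          49 / 129600 * a ^ 4 * b ^ 4 * (-4 * (a ^ 2 - b ^ 2))) * x ^ 4 +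
        49 / 129600 * a ^ 4 * b ^ 4 * (-(4 / 3) * (a ^ 4 + b ^ 4)) * x ^ 6)
        (fun x => ?_) (by fun_prop)
      obtain ⟨h1, h2, h3, h4⟩ := hI x
      rw [h1, h2, h3, h4]
      ring
    refine (t5.add t6).congr_left fun x => ?_
    ring

theorem divergentPart_eq (s : ℕ) (q : ℝ) (E B : Vec3) (T : ℂ) :
    divergentPart s q (fieldStrength E B) T = profileLow s E B (q * T) := by
  rw [divergentPart, profileLow, trace_fieldStrength_sq]
  split_ifs <;> ring

/-! ### Bounds along the contour and convergence with a cutoff -/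

theorem norm_properTimeWeight (m : ℝ) (T : ℂ) :
    ‖properTimeWeight m T‖ =
      Real.exp (-(m ^ 2 * T.re)) / ((4 * Real.pi) ^ 2 * ‖T‖ ^ 3) := by
  have h : (-((m : ℂ) ^ 2 * T)).re = -(m ^ 2 * T.re) := by
    rw [Complex.neg_re, ← Complex.ofReal_pow, Complex.re_ofReal_mul]
  rw [properTimeWeight, norm_mul, norm_div, norm_div, norm_one, Complex.norm_exp, h, norm_pow,
    norm_mul, norm_mul, Complex.norm_real, Real.norm_of_nonneg Real.pi_pos.le]
  norm_num
  ring

theorem differentiableAt_properTimeWeight (m : ℝ) {T : ℂ} (hT : T ≠ 0) :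
    DifferentiableAt ℂ (properTimeWeight m) T := by
  unfold properTimeWeight
  have h : (4 * Real.pi * T) ^ 2 ≠ 0 := by simp [hT]
  fun_prop (disch := assumption)

theorem contourPoint_zero (φ r : ℝ) : contourPoint 0 φ r = r * Complex.exp (Complex.I * φ) := by
  simp [contourPoint]

theorem norm_exp_I_mul (φ : ℝ) : ‖Complex.exp (Complex.I * φ)‖ = 1 := by
  rw [mul_comm, Complex.norm_exp_ofReal_mul_I]

theorem pow_le_mul_exp (n : ℕ) {μ : ℝ} (hμ : 0 < μ) {r : ℝ} (hr : 0 ≤ r) :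
    r ^ n ≤ n.factorial / μ ^ n * Real.exp (μ * r) := by
  have h := Real.pow_div_factorial_le_exp (μ * r) (by positivity) n
  rw [div_le_iff₀ (by positivity), mul_pow] at h
  rw [div_mul_eq_mul_div, le_div_iff₀ (by positivity)]
  linarith

/-- The condition ε ≤ ε * r means r ≥ 1 when ε > 0 and nothing when ε = 0, so one statement serves
both the cutoff and the renormalized integrals. -/
theorem exists_profile_contour_bound (s : ℕ) (E B : Vec3) {q ε φ μ : ℝ} (hε : 0 ≤ ε)
    (hφ0 : 0 ≤ φ) (hφ : φ < Real.pi / 2) (hK : q * Kminus E B ≠ 0 → 0 < φ)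
    (hμ : |q| * growthRate s E B (Complex.exp (Complex.I * φ)) < μ) :
    ∃ C, ∀ r : ℝ, 0 ≤ r → ε ≤ ε * r →
      ‖profile s E B (q * contourPoint ε φ r)‖ ≤ C * Real.exp (μ * r) := by
  have hc : 0 < Real.cos φ := Real.cos_pos_of_mem_Ioo ⟨by linarith [Real.pi_pos], hφ⟩
  have hs : 0 ≤ Real.sin φ := Real.sin_nonneg_of_nonneg_of_le_pi hφ0 (by linarith [Real.pi_pos])
  have hc1 := Real.cos_le_one φ
  have hs1 := Real.sin_le_one φ
  have ha := Kplus_nonneg E B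
  have hb := Kminus_nonneg E B
  have e1 : (Complex.exp (Complex.I * φ)).re = Real.cos φ := by
    simpa [contourPoint] using contourPoint_re 0 φ 1
  have e2 : (Complex.exp (Complex.I * φ)).im = Real.sin φ := by
    simpa [contourPoint] using contourPoint_im 0 φ 1
  set g := growthRate s E B (Complex.exp (Complex.I * φ)) with hg
  -- The first summand bounds the opening of the sector needed for sinh, the second that for sin. At
  -- sin φ = 0 the second is 0 by convention; then q K₋ = 0 and no sector is needed for sin.
  set κ := 1 / Real.cos φ + (ε + 1) / Real.sin φ with hκ
  have hκ0 : 0 ≤ κ := by positivity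
  -- Half of the available gap for each of the two linear prefactors.
  set η := (μ - |q| * g) / 2 with hη
  have hη0 : 0 < η := by rw [hη]; linarith
  set a' := 2 * (Kplus E B * |q|) with ha'
  set b' := 2 * (Kminus E B * |q|) with hb'
  have ha0 : 0 ≤ a' := by positivity
  have hb0 : 0 ≤ b' := by positivity
  refine ⟨5 * (1 + κ) ^ 2 * ((1 + a' * ε) * (1 + a' / η)) * (1 + b' / η) *
    Real.exp (|q| * Kplus E B * ε), fun r hr hεr => ?_⟩
  set x : ℂ := q * contourPoint ε φ r with hx
  have hre : |x.re| = |q| * (ε + r * Real.cos φ) := by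
    rw [hx, Complex.re_ofReal_mul, contourPoint_re, abs_mul,
      abs_of_nonneg (a := ε + r * Real.cos φ) (by positivity)]
  have him : |x.im| = |q| * (r * Real.sin φ) := by
    rw [hx, Complex.im_ofReal_mul, contourPoint_im, abs_mul,
      abs_of_nonneg (a := r * Real.sin φ) (by positivity)]
  have h1 : Kplus E B * |x.im| ≤ κ * (Kplus E B * |x.re|) := by
    have : r * Real.sin φ ≤ κ * (ε + r * Real.cos φ) := by
      have h2 : 1 / Real.cos φ * (r * Real.cos φ) = r := by field_simp
      have h3 : 0 ≤ (ε + 1) / Real.sin φ * (ε + r * Real.cos φ) := by positivity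
      have h4 : 0 ≤ 1 / Real.cos φ * ε := by positivity
      have h5 : r * Real.sin φ ≤ r := by nlinarith
      rw [hκ, add_mul, mul_add]
      linarith
    rw [hre, him]
    calc _ = Kplus E B * |q| * (r * Real.sin φ) := by ring
      _ ≤ Kplus E B * |q| * (κ * (ε + r * Real.cos φ)) := by gcongr
      _ = _ := by ring
  have h2 : Kminus E B * |x.re| ≤ κ * (Kminus E B * |x.im|) := by
    rw [hre, him]
    by_cases hqK : q * Kminus E B = 0
    · have : Kminus E B * |q| = 0 := by
        rcases mul_eq_zero.1 hqK with h | h <;> simp [h]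
      rw [← mul_assoc, this, ← mul_assoc (Kminus E B), this]
      simp
    · have hs0 : 0 < Real.sin φ := Real.sin_pos_of_pos_of_lt_pi (hK hqK)
        (by linarith [Real.pi_pos])
      have : ε + r * Real.cos φ ≤ κ * (r * Real.sin φ) := by
        have h2 : (ε + 1) / Real.sin φ * (r * Real.sin φ) = ε * r + r := by field_simp
        have h4 : 0 ≤ 1 / Real.cos φ * (r * Real.sin φ) := by positivity
        have h5 : r * Real.cos φ ≤ r := by nlinarith
        rw [hκ, add_mul]
        linarith
      calc _ = Kminus E B * |q| * (ε + r * Real.cos φ) := by ring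
        _ ≤ Kminus E B * |q| * (κ * (r * Real.sin φ)) := by gcongr
        _ = _ := by ring
  have h3 : growthRate s E B x ≤ |q| * g * r + |q| * Kplus E B * ε := by
    rw [hg]
    unfold growthRate
    split_ifs with hs'
    · simp only [mul_zero, zero_mul, zero_add]; positivity
    · rw [hre, him, e1, e2, abs_of_pos hc, abs_of_nonneg hs]
      have h6 : Kplus E B * (|q| * (ε + r * Real.cos φ)) - Kminus E B * (|q| * (r * Real.sin φ)) =
        |q| * (Kplus E B * Real.cos φ - Kminus E B * Real.sin φ) * r + |q| * Kplus E B * ε := by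
        ring
      rw [h6]
      refine (abs_add_le _ _).trans (le_of_eq ?_)
      rw [abs_mul, abs_mul, abs_abs, abs_of_nonneg hr,
        abs_of_nonneg (a := |q| * Kplus E B * ε) (by positivity)]
  have h4 : 1 + 2 * (Kplus E B * |x.re|) ≤
      (1 + a' * ε) * ((1 + a' / η) * Real.exp (η * r)) := by
    refine le_trans ?_ (mul_le_mul_of_nonneg_left (one_add_mul_le_exp ha0 hη0 hr) (by positivity))
    rw [hre]
    have h7 : a' * (r * Real.cos φ) ≤ a' * r := by gcongr; nlinarith
    have h8 : 0 ≤ (a' * ε) * (a' * r) := by positivity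
    calc _ = 1 + a' * ε + a' * (r * Real.cos φ) := by rw [ha']; ring
      _ ≤ _ := by nlinarith
  have h5 : 1 + 2 * (Kminus E B * |x.im|) ≤ (1 + b' / η) * Real.exp (η * r) := by
    refine le_trans ?_ (one_add_mul_le_exp hb0 hη0 hr)
    rw [him]
    have h7 : b' * (r * Real.sin φ) ≤ b' * r := by gcongr; nlinarith
    calc _ = 1 + b' * (r * Real.sin φ) := by rw [hb']; ring
      _ ≤ _ := by linarith
  calc _ ≤ _ := norm_profile_le s E B hκ0 h1 h2
    _ ≤ 5 * (1 + κ) ^ 2 * ((1 + a' * ε) * ((1 + a' / η) * Real.exp (η * r))) *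
        ((1 + b' / η) * Real.exp (η * r)) * Real.exp (|q| * g * r + |q| * Kplus E B * ε) := by
        gcongr
    _ = 5 * (1 + κ) ^ 2 * ((1 + a' * ε) * (1 + a' / η)) * (1 + b' / η) *
        Real.exp (|q| * Kplus E B * ε) *
          (Real.exp (η * r) * Real.exp (η * r) * Real.exp (|q| * g * r)) := by
        rw [Real.exp_add]; ring
    _ = _ := by
        rw [← Real.exp_add, ← Real.exp_add]
        congr 2
        rw [hη]
        ring

/-- Along an admissible contour the mass term dominates the growth of the spin-`s` profile. -/
theorem AdmissibleContour.growth_lt {s : ℕ} {m q : ℝ} {E B : Vec3} {ε φ : ℝ} (hm : 0 < m)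
    (hs : s ≤ 1) (h : AdmissibleContour s m q E B ε φ) :
    |q| * growthRate s E B (Complex.exp (Complex.I * φ)) < m ^ 2 * Real.cos φ := by
  obtain ⟨-, -, hφ0, hφ, -, h6⟩ := h
  have hc : 0 < Real.cos φ := Real.cos_pos_of_mem_Ioo ⟨by linarith [Real.pi_pos], hφ⟩
  have hs0 : 0 ≤ Real.sin φ := Real.sin_nonneg_of_nonneg_of_le_pi hφ0 (by linarith [Real.pi_pos])
  have e1 : (Complex.exp (Complex.I * φ)).re = Real.cos φ := by
    simpa [contourPoint] using contourPoint_re 0 φ 1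
  have e2 : (Complex.exp (Complex.I * φ)).im = Real.sin φ := by
    simpa [contourPoint] using contourPoint_im 0 φ 1
  unfold growthRate
  split_ifs with h0
  · rw [mul_zero]; positivity
  · rw [e1, e2, abs_of_pos hc, abs_of_nonneg hs0]
    exact h6 (by omega)

theorem contourPoint_ne_zero {ε φ r : ℝ} (hε : 0 ≤ ε) (hφ0 : 0 ≤ φ) (hφ : φ < Real.pi / 2)
    (hr : 0 ≤ r) (h : 0 < ε ∨ 0 < r) : contourPoint ε φ r ≠ 0 := by
  have hc : 0 < Real.cos φ := Real.cos_pos_of_mem_Ioo ⟨by linarith [Real.pi_pos], hφ⟩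
  intro h0
  have h1 := congrArg Complex.re h0
  rw [contourPoint_re, Complex.zero_re] at h1
  have h2 : 0 ≤ r * Real.cos φ := by positivity
  rcases h with h | h
  · linarith
  · have : 0 < r * Real.cos φ := by positivity
    linarith

/-- The cutoff ε > 0 keeps the integrand continuous down to r = 0, so only the tail matters; there a
rate μ strictly between the growth of the profile and m² cos φ leaves exponential decay. -/
theorem integrableOn_contourPullback_profile {s : ℕ} {m q : ℝ} {E B : Vec3} {ε φ : ℝ}
    (hm : 0 < m) (hs : s ≤ 1) (hε : 0 < ε) (h : AdmissibleContour s m q E B ε φ) :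
    MeasureTheory.IntegrableOn (contourPullback ε φ
      (fun T => properTimeWeight m T * profile s E B (q * T))) (Set.Ioi 0) := by
  have hg := h.growth_lt hm hs
  obtain ⟨hε0, hεK, hφ0, hφ, hK, -⟩ := h
  have hc : 0 < Real.cos φ := Real.cos_pos_of_mem_Ioo ⟨by linarith [Real.pi_pos], hφ⟩
  obtain ⟨μ, hμ1, hμ2⟩ := exists_between hg
  obtain ⟨C, hC⟩ := exists_profile_contour_bound s E B hε0 hφ0 hφ hK hμ1
  have hcont : ContinuousOn (contourPullback ε φ
      (fun T => properTimeWeight m T * profile s E B (q * T))) (Set.Ici 0) := by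
    intro r hr
    refine ContinuousAt.continuousWithinAt ?_
    unfold contourPullback
    refine ContinuousAt.mul ?_ continuousAt_const
    have d1 := (differentiableAt_properTimeWeight m
      (contourPoint_ne_zero hε0 hφ0 hφ hr (Or.inl hε))).continuousAt
    have d2 := (differentiableAt_profile_contour s E B hε0 hεK hφ0 hφ hK hr).continuousAt
    have d3 := (continuous_contourPoint ε φ).continuousAt (x := r)
    exact (d1.comp (f := contourPoint ε φ) d3).mul
      (ContinuousAt.comp (f := fun r => (q : ℂ) * contourPoint ε φ r) d2
        (continuousAt_const.mul d3))
  have hO : contourPullback ε φ (fun T => properTimeWeight m T * profile s E B (q * T))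
      =O[atTop] fun r => Real.exp (-(m ^ 2 * Real.cos φ - μ) * r) := by
    refine IsBigO.of_bound C ?_
    filter_upwards [eventually_ge_atTop 1] with r hr
    have hr0 : 0 ≤ r := by linarith
    have b1 := hC r hr0 (by nlinarith)
    have b2 : ‖properTimeWeight m (contourPoint ε φ r)‖ ≤ Real.exp (-(m ^ 2 * Real.cos φ) * r) := by
      rw [norm_properTimeWeight]
      have n1 : 1 ≤ ‖contourPoint ε φ r‖ := hr.trans (le_norm_contourPoint hε0 hφ0 hφ.le hr0)
      have n2 : 1 ≤ (4 * Real.pi) ^ 2 * ‖contourPoint ε φ r‖ ^ 3 :=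
        one_le_mul_of_one_le_of_one_le (one_le_pow₀ (by linarith [Real.pi_gt_three]))
          (one_le_pow₀ n1)
      refine (div_le_self (Real.exp_pos _).le n2).trans (Real.exp_le_exp.2 ?_)
      rw [contourPoint_re]
      have : 0 ≤ m ^ 2 * ε := by positivity
      nlinarith
    rw [contourPullback, norm_mul, norm_mul, norm_exp_I_mul, mul_one,
      Real.norm_of_nonneg (Real.exp_pos _).le]
    calc _ ≤ Real.exp (-(m ^ 2 * Real.cos φ) * r) * (C * Real.exp (μ * r)) := by gcongr
      _ = C * (Real.exp (-(m ^ 2 * Real.cos φ) * r) * Real.exp (μ * r)) := by ring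
      _ = _ := by rw [← Real.exp_add]; ring_nf
  have hi := integrableOn_Ici_iff_integrableOn_Ioi (μ := MeasureTheory.volume) (b := (0 : ℝ))
    (f := contourPullback ε φ (fun T => properTimeWeight m T * profile s E B (q * T)))
    (by finiteness) |>.mp <|
    (hcont.locallyIntegrableOn measurableSet_Ici).integrableOn_of_isBigO_atTop
    hO ⟨Set.Ioi 0, Ioi_mem_atTop 0, exp_neg_integrableOn_Ioi 0 (by linarith)⟩
  exact hi

/-! ### Renormalized integrals and weak fields -/

/-- The spin-`s` profile minus its quartic Taylor polynomial. -/
noncomputable def profileRem (s : ℕ) (E B : Vec3) (x : ℂ) : ℂ :=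
  profile s E B x - (profileLow s E B x + profileQuartic s E B * x ^ 4)

/-- Evenness allows |q| in place of q in the scaling argument of `renormalizedMinkowski_isBigO`. -/
theorem profileRem_neg (s : ℕ) (E B : Vec3) (x : ℂ) :
    profileRem s E B (-x) = profileRem s E B x := by
  have h4 : (-x) ^ 4 = x ^ 4 := by ring
  simp [profileRem, profile, profileLow, divSinh, divSin, neg_mul, mul_neg, h4]

theorem exists_profileLow_add_quartic_bound (s : ℕ) (E B : Vec3) (q : ℝ) {φ μ : ℝ} (hμ : 0 < μ) :
    ∃ C, ∀ r : ℝ, 0 ≤ r → ‖profileLow s E B (q * contourPoint 0 φ r) +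
      profileQuartic s E B * (q * contourPoint 0 φ r) ^ 4‖ ≤ C * Real.exp (μ * r) := by
  obtain ⟨c₀, c₂, hlow⟩ : ∃ c₀ c₂ : ℂ, ∀ x, profileLow s E B x = c₀ + c₂ * x ^ 2 := by
    unfold profileLow
    split_ifs
    · exact ⟨-1, -(1 / 6 * ((Kminus E B : ℂ) ^ 2 - (Kplus E B : ℂ) ^ 2)), fun x => by ring⟩
    · exact ⟨-3, 7 / 2 * ((Kminus E B : ℂ) ^ 2 - (Kplus E B : ℂ) ^ 2), fun x => by ring⟩
  refine ⟨‖c₀‖ + ‖c₂‖ * |q| ^ 2 * (Nat.factorial 2 / μ ^ 2) +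
    ‖profileQuartic s E B‖ * |q| ^ 4 * (Nat.factorial 4 / μ ^ 4), fun r hr => ?_⟩
  have hx : ‖(q : ℂ) * contourPoint 0 φ r‖ = |q| * r := by
    rw [contourPoint_zero, norm_mul, norm_mul, norm_exp_I_mul, Complex.norm_real, Complex.norm_real,
      Real.norm_of_nonneg hr, mul_one, Real.norm_eq_abs]
  rw [hlow]
  have h1 : (1 : ℝ) ≤ Real.exp (μ * r) := Real.one_le_exp (by positivity)
  calc _ ≤ ‖c₀‖ + ‖c₂‖ * (|q| * r) ^ 2 + ‖profileQuartic s E B‖ * (|q| * r) ^ 4 := by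
        rw [← hx, ← norm_pow, ← norm_pow, ← norm_mul, ← norm_mul]
        exact norm_add₃_le
    _ = ‖c₀‖ * 1 + ‖c₂‖ * |q| ^ 2 * r ^ 2 + ‖profileQuartic s E B‖ * |q| ^ 4 * r ^ 4 := by ring
    _ ≤ ‖c₀‖ * Real.exp (μ * r) +
        ‖c₂‖ * |q| ^ 2 * (Nat.factorial 2 / μ ^ 2 * Real.exp (μ * r)) +
        ‖profileQuartic s E B‖ * |q| ^ 4 * (Nat.factorial 4 / μ ^ 4 * Real.exp (μ * r)) := by
        gcongr
        · exact pow_le_mul_exp 2 hμ hr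
        · exact pow_le_mul_exp 4 hμ hr
    _ = _ := by ring

/-- Taylor's bound gives r⁶ for r < d. For r ≥ d the factor (r/d)⁶ is at least 1 and can be inserted
for free into the exponential bounds. -/
theorem exists_profileRem_bound (s : ℕ) (E B : Vec3) {q φ μ : ℝ}
    (hφ0 : 0 ≤ φ) (hφ : φ < Real.pi / 2) (hK : q * Kminus E B ≠ 0 → 0 < φ)
    (hμ : |q| * growthRate s E B (Complex.exp (Complex.I * φ)) < μ) :
    ∃ C, 0 ≤ C ∧ ∀ r : ℝ, 0 ≤ r →
      ‖profileRem s E B (q * contourPoint 0 φ r)‖ ≤ C * r ^ 6 * Real.exp (μ * r) := by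
  have hμ0 : 0 < μ := lt_of_le_of_lt
    (mul_nonneg (abs_nonneg _) (growthRate_nonneg _ _ _ _)) hμ
  obtain ⟨C₁, h1⟩ := exists_profile_contour_bound s E B (le_refl (0 : ℝ)) hφ0 hφ hK hμ
  obtain ⟨C₂, h2⟩ := exists_profileLow_add_quartic_bound s E B q (φ := φ) hμ0
  obtain ⟨C₃, hC₃, h3⟩ := (profile_taylor s E B).exists_pos
  rw [isBigOWith_iff, Metric.eventually_nhds_iff] at h3
  obtain ⟨δ, hδ, h3⟩ := h3
  have hx : ∀ r : ℝ, 0 ≤ r → ‖(q : ℂ) * contourPoint 0 φ r‖ = |q| * r := by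
    intro r hr
    rw [contourPoint_zero, norm_mul, norm_mul, norm_exp_I_mul, Complex.norm_real, Complex.norm_real,
      Real.norm_of_nonneg hr, mul_one, Real.norm_eq_abs]
  set d := δ / (|q| + 1) with hd
  have hd0 : 0 < d := by positivity
  have hC12 : 0 ≤ C₁ + C₂ := by
    have b1 := (norm_nonneg _).trans (h1 0 le_rfl (by simp))
    have b2 := (norm_nonneg _).trans (h2 0 le_rfl)
    simp at b1 b2
    linarith
  refine ⟨C₃ * |q| ^ 6 + (C₁ + C₂) / d ^ 6, by positivity, fun r hr => ?_⟩
  by_cases hrd : r < d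
  · have hlt : |q| * r < δ := by
      rw [hd, lt_div_iff₀ (by positivity)] at hrd
      linarith
    have b := h3 (y := q * contourPoint 0 φ r) (by rwa [dist_zero_right, hx r hr])
    rw [norm_pow, hx r hr] at b
    have e1 : 1 ≤ Real.exp (μ * r) := Real.one_le_exp (by positivity)
    calc _ ≤ C₃ * |q| ^ 6 * r ^ 6 * 1 := by rw [profileRem]; linarith
      _ ≤ _ := by
        gcongr
        exact le_add_of_nonneg_right (by positivity)
  · have hr6 : 1 ≤ r ^ 6 / d ^ 6 := by
      rw [← div_pow]
      exact one_le_pow₀ ((one_le_div hd0).2 (not_lt.1 hrd))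
    calc _ ≤ C₁ * Real.exp (μ * r) + C₂ * Real.exp (μ * r) :=
          (norm_sub_le _ _).trans (add_le_add (h1 r hr (by simp)) (h2 r hr))
      _ = (C₁ + C₂) * 1 * Real.exp (μ * r) := by ring
      _ ≤ (C₁ + C₂) * (r ^ 6 / d ^ 6) * Real.exp (μ * r) := by gcongr
      _ = (C₁ + C₂) / d ^ 6 * r ^ 6 * Real.exp (μ * r) := by ring
      _ ≤ _ := by
        gcongr
        exact le_add_of_nonneg_left (by positivity)

theorem norm_weight_contour_zero (m φ : ℝ) {r : ℝ} (hr : 0 ≤ r) :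
    ‖properTimeWeight m (contourPoint 0 φ r)‖ =
      Real.exp (-(m ^ 2 * Real.cos φ) * r) / ((4 * Real.pi) ^ 2 * r ^ 3) := by
  rw [norm_properTimeWeight, contourPoint_re, contourPoint_zero, norm_mul, norm_exp_I_mul,
    Complex.norm_real, Real.norm_of_nonneg hr]
  ring_nf

/-- The weight costs r⁻³, leaving r³. Of the spare rate 2η, one η absorbs r³ at the price 3!/η³ and
the other remains for integrability. -/
theorem norm_weight_mul_le {m φ μ η C r : ℝ} (x : ℂ) (hr : 0 < r) (hC : 0 ≤ C) (hη : 0 < η)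
    (hμ : μ + 2 * η ≤ m ^ 2 * Real.cos φ) (hx : ‖x‖ ≤ C * r ^ 6 * Real.exp (μ * r)) :
    ‖properTimeWeight m (contourPoint 0 φ r) * x * Complex.exp (Complex.I * φ)‖ ≤
      C * (Nat.factorial 3 / η ^ 3) * Real.exp (-η * r) := by
  rw [norm_mul, norm_mul, norm_exp_I_mul, mul_one, norm_weight_contour_zero m φ hr.le]
  have hpi : 1 ≤ (4 * Real.pi) ^ 2 := one_le_pow₀ (by linarith [Real.pi_gt_three])
  calc _ ≤ Real.exp (-(m ^ 2 * Real.cos φ) * r) / (1 * r ^ 3) *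
        (C * r ^ 6 * Real.exp (μ * r)) := by gcongr
    _ = C * r ^ 3 * (Real.exp (-(m ^ 2 * Real.cos φ) * r) * Real.exp (μ * r)) := by
        field_simp
    _ ≤ C * (Nat.factorial 3 / η ^ 3 * Real.exp (η * r)) * Real.exp (-(2 * η) * r) := by
        rw [← Real.exp_add]
        gcongr
        · exact pow_le_mul_exp 3 hη hr.le
        · nlinarith
    _ = C * (Nat.factorial 3 / η ^ 3) * (Real.exp (η * r) * Real.exp (-(2 * η) * r)) := by ring
    _ = _ := by rw [← Real.exp_add]; ring_nf

theorem profileLow_differentiable (s : ℕ) (E B : Vec3) : Differentiable ℂ (profileLow s E B) := by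
  unfold profileLow
  split_ifs <;> fun_prop

theorem continuousOn_remainder_contour (s : ℕ) (m : ℝ) (E B : Vec3) {q φ : ℝ}
    (hφ0 : 0 ≤ φ) (hφ : φ < Real.pi / 2) (hK : q * Kminus E B ≠ 0 → 0 < φ) :
    ContinuousOn (fun r : ℝ => properTimeWeight m (contourPoint 0 φ r) *
      profileRem s E B (q * contourPoint 0 φ r) * Complex.exp (Complex.I * φ)) (Set.Ioi 0) := by
  intro r hr
  refine ContinuousAt.continuousWithinAt ?_
  refine ContinuousAt.mul ?_ continuousAt_const
  have hr' : (0 : ℝ) < r := hr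
  have d1 := (differentiableAt_properTimeWeight m
    (contourPoint_ne_zero le_rfl hφ0 hφ hr'.le (Or.inr hr'))).continuousAt
  have d2 := (differentiableAt_profile_contour s E B le_rfl (by simp [Real.pi_pos]) hφ0 hφ hK
    hr'.le).continuousAt
  have d2' : ContinuousAt (profileRem s E B) (q * contourPoint 0 φ r) := by
    unfold profileRem
    have := ((profileLow_differentiable s E B).continuous).continuousAt
      (x := q * contourPoint 0 φ r)
    fun_prop
  have d3 := (continuous_contourPoint 0 φ).continuousAt (x := r)
  exact (d1.comp (f := contourPoint 0 φ) d3).mul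
    (ContinuousAt.comp (f := fun r => (q : ℂ) * contourPoint 0 φ r) d2' (continuousAt_const.mul d3))

theorem integrableOn_remainder_contour {s : ℕ} {m : ℝ} {E B : Vec3} {q φ : ℝ}
    (hφ0 : 0 ≤ φ) (hφ : φ < Real.pi / 2) (hK : q * Kminus E B ≠ 0 → 0 < φ)
    (hg : |q| * growthRate s E B (Complex.exp (Complex.I * φ)) < m ^ 2 * Real.cos φ) :
    MeasureTheory.IntegrableOn (fun r : ℝ => properTimeWeight m (contourPoint 0 φ r) *
      profileRem s E B (q * contourPoint 0 φ r) * Complex.exp (Complex.I * φ)) (Set.Ioi 0) := by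
  obtain ⟨μ, hμ1, hμ2⟩ := exists_between hg
  obtain ⟨C, hC0, hC⟩ := exists_profileRem_bound s E B hφ0 hφ hK hμ1
  set η := (m ^ 2 * Real.cos φ - μ) / 2 with hη
  have hη0 : 0 < η := by rw [hη]; linarith
  refine MeasureTheory.Integrable.mono'
    ((exp_neg_integrableOn_Ioi 0 hη0).const_mul (C * (Nat.factorial 3 / η ^ 3)))
    ((continuousOn_remainder_contour s m E B hφ0 hφ hK).aestronglyMeasurable measurableSet_Ioi) ?_
  refine MeasureTheory.ae_restrict_of_forall_mem measurableSet_Ioi fun r hr => ?_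
  exact norm_weight_mul_le _ hr hC0 hη0 (by rw [hη]; linarith) (hC r (le_of_lt hr))

theorem quartic_contour_eq (m q φ : ℝ) (c : ℂ) {r : ℝ} (hr : 0 < r) :
    properTimeWeight m (contourPoint 0 φ r) * (c * (q * contourPoint 0 φ r) ^ 4) *
      Complex.exp (Complex.I * φ) = c * q ^ 4 / (16 * Real.pi ^ 2) *
        Complex.exp (Complex.I * φ) ^ 2 * ((r : ℂ) *
          Complex.exp (-(m ^ 2 * Complex.exp (Complex.I * φ) * r))) := by
  have h1 : (r : ℂ) ≠ 0 := by exact_mod_cast hr.ne'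
  have h2 := Complex.exp_ne_zero (Complex.I * φ)
  have h3 : (Real.pi : ℂ) ≠ 0 := by exact_mod_cast Real.pi_ne_zero
  rw [contourPoint_zero, properTimeWeight,
    show (m : ℂ) ^ 2 * (r * Complex.exp (Complex.I * φ)) =
      m ^ 2 * Complex.exp (Complex.I * φ) * r by ring]
  field_simp
  ring

theorem re_mass_mul_exp_pos {m φ : ℝ} (hm : 0 < m) (hφ0 : 0 ≤ φ) (hφ : φ < Real.pi / 2) :
    0 < ((m : ℂ) ^ 2 * Complex.exp (Complex.I * φ)).re := by
  have hc : 0 < Real.cos φ := Real.cos_pos_of_mem_Ioo ⟨by linarith [Real.pi_pos], hφ⟩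
  have e1 : (Complex.exp (Complex.I * φ)).re = Real.cos φ := by
    simpa [contourPoint] using contourPoint_re 0 φ 1
  rw [← Complex.ofReal_pow, Complex.re_ofReal_mul, e1]
  positivity

theorem integrableOn_mul_exp_neg {b : ℂ} (hb : 0 < b.re) :
    MeasureTheory.IntegrableOn (fun r : ℝ => (r : ℂ) * Complex.exp (-(b * r))) (Set.Ioi 0) := by
  have hη : 0 < b.re / 2 := by positivity
  refine MeasureTheory.Integrable.mono'
    ((exp_neg_integrableOn_Ioi 0 hη).const_mul (Nat.factorial 1 / (b.re / 2) ^ 1)) ?_ ?_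
  · exact ContinuousOn.aestronglyMeasurable (Continuous.continuousOn (by fun_prop))
      measurableSet_Ioi
  · refine MeasureTheory.ae_restrict_of_forall_mem measurableSet_Ioi fun r hr => ?_
    have hr' : (0 : ℝ) < r := hr
    rw [norm_mul, Complex.norm_real, Real.norm_of_nonneg hr'.le, Complex.norm_exp, Complex.neg_re,
      Complex.re_mul_ofReal]
    have h := pow_le_mul_exp 1 hη hr'.le
    rw [pow_one] at h
    calc r * Real.exp (-(b.re * r)) ≤
        Nat.factorial 1 / (b.re / 2) ^ 1 * Real.exp (b.re / 2 * r) * Real.exp (-(b.re * r)) := by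
          gcongr
      _ = _ := by rw [mul_assoc, ← Real.exp_add]; ring_nf

theorem integral_mul_exp_neg {b : ℂ} (hb : 0 < b.re) :
    ∫ r in Set.Ioi (0 : ℝ), (r : ℂ) * Complex.exp (-(b * r)) = 1 / b ^ 2 := by
  have hb0 : b ≠ 0 := fun h => by simp [h] at hb
  have hderiv : ∀ r ∈ Set.Ici (0 : ℝ), HasDerivAt
      (fun r : ℝ => -((r : ℂ) / b + 1 / b ^ 2) * Complex.exp (-(b * r)))
      ((r : ℂ) * Complex.exp (-(b * r))) r := by
    intro r _
    have h0 : HasDerivAt (fun r : ℝ => (r : ℂ)) 1 r := Complex.ofRealCLM.hasDerivAt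
    have h1 : HasDerivAt (fun r : ℝ => -((r : ℂ) / b + 1 / b ^ 2)) (-(1 / b)) r :=
      ((h0.div_const b).add_const _).neg
    have h2 : HasDerivAt (fun r : ℝ => Complex.exp (-(b * r)))
        (Complex.exp (-(b * r)) * -(b * 1)) r := (h0.const_mul b).neg.cexp
    refine (h1.mul h2).congr_deriv ?_
    field_simp
    ring
  have hlim : Tendsto (fun r : ℝ => -((r : ℂ) / b + 1 / b ^ 2) * Complex.exp (-(b * r))) atTop
      (𝓝 0) := by
    have hη : 0 < b.re / 2 := by positivity
    have h1 : Tendsto (fun r : ℝ => (1 / ‖b‖ ^ 2) * (1 + ‖b‖ / (b.re / 2)) *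
        Real.exp (-(b.re / 2 * r))) atTop (𝓝 0) := by
      have h2 := Real.tendsto_exp_neg_atTop_nhds_zero.comp (tendsto_id.const_mul_atTop hη)
      have h3 := h2.const_mul ((1 / ‖b‖ ^ 2) * (1 + ‖b‖ / (b.re / 2)))
      rw [mul_zero] at h3
      exact h3
    refine squeeze_zero_norm' ?_ h1
    filter_upwards [eventually_ge_atTop 0] with r hr
    rw [norm_mul, norm_neg, Complex.norm_exp, Complex.neg_re, Complex.re_mul_ofReal]
    have hnb : 0 < ‖b‖ := norm_pos_iff.2 hb0
    have h3 : ‖(r : ℂ) / b + 1 / b ^ 2‖ ≤ (1 / ‖b‖ ^ 2) * (1 + ‖b‖ * r) := by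
      refine (norm_add_le _ _).trans (le_of_eq ?_)
      rw [norm_div, norm_div, norm_pow, norm_one, Complex.norm_real, Real.norm_of_nonneg hr]
      field_simp
      ring
    have h4 := one_add_mul_le_exp hnb.le hη hr
    calc _ ≤ (1 / ‖b‖ ^ 2) * ((1 + ‖b‖ / (b.re / 2)) * Real.exp (b.re / 2 * r)) *
          Real.exp (-(b.re * r)) := by
          gcongr
          exact h3.trans (by gcongr)
      _ = (1 / ‖b‖ ^ 2) * (1 + ‖b‖ / (b.re / 2)) *
          (Real.exp (b.re / 2 * r) * Real.exp (-(b.re * r))) := by ring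
      _ = _ := by rw [← Real.exp_add]; ring_nf
  rw [MeasureTheory.integral_Ioi_of_hasDerivAt_of_tendsto' hderiv (integrableOn_mul_exp_neg hb)
    hlim]
  simp

theorem integrableOn_quartic_contour {m q φ : ℝ} (c : ℂ) (hm : 0 < m) (hφ0 : 0 ≤ φ)
    (hφ : φ < Real.pi / 2) :
    MeasureTheory.IntegrableOn (fun r : ℝ => properTimeWeight m (contourPoint 0 φ r) *
      (c * (q * contourPoint 0 φ r) ^ 4) * Complex.exp (Complex.I * φ)) (Set.Ioi 0) := by
  refine MeasureTheory.IntegrableOn.congr_fun ?_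
    (fun r hr => (quartic_contour_eq m q φ c hr).symm) measurableSet_Ioi
  exact (integrableOn_mul_exp_neg (re_mass_mul_exp_pos hm hφ0 hφ)).const_mul _

/-- The integral of r e^{-br} is 1/b² with b = m² e^{iφ}; the factor e^{2iφ} from T⁴ and dT against
T⁻³ cancels the phase, so the result does not depend on φ. -/
theorem integral_quartic_contour {m q φ : ℝ} (c : ℂ) (hm : 0 < m) (hφ0 : 0 ≤ φ)
    (hφ : φ < Real.pi / 2) :
    ∫ r in Set.Ioi (0 : ℝ), properTimeWeight m (contourPoint 0 φ r) *
      (c * (q * contourPoint 0 φ r) ^ 4) * Complex.exp (Complex.I * φ) =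
        c * q ^ 4 / (16 * Real.pi ^ 2 * m ^ 4) := by
  have hb := re_mass_mul_exp_pos hm hφ0 hφ
  rw [MeasureTheory.setIntegral_congr_fun measurableSet_Ioi
    (fun r hr => quartic_contour_eq m q φ c hr)]
  rw [MeasureTheory.integral_const_mul, integral_mul_exp_neg hb]
  have h1 : (m : ℂ) ≠ 0 := by exact_mod_cast hm.ne'
  have h2 := Complex.exp_ne_zero (Complex.I * φ)
  have h3 : (Real.pi : ℂ) ≠ 0 := by exact_mod_cast Real.pi_ne_zero
  field_simp

theorem contourPullback_renormalized {s : ℕ} (hs : s ≤ 1) (m q : ℝ) (E B : Vec3) (φ r : ℝ) :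
    contourPullback 0 φ (renormalizedIntegrand s m q (fieldStrength E B)) r =
      properTimeWeight m (contourPoint 0 φ r) * profileRem s E B (q * contourPoint 0 φ r) *
        Complex.exp (Complex.I * φ) +
      properTimeWeight m (contourPoint 0 φ r) *
        (profileQuartic s E B * (q * contourPoint 0 φ r) ^ 4) * Complex.exp (Complex.I * φ) := by
  rw [contourPullback, renormalizedIntegrand, worldlineFactor_eq_profile s hs, divergentPart_eq,
    profileRem]
  ring

theorem integrableOn_renormalized {s : ℕ} (hs : s ≤ 1) {m q : ℝ} {E B : Vec3} {φ : ℝ}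
    (hm : 0 < m) (h : AdmissibleContour s m q E B 0 φ) :
    MeasureTheory.IntegrableOn (contourPullback 0 φ
      (renormalizedIntegrand s m q (fieldStrength E B))) (Set.Ioi 0) := by
  have hg := h.growth_lt hm hs
  obtain ⟨-, -, hφ0, hφ, hK, -⟩ := h
  rw [funext (contourPullback_renormalized hs m q E B φ)]
  exact (integrableOn_remainder_contour hφ0 hφ hK hg).add
    (integrableOn_quartic_contour _ hm hφ0 hφ)

/-- The weak-field expansion of the renormalized Lagrangian. -/
theorem renormalizedMinkowski_isBigO {s : ℕ} (hs : s ≤ 1) {m : ℝ} {E B : Vec3} {φ : ℝ}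
    (hm : 0 < m) (hφ0 : 0 ≤ φ) (hφ : φ < Real.pi / 2) (hK : Kminus E B ≠ 0 → 0 < φ) :
    (fun q : ℝ => renormalizedMinkowski s m q E B φ -
      (1 / 4 * (fieldStrength E B ^ 2).trace -
        profileQuartic s E B * q ^ 4 / (16 * Real.pi ^ 2 * m ^ 4))) =O[𝓝 0] fun q : ℝ => q ^ 6 := by
  have hc : 0 < Real.cos φ := Real.cos_pos_of_mem_Ioo ⟨by linarith [Real.pi_pos], hφ⟩
  have hmc : 0 < m ^ 2 * Real.cos φ := by positivity
  set g := growthRate s E B (Complex.exp (Complex.I * φ)) with hgdef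
  have hg0 : 0 ≤ g := growthRate_nonneg _ _ _ _
  have hμ : |(1 : ℝ)| * g < g + 1 := by simp
  -- The constant is fixed once, at charge 1; other charges are reached by rescaling r, which is
  -- where the factor |q|⁶ comes from.
  obtain ⟨C, hC0, hC⟩ := exists_profileRem_bound s E B hφ0 hφ (q := 1) (by simpa using hK) hμ
  set η := m ^ 2 * Real.cos φ / 4 with hη
  have hη0 : 0 < η := by positivity
  set J := ∫ r in Set.Ioi (0 : ℝ), (Nat.factorial 3 / η ^ 3) * Real.exp (-η * r) with hJ
  refine IsBigO.of_bound (C * J) ?_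
  -- For such q the rescaled rate |q|(g + 1) uses less than half of m² cos φ; the other half is 2η.
  -- The growth condition needed for convergence also holds automatically for these q.
  have hd : 0 < m ^ 2 * Real.cos φ / (2 * (g + 1)) := by positivity
  filter_upwards [Metric.ball_mem_nhds (0 : ℝ) hd] with q hq
  rw [mem_ball_zero_iff, Real.norm_eq_abs, lt_div_iff₀ (by positivity)] at hq
  have hqg : |q| * g < m ^ 2 * Real.cos φ := by nlinarith [abs_nonneg q]
  have hqK : q * Kminus E B ≠ 0 → 0 < φ := fun h => hK (right_ne_zero_of_mul h)
  have hbound : ∀ r : ℝ, 0 < r → ‖profileRem s E B (q * contourPoint 0 φ r)‖ ≤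
      C * |q| ^ 6 * r ^ 6 * Real.exp (|q| * (g + 1) * r) := by
    intro r hr
    have h1 := hC (|q| * r) (by positivity)
    have h2 : profileRem s E B (q * contourPoint 0 φ r) =
        profileRem s E B (((1 : ℝ) : ℂ) * contourPoint 0 φ (|q| * r)) := by
      rw [contourPoint_zero, contourPoint_zero, Complex.ofReal_one, one_mul, Complex.ofReal_mul]
      rcases abs_choice q with h | h
      · rw [h, mul_assoc]
      · rw [h, Complex.ofReal_neg, neg_mul, neg_mul, profileRem_neg, mul_assoc]
    rw [h2]
    refine h1.trans (le_of_eq ?_)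
    rw [mul_pow]
    ring_nf
  have hdiff : renormalizedMinkowski s m q E B φ -
      (1 / 4 * (fieldStrength E B ^ 2).trace -
        profileQuartic s E B * q ^ 4 / (16 * Real.pi ^ 2 * m ^ 4)) =
      -∫ r in Set.Ioi (0 : ℝ), properTimeWeight m (contourPoint 0 φ r) *
        profileRem s E B (q * contourPoint 0 φ r) * Complex.exp (Complex.I * φ) := by
    rw [renormalizedMinkowski, renormalizedLagrangian, contourIntegral]
    simp_rw [contourPullback_renormalized hs]
    rw [MeasureTheory.integral_add (integrableOn_remainder_contour hφ0 hφ hqK hqg)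
      (integrableOn_quartic_contour _ hm hφ0 hφ), integral_quartic_contour _ hm hφ0 hφ]
    ring
  rw [hdiff, norm_neg, norm_pow, Real.norm_eq_abs]
  refine (MeasureTheory.norm_integral_le_of_norm_le
    (((exp_neg_integrableOn_Ioi 0 hη0).const_mul (Nat.factorial 3 / η ^ 3)).const_mul
      (C * |q| ^ 6)) ?_).trans (le_of_eq ?_)
  · refine MeasureTheory.ae_restrict_of_forall_mem measurableSet_Ioi fun r hr => ?_
    rw [← mul_assoc]
    exact norm_weight_mul_le _ hr (by positivity) hη0 (by rw [hη]; linarith) (hbound r hr)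
  · rw [MeasureTheory.integral_const_mul, ← hJ]
    ring

/-! ### Shifting lines and rotating rays of integration -/

open MeasureTheory in
theorem integrable_exp_neg_mul_abs {δ : ℝ} (hδ : 0 < δ) :
    Integrable fun x : ℝ => Real.exp (-δ * |x|) := by
  rw [← integrableOn_univ, ← Set.Iic_union_Ioi (a := (0 : ℝ))]
  refine IntegrableOn.union ?_ ?_
  · refine (integrableOn_exp_mul_Iic hδ 0).congr_fun (fun x hx => ?_) measurableSet_Iic
    change Real.exp (δ * x) = _
    rw [abs_of_nonpos hx, neg_mul_neg]
  · refine (exp_neg_integrableOn_Ioi 0 hδ).congr_fun (fun x hx => ?_) measurableSet_Ioi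
    change Real.exp (-δ * x) = _
    rw [abs_of_pos hx]

theorem integrable_horizontal {F : ℂ → ℂ} {y C δ : ℝ} (hδ : 0 < δ)
    (hF : ∀ z : ℂ, z.im = y → ContinuousAt F z)
    (hb : ∀ z : ℂ, z.im = y → ‖F z‖ ≤ C * Real.exp (-δ * |z.re|)) :
    MeasureTheory.Integrable fun x : ℝ => F (x + y * Complex.I) := by
  refine MeasureTheory.Integrable.mono' ((integrable_exp_neg_mul_abs hδ).const_mul C) ?_ ?_
  · refine Continuous.aestronglyMeasurable (continuous_iff_continuousAt.2 fun x => ?_)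
    exact ContinuousAt.comp (g := F) (f := fun x : ℝ => (x : ℂ) + y * Complex.I) (hF _ (by simp))
      (by fun_prop)
  · refine Eventually.of_forall fun x => ?_
    simpa using hb (x + y * Complex.I) (by simp)

/-- Shift of a horizontal line of integration. -/
theorem integral_horizontal_shift {F : ℂ → ℂ} {y₁ y₂ C δ : ℝ} (hδ : 0 < δ)
    (hF : ∀ z : ℂ, z.im ∈ Set.uIcc y₁ y₂ → DifferentiableAt ℂ F z)
    (hb : ∀ z : ℂ, z.im ∈ Set.uIcc y₁ y₂ → ‖F z‖ ≤ C * Real.exp (-δ * |z.re|)) :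
    ∫ x : ℝ, F (x + y₁ * Complex.I) = ∫ x : ℝ, F (x + y₂ * Complex.I) := by
  have hint : ∀ y ∈ Set.uIcc y₁ y₂, MeasureTheory.Integrable fun x : ℝ => F (x + y * Complex.I) :=
    fun y hy => integrable_horizontal hδ (fun z hz => (hF z (hz ▸ hy)).continuousAt)
      (fun z hz => hb z (hz ▸ hy))
  have hlim : ∀ y ∈ Set.uIcc y₁ y₂, Tendsto (fun X : ℝ => ∫ x in (-X)..X, F (x + y * Complex.I))
      atTop (𝓝 (∫ x : ℝ, F (x + y * Complex.I))) := fun y hy =>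
    MeasureTheory.intervalIntegral_tendsto_integral (hint y hy) tendsto_neg_atTop_atBot tendsto_id
  -- σ = ±1 treats the two vertical sides of the rectangle at once; they vanish in the limit by the
  -- exponential bound.
  have hside : ∀ σ : ℝ, |σ| = 1 → Tendsto (fun X : ℝ => ∫ y in y₁..y₂,
      F (((σ * X : ℝ) : ℂ) + y * Complex.I)) atTop (𝓝 0) := by
    intro σ hσ
    have h1 : Tendsto (fun X : ℝ => C * Real.exp (-(δ * X)) * |y₂ - y₁|) atTop (𝓝 0) := by
      have h2 := Real.tendsto_exp_neg_atTop_nhds_zero.comp (tendsto_id.const_mul_atTop hδ)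
      have h3 := (h2.const_mul C).mul_const |y₂ - y₁|
      rw [mul_zero, zero_mul] at h3
      exact h3
    refine squeeze_zero_norm' ?_ h1
    filter_upwards [eventually_ge_atTop 0] with X hX
    refine intervalIntegral.norm_integral_le_of_norm_le_const fun y hy => ?_
    have h4 := hb (((σ * X : ℝ) : ℂ) + y * Complex.I)
      (by simpa using Set.uIoc_subset_uIcc hy)
    have h5 : (((σ * X : ℝ) : ℂ) + y * Complex.I).re = σ * X := by simp
    rw [h5, abs_mul, hσ, one_mul, abs_of_nonneg hX, neg_mul] at h4
    exact h4
  have hrect : ∀ X : ℝ, (∫ x in (-X)..X, F (x + y₁ * Complex.I)) -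
      (∫ x in (-X)..X, F (x + y₂ * Complex.I)) =
      Complex.I * (∫ y in y₁..y₂, F ((((-1) * X : ℝ) : ℂ) + y * Complex.I)) -
      Complex.I * (∫ y in y₁..y₂, F (((1 * X : ℝ) : ℂ) + y * Complex.I)) := by
    intro X
    have h := Complex.integral_boundary_rect_eq_zero_of_differentiableOn F
      (⟨-X, y₁⟩ : ℂ) (⟨X, y₂⟩ : ℂ) (fun z hz => (hF z hz.2).differentiableWithinAt)
    simp only [smul_eq_mul] at h
    rw [neg_one_mul, one_mul]
    linear_combination h
  have h1 := (hlim y₁ Set.left_mem_uIcc).sub (hlim y₂ Set.right_mem_uIcc)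
  rw [funext hrect] at h1
  have h2 := ((hside (-1) (by simp)).const_mul Complex.I).sub
    ((hside 1 (by simp)).const_mul Complex.I)
  rw [mul_zero, sub_zero] at h2
  exact sub_eq_zero.1 (tendsto_nhds_unique h1 h2)

/-- Estimates of 1/sin are available only away from the real axis. The rest of the strip is compact,
so continuity bounds f there, at the cost of a factor e. -/
theorem exists_strip_bound {f : ℂ → ℂ} {x₁ x₂ C δ : ℝ} (hδ : 0 < δ)
    (hf : ∀ z : ℂ, z.re ∈ Set.uIcc x₁ x₂ → DifferentiableAt ℂ f z)
    (hb : ∀ z : ℂ, z.re ∈ Set.uIcc x₁ x₂ → 1 ≤ δ * |z.im| → ‖f z‖ ≤ C * Real.exp (-δ * |z.im|)) :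
    ∃ C', ∀ z : ℂ, z.re ∈ Set.uIcc x₁ x₂ → ‖f z‖ ≤ C' * Real.exp (-δ * |z.im|) := by
  have hK : IsCompact (Set.uIcc x₁ x₂ ×ℂ Set.Icc (-(1 / δ)) (1 / δ)) :=
    isCompact_uIcc.reProdIm isCompact_Icc
  obtain ⟨M, hM⟩ := hK.exists_bound_of_continuousOn
    (fun z hz => (hf z hz.1).continuousAt.continuousWithinAt)
  refine ⟨max C (M * Real.exp 1), fun z hz => ?_⟩
  by_cases h : 1 ≤ δ * |z.im|
  · exact (hb z hz h).trans (by gcongr; exact le_max_left _ _)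
  · rw [not_le] at h
    have h1 : |z.im| ≤ 1 / δ := by rw [le_div_iff₀ hδ]; linarith
    have h2 := hM z ⟨hz, abs_le.1 h1⟩
    have hM0 : 0 ≤ M := (norm_nonneg _).trans h2
    calc ‖f z‖ ≤ M * 1 := by linarith
      _ ≤ M * (Real.exp 1 * Real.exp (-δ * |z.im|)) := by
          gcongr
          rw [← Real.exp_add]
          exact Real.one_le_exp (by linarith)
      _ = (M * Real.exp 1) * Real.exp (-δ * |z.im|) := by ring
      _ ≤ _ := by gcongr; exact le_max_right _ _

theorem integrable_vertical {f : ℂ → ℂ} {x₁ x₂ C δ : ℝ} (hδ : 0 < δ)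
    (hf : ∀ z : ℂ, z.re ∈ Set.uIcc x₁ x₂ → DifferentiableAt ℂ f z)
    (hb : ∀ z : ℂ, z.re ∈ Set.uIcc x₁ x₂ → 1 ≤ δ * |z.im| → ‖f z‖ ≤ C * Real.exp (-δ * |z.im|)) :
    MeasureTheory.Integrable fun y : ℝ => f (x₁ + y * Complex.I) := by
  obtain ⟨C', hC'⟩ := exists_strip_bound hδ hf hb
  refine MeasureTheory.Integrable.mono' ((integrable_exp_neg_mul_abs hδ).const_mul C') ?_ ?_
  · refine Continuous.aestronglyMeasurable (continuous_iff_continuousAt.2 fun x => ?_)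
    exact ContinuousAt.comp (g := f) (f := fun y : ℝ => (x₁ : ℂ) + y * Complex.I)
      (hf _ (by simp)).continuousAt (by fun_prop)
  · refine Eventually.of_forall fun x => ?_
    simpa using hC' (x₁ + x * Complex.I) (by simp)

/-- Shift of a vertical line of integration. -/
theorem integral_vertical_shift {f : ℂ → ℂ} {x₁ x₂ C δ : ℝ} (hδ : 0 < δ)
    (hf : ∀ z : ℂ, z.re ∈ Set.uIcc x₁ x₂ → DifferentiableAt ℂ f z)
    (hb : ∀ z : ℂ, z.re ∈ Set.uIcc x₁ x₂ → 1 ≤ δ * |z.im| → ‖f z‖ ≤ C * Real.exp (-δ * |z.im|)) :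
    ∫ y : ℝ, f (x₁ + y * Complex.I) = ∫ y : ℝ, f (x₂ + y * Complex.I) := by
  obtain ⟨C', hC'⟩ := exists_strip_bound hδ hf hb
  have hmem : ∀ z : ℂ, z.im ∈ Set.uIcc (-x₁) (-x₂) → (Complex.I * z).re ∈ Set.uIcc x₁ x₂ := by
    intro z hz
    rw [Complex.I_mul_re]
    rw [Set.mem_uIcc] at hz ⊢
    rcases hz with ⟨h1, h2⟩ | ⟨h1, h2⟩
    · exact Or.inr ⟨by linarith, by linarith⟩
    · exact Or.inl ⟨by linarith, by linarith⟩
  have h := integral_horizontal_shift (F := fun z => f (Complex.I * z)) (y₁ := -x₁) (y₂ := -x₂)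
    (C := C') hδ
    (fun z hz => DifferentiableAt.comp (g := f) z (hf _ (hmem z hz)) (by fun_prop))
    (fun z hz => by simpa using hC' _ (hmem z hz))
  have e : ∀ x y : ℝ, Complex.I * ((y : ℂ) + ((-x : ℝ) : ℂ) * Complex.I) = x + y * Complex.I := by
    intro x y
    push_cast
    linear_combination (-(x : ℂ)) * Complex.I_sq
  simpa only [e] using h

-- In logarithmic coordinates rays become horizontal lines, so rotating a ray is a horizontal shift.
open MeasureTheory in
theorem integral_Ioi_eq_integral_exp (h : ℝ → ℂ) :
    ∫ r in Set.Ioi (0 : ℝ), h r = ∫ t : ℝ, (Real.exp t : ℂ) * h (Real.exp t) := by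
  have h1 := integral_image_eq_integral_abs_deriv_smul (s := Set.univ) MeasurableSet.univ
    (fun x _ => (Real.hasDerivAt_exp x).hasDerivWithinAt) Real.exp_injective.injOn h
  rw [Set.image_univ, Real.range_exp, setIntegral_univ] at h1
  rw [h1]
  refine integral_congr_ae (Eventually.of_forall fun t => ?_)
  simp only [abs_of_pos (Real.exp_pos t), Complex.real_smul]

theorem continuous_contourPoint_uncurry (ε : ℝ) :
    Continuous fun p : ℝ × ℝ => contourPoint ε p.2 p.1 := by
  unfold contourPoint; fun_prop

/-- Rotation of the proper-time contour. -/
theorem contourIntegral_rotate {f : ℂ → ℂ} {ε φ₁ φ₂ C : ℝ}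
    (hf : ∀ r : ℝ, 0 ≤ r → ∀ ψ ∈ Set.uIcc φ₁ φ₂, DifferentiableAt ℂ f (contourPoint ε ψ r))
    (hb : ∀ r : ℝ, 1 ≤ r → ∀ ψ ∈ Set.uIcc φ₁ φ₂, ‖f (contourPoint ε ψ r)‖ ≤ C / r ^ 2) :
    contourIntegral ε φ₁ f = contourIntegral ε φ₂ f := by
  have hK : IsCompact (Set.Icc (0 : ℝ) 1 ×ˢ Set.uIcc φ₁ φ₂) := isCompact_Icc.prod isCompact_uIcc
  obtain ⟨M, hM⟩ := hK.exists_bound_of_continuousOn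
    (f := fun p : ℝ × ℝ => f (contourPoint ε p.2 p.1)) (fun p hp =>
      (ContinuousAt.comp (g := f) (f := fun p : ℝ × ℝ => contourPoint ε p.2 p.1)
        (hf p.1 hp.1.1 p.2 hp.2).continuousAt
        (continuous_contourPoint_uncurry ε).continuousAt).continuousWithinAt)
  have hpt : ∀ z : ℂ, (ε : ℂ) + Complex.exp z = contourPoint ε z.im (Real.exp z.re) := by
    intro z
    rw [contourPoint, Complex.ofReal_exp, ← Complex.exp_add, mul_comm Complex.I,
      Complex.re_add_im]
  -- The Jacobian e^z gives decay as Re z → -∞, where f is bounded; the bound C / r² gives it as Re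
  -- z → +∞.
  have h := integral_horizontal_shift (F := fun z => f (ε + Complex.exp z) * Complex.exp z)
    (y₁ := φ₁) (y₂ := φ₂) (C := max C M) one_pos
    (fun z hz => by
      have h1 := hf (Real.exp z.re) (Real.exp_pos _).le z.im hz
      rw [← hpt] at h1
      exact (DifferentiableAt.comp (g := f) z h1 (by fun_prop)).mul (by fun_prop))
    (fun z hz => by
      rw [norm_mul, hpt, Complex.norm_exp]
      by_cases h0 : 0 ≤ z.re
      · have h1 := hb (Real.exp z.re) (Real.one_le_exp h0) z.im hz
        have h2 : Real.exp (-1 * |z.re|) = Real.exp z.re / Real.exp z.re ^ 2 := by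
          rw [abs_of_nonneg h0, neg_one_mul, Real.exp_neg]
          have := (Real.exp_pos z.re).ne'
          field_simp
        rw [h2]
        calc _ ≤ C / Real.exp z.re ^ 2 * Real.exp z.re := by gcongr
          _ = C * (Real.exp z.re / Real.exp z.re ^ 2) := by ring
          _ ≤ _ := by gcongr; exact le_max_left _ _
      · rw [not_le] at h0
        have h1 := hM (Real.exp z.re, z.im)
          ⟨⟨(Real.exp_pos _).le, Real.exp_le_one_iff.2 h0.le⟩, hz⟩
        rw [abs_of_neg h0, neg_mul_neg, one_mul]
        gcongr
        exact h1.trans (le_max_right _ _))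
  have e : ∀ φ : ℝ, contourIntegral ε φ f = ∫ x : ℝ,
      f (ε + Complex.exp (x + φ * Complex.I)) * Complex.exp (x + φ * Complex.I) := by
    intro φ
    rw [contourIntegral, integral_Ioi_eq_integral_exp]
    refine MeasureTheory.integral_congr_ae (Eventually.of_forall fun t => ?_)
    simp only [contourPullback]
    rw [hpt]
    simp only [Complex.add_re, Complex.ofReal_re, Complex.mul_re, Complex.I_re, mul_zero,
      Complex.ofReal_im, Complex.I_im, sub_zero, add_zero, Complex.add_im, mul_one,
      Complex.mul_im, zero_add, Complex.exp_add, mul_comm Complex.I, ← Complex.ofReal_exp]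
    ring
  rw [e, e, h]

/-! ### Vertical integrals of the spin-0 integrand and their jumps at the poles -/

theorem integrable_inv_cosh : MeasureTheory.Integrable fun y : ℝ => (Real.cosh y)⁻¹ := by
  refine MeasureTheory.Integrable.mono' ((integrable_exp_neg_mul_abs one_pos).const_mul 2)
    (Continuous.aestronglyMeasurable (Real.continuous_cosh.inv₀ fun y => (Real.cosh_pos y).ne'))
    (Eventually.of_forall fun y => ?_)
  rw [Real.norm_of_nonneg (inv_nonneg.2 (Real.cosh_pos y).le), neg_one_mul, Real.exp_neg,
    ← div_eq_mul_inv, inv_eq_one_div, div_le_div_iff₀ (Real.cosh_pos y) (Real.exp_pos _),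
    ← Real.cosh_abs, Real.cosh_eq]
  linarith [Real.exp_pos (-|y|)]

theorem integral_inv_cosh : ∫ y : ℝ, (Real.cosh y)⁻¹ = Real.pi := by
  have hd : ∀ y : ℝ, HasDerivAt (fun y => Real.arctan (Real.sinh y)) (Real.cosh y)⁻¹ y := by
    intro y
    refine (Real.hasDerivAt_sinh y).arctan.congr_deriv ?_
    have := (Real.cosh_pos y).ne'
    rw [← Real.cosh_sq']
    field_simp
  have h1 : Tendsto (fun y => Real.arctan (Real.sinh y)) atTop (𝓝 (Real.pi / 2)) :=
    (Real.tendsto_arctan_atTop.mono_right nhdsWithin_le_nhds).comp Real.sinhOrderIso.tendsto_atTop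
  have h2 : Tendsto (fun y => Real.arctan (Real.sinh y)) atBot (𝓝 (-(Real.pi / 2))) :=
    (Real.tendsto_arctan_atBot.mono_right nhdsWithin_le_nhds).comp Real.sinhOrderIso.tendsto_atBot
  rw [MeasureTheory.integral_of_hasDerivAt_of_tendsto hd integrable_inv_cosh h2 h1]
  ring

/-- The spin-0 proper-time integrand in a purely electric field, `b = q E`. -/
noncomputable def scalarIntegrand (m b : ℝ) (T : ℂ) : ℂ := properTimeWeight m T * divSin (b * T)

/-- The numerator of `scalarIntegrand`, as a multiple of `1 / sin (b T)`. -/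
noncomputable def scalarNumerator (m b : ℝ) (T : ℂ) : ℂ := properTimeWeight m T * (b * T)

theorem scalarIntegrand_eq {m b : ℝ} {T : ℂ} (h : (b : ℂ) * T ≠ 0) :
    scalarIntegrand m b T = scalarNumerator m b T / Complex.sin (b * T) := by
  rw [scalarIntegrand, scalarNumerator, divSin, if_neg h, mul_div_assoc']

theorem norm_scalarNumerator_le {m b : ℝ} (hb : 0 < b) {T : ℂ} {x : ℝ} (hx : 0 < x)
    (hT : x ≤ T.re) : ‖scalarNumerator m b T‖ ≤ b / x ^ 2 := by
  have hn : x ≤ ‖T‖ := hT.trans (Complex.re_le_norm T)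
  have hn0 : 0 < ‖T‖ := hx.trans_le hn
  have hpi : 1 ≤ (4 * Real.pi) ^ 2 := one_le_pow₀ (by linarith [Real.pi_gt_three])
  have he : Real.exp (-(m ^ 2 * T.re)) ≤ 1 := by
    rw [Real.exp_le_one_iff]
    have : 0 ≤ m ^ 2 * T.re := mul_nonneg (sq_nonneg m) (hx.le.trans hT)
    linarith
  rw [scalarNumerator, norm_mul, norm_properTimeWeight, norm_mul, Complex.norm_real,
    Real.norm_of_nonneg hb.le]
  calc _ ≤ 1 / (1 * ‖T‖ ^ 3) * (b * ‖T‖) := by gcongr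
    _ = b / ‖T‖ ^ 2 := by field_simp
    _ ≤ _ := by gcongr

theorem sinh_abs_im_le_norm_sin (z : ℂ) : Real.sinh |z.im| ≤ ‖Complex.sin z‖ := by
  have h := sinh_abs_re_le_norm_sinh (z * Complex.I)
  rw [Complex.sinh_mul_I, norm_mul, Complex.norm_I, mul_one] at h
  simpa using h

theorem exp_div_four_le_sinh {y : ℝ} (hy : 1 ≤ y) : Real.exp y / 4 ≤ Real.sinh y := by
  rw [Real.sinh_eq]
  have h1 : Real.exp y * Real.exp (-y) = 1 := by rw [← Real.exp_add]; simp
  have h2 : 2 ≤ Real.exp y := by linarith [Real.add_one_le_exp y]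
  nlinarith [Real.exp_pos (-y)]

theorem norm_inv_sin_le {b : ℝ} (hb : 0 < b) {T : ℂ} (h : 1 ≤ b * |T.im|) :
    ‖(Complex.sin (b * T))⁻¹‖ ≤ 4 * Real.exp (-b * |T.im|) := by
  have h1 := sinh_abs_im_le_norm_sin (b * T)
  rw [Complex.im_ofReal_mul, abs_mul, abs_of_pos hb] at h1
  have h2 := (exp_div_four_le_sinh h).trans h1
  rw [norm_inv, neg_mul, Real.exp_neg]
  calc _ ≤ (Real.exp (b * |T.im|) / 4)⁻¹ := by gcongr
    _ = _ := by rw [inv_div, div_eq_mul_inv]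

theorem ne_zero_of_re_pos {T : ℂ} (h : 0 < T.re) : T ≠ 0 := fun h0 => by simp [h0] at h

theorem differentiableAt_scalarIntegrand {m b : ℝ} {T : ℂ} (hT : 0 < T.re)
    (h : T.im = 0 → |b * T.re| < Real.pi) (hb : 0 < b) :
    DifferentiableAt ℂ (scalarIntegrand m b) T := by
  unfold scalarIntegrand
  simp_rw [divSin_eq_inv]
  refine (differentiableAt_properTimeWeight m (ne_zero_of_re_pos hT)).mul (DifferentiableAt.inv
    ((differentiable_sinc _).comp T (by fun_prop)) (sinc_ne_zero ?_))
  rw [Complex.im_ofReal_mul, Complex.re_ofReal_mul]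
  intro h0
  exact h ((mul_eq_zero.1 h0).resolve_left hb.ne')

theorem norm_scalarIntegrand_le {m b : ℝ} (hb : 0 < b) {T : ℂ} {x : ℝ} (hx : 0 < x)
    (hT : x ≤ T.re) (h : 1 ≤ b * |T.im|) :
    ‖scalarIntegrand m b T‖ ≤ 4 * (b / x ^ 2) * Real.exp (-b * |T.im|) := by
  have hT0 : T ≠ 0 := ne_zero_of_re_pos (hx.trans_le hT)
  rw [scalarIntegrand_eq (mul_ne_zero (by exact_mod_cast hb.ne') hT0), div_eq_mul_inv, norm_mul]
  calc _ ≤ b / x ^ 2 * (4 * Real.exp (-b * |T.im|)) :=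
        mul_le_mul (norm_scalarNumerator_le hb hx hT) (norm_inv_sin_le hb h) (norm_nonneg _)
          (by positivity)
    _ = _ := by ring

/-- The integral of `scalarIntegrand` over the vertical line through `x`. -/
noncomputable def verticalIntegral (m b x : ℝ) : ℂ :=
  ∫ y : ℝ, scalarIntegrand m b (x + y * Complex.I)

/-- No pole lies between two lines to the left of π/b, which makes the result independent of the
cutoff. -/
theorem verticalIntegral_eq_of_lt_pole {m b x₁ x₂ : ℝ} (hb : 0 < b) (h₁ : 0 < x₁)
    (h₁' : b * x₁ < Real.pi) (h₂ : 0 < x₂) (h₂' : b * x₂ < Real.pi) :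
    (MeasureTheory.Integrable fun y : ℝ => scalarIntegrand m b (x₁ + y * Complex.I)) ∧
      verticalIntegral m b x₁ = verticalIntegral m b x₂ := by
  have hmin : 0 < min x₁ x₂ := lt_min h₁ h₂
  have hd : ∀ z : ℂ, z.re ∈ Set.uIcc x₁ x₂ → DifferentiableAt ℂ (scalarIntegrand m b) z := by
    intro z hz
    have hre : 0 < z.re := hmin.trans_le hz.1
    refine differentiableAt_scalarIntegrand hre (fun _ => ?_) hb
    rw [abs_of_pos (by positivity)]
    rcases le_max_iff.1 hz.2 with h | h
    · nlinarith
    · nlinarith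
  have hbd : ∀ z : ℂ, z.re ∈ Set.uIcc x₁ x₂ → 1 ≤ b * |z.im| →
      ‖scalarIntegrand m b z‖ ≤ 4 * (b / min x₁ x₂ ^ 2) * Real.exp (-b * |z.im|) :=
    fun z hz h => norm_scalarIntegrand_le hb hmin hz.1 h
  exact ⟨integrable_vertical hb hd hbd, integral_vertical_shift hb hd hbd⟩

/-- The point half-way between the `n`-th and the `n+1`-st pole. -/
noncomputable def midPole (b : ℝ) (n : ℕ) : ℝ := (n + 1 / 2) * Real.pi / b

/-- The `n+1`-st pole on the positive real axis. -/
noncomputable def pole (b : ℝ) (n : ℕ) : ℝ := (n + 1) * Real.pi / b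

theorem sin_add_nat_mul_pi (z : ℂ) (n : ℕ) :
    Complex.sin (z + n * Real.pi) = (-1) ^ n * Complex.sin z := by
  induction n with
  | zero => simp
  | succ n ih =>
    rw [show z + ((n + 1 : ℕ) : ℂ) * Real.pi = (z + n * Real.pi) + Real.pi by push_cast; ring,
      Complex.sin_add_pi, ih]
    ring

/-- Half-way between poles the sine is ± a real cosh, so line integrals of its reciprocal are known
exactly. -/
theorem sin_midPole {b : ℝ} (hb : 0 < b) (n : ℕ) (y : ℝ) :
    Complex.sin (b * (midPole b n + y * Complex.I)) = (-1) ^ n * (Real.cosh (b * y) : ℂ) := by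
  have h0 : (b : ℂ) ≠ 0 := by exact_mod_cast hb.ne'
  have h1 : (b : ℂ) * (midPole b n + y * Complex.I) =
      ((b * y : ℝ) * Complex.I + Real.pi / 2) + n * Real.pi := by
    rw [midPole]
    push_cast
    field_simp
    ring
  rw [h1, sin_add_nat_mul_pi, Complex.sin_add_pi_div_two, Complex.cos_mul_I, Complex.ofReal_cosh]

theorem integrable_inv_cosh_mul {b : ℝ} (hb : 0 < b) :
    MeasureTheory.Integrable fun y : ℝ => (Real.cosh (b * y))⁻¹ :=
  integrable_inv_cosh.comp_mul_left' hb.ne'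

theorem integral_inv_cosh_mul {b : ℝ} (hb : 0 < b) :
    ∫ y : ℝ, (Real.cosh (b * y))⁻¹ = Real.pi / b := by
  rw [MeasureTheory.Measure.integral_comp_mul_left (fun y => (Real.cosh y)⁻¹), integral_inv_cosh,
    smul_eq_mul, abs_of_pos (inv_pos.2 hb)]
  field_simp

theorem midPole_pos {b : ℝ} (hb : 0 < b) (n : ℕ) : 0 < midPole b n := by
  unfold midPole; positivity

theorem scalarIntegrand_midPole {m b : ℝ} (hb : 0 < b) (n : ℕ) (y : ℝ) :
    scalarIntegrand m b (midPole b n + y * Complex.I) =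
      scalarNumerator m b (midPole b n + y * Complex.I) *
        ((-1) ^ n * ((Real.cosh (b * y))⁻¹ : ℝ)) := by
  have hre : 0 < ((midPole b n : ℂ) + y * Complex.I).re := by simpa using midPole_pos hb n
  have hb0 : (b : ℂ) ≠ 0 := by exact_mod_cast hb.ne'
  rw [scalarIntegrand_eq (mul_ne_zero hb0 (ne_zero_of_re_pos hre)), sin_midPole hb, div_eq_mul_inv,
    mul_inv, ← inv_pow, inv_neg_one, Complex.ofReal_inv]

theorem differentiableAt_scalarNumerator {m b : ℝ} {T : ℂ} (hT : T ≠ 0) :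
    DifferentiableAt ℂ (scalarNumerator m b) T :=
  (differentiableAt_properTimeWeight m hT).mul (by fun_prop)

theorem integrable_scalarIntegrand_midPole {m b : ℝ} (hb : 0 < b) (n : ℕ) :
    MeasureTheory.Integrable fun y : ℝ => scalarIntegrand m b (midPole b n + y * Complex.I) := by
  simp_rw [scalarIntegrand_midPole hb]
  have hre : ∀ y : ℝ, ((midPole b n : ℂ) + y * Complex.I).re = midPole b n := fun y => by simp
  refine MeasureTheory.Integrable.bdd_mul (c := b / midPole b n ^ 2)
    ((integrable_inv_cosh_mul hb).ofReal.const_mul _) ?_ ?_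
  · refine Continuous.aestronglyMeasurable (continuous_iff_continuousAt.2 fun y => ?_)
    exact ContinuousAt.comp (g := scalarNumerator m b)
      (f := fun y : ℝ => (midPole b n : ℂ) + y * Complex.I)
      (differentiableAt_scalarNumerator
        (ne_zero_of_re_pos (by rw [hre]; exact midPole_pos hb n))).continuousAt (by fun_prop)
  · exact Eventually.of_forall fun y => norm_scalarNumerator_le hb (midPole_pos hb n) (hre y).ge

/-- The numerator is at most b / `midPole`², while the integral of 1/cosh stays equal to π/b. -/
theorem tendsto_verticalIntegral_midPole {m b : ℝ} (hb : 0 < b) :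
    Tendsto (fun n => verticalIntegral m b (midPole b n)) atTop (𝓝 0) := by
  have h1 : Tendsto (fun n => midPole b n) atTop atTop := by
    unfold midPole
    refine Tendsto.atTop_div_const hb (Tendsto.atTop_mul_const Real.pi_pos ?_)
    exact tendsto_atTop_add_const_right _ _ tendsto_natCast_atTop_atTop
  have h2 : Tendsto (fun n => b / midPole b n ^ 2 * (Real.pi / b)) atTop (𝓝 0) := by
    have := ((tendsto_pow_atTop two_ne_zero).comp h1).const_div_atTop b |>.mul_const (Real.pi / b)
    rw [zero_mul] at this
    exact this
  refine squeeze_zero_norm (fun n => ?_) h2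
  rw [verticalIntegral, ← integral_inv_cosh_mul hb, ← MeasureTheory.integral_const_mul]
  refine MeasureTheory.norm_integral_le_of_norm_le ((integrable_inv_cosh_mul hb).const_mul _)
    (Eventually.of_forall fun y => ?_)
  rw [scalarIntegrand_midPole hb, norm_mul, norm_mul, norm_pow, norm_neg, norm_one, one_pow,
    one_mul, Complex.norm_real, Real.norm_of_nonneg (inv_nonneg.2 (Real.cosh_pos _).le)]
  refine mul_le_mul_of_nonneg_right ?_ (inv_nonneg.2 (Real.cosh_pos _).le)
  exact norm_scalarNumerator_le hb (midPole_pos hb n) (by simp)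

theorem scalarNumerator_pole {m b : ℝ} (hb : 0 < b) (n : ℕ) :
    scalarNumerator m b (pole b n) =
      ((b ^ 3 / (16 * Real.pi ^ 4) *
        (Real.exp (-(m ^ 2 * Real.pi * ((n : ℝ) + 1) / b)) / ((n : ℝ) + 1) ^ 2) : ℝ) : ℂ) := by
  have h0 : (b : ℂ) ≠ 0 := by exact_mod_cast hb.ne'
  have h1 : (Real.pi : ℂ) ≠ 0 := by exact_mod_cast Real.pi_ne_zero
  have h2 : (n : ℂ) + 1 ≠ 0 := by exact_mod_cast n.succ_ne_zero
  rw [scalarNumerator, properTimeWeight, pole]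
  push_cast
  rw [show (m : ℂ) ^ 2 * ((n + 1) * Real.pi / b) = m ^ 2 * Real.pi * (n + 1) / b by ring]
  field_simp
  ring

/-- The jump of the vertical integral at a pole. -/
theorem verticalIntegral_midPole_sub {m b : ℝ} (hb : 0 < b) (n : ℕ) :
    verticalIntegral m b (midPole b n) - verticalIntegral m b (midPole b (n + 1)) =
      2 * ((-1) ^ n * (scalarNumerator m b (pole b n) * (Real.pi / b))) := by
  have hb0 : (b : ℂ) ≠ 0 := by exact_mod_cast hb.ne'
  set c := scalarNumerator m b with hc
  set p : ℂ := (pole b n : ℂ) with hp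
  -- This is (c(T) - c(p)) / sin(bT) with its singularity at p visibly removed, so its integral is
  -- the same on both lines. The subtracted constant contributes ± c(p) π/b with opposite signs on
  -- the two lines, whence the factor 2.
  set h : ℂ → ℂ := fun T => (-1) ^ (n + 1) / b * dslope c p T * divSin (b * (T - p)) with hh
  have hmid : ∀ z : ℂ, z.re ∈ Set.uIcc (midPole b n) (midPole b (n + 1)) →
      midPole b 0 ≤ z.re ∧ |b * (z.re - pole b n)| ≤ Real.pi / 2 := by
    intro z hz
    have hle : midPole b n ≤ midPole b (n + 1) := by
      unfold midPole; gcongr; linarith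
    rw [Set.uIcc_of_le hle] at hz
    have h0 : midPole b 0 ≤ midPole b n := by
      unfold midPole; gcongr; simp
    refine ⟨h0.trans hz.1, ?_⟩
    have e1 : b * midPole b n = (n + 1 / 2) * Real.pi := by rw [midPole]; field_simp
    have e2 : b * midPole b (n + 1) = (n + 1 + 1 / 2) * Real.pi := by
      rw [midPole]; push_cast; field_simp
    have e3 : b * pole b n = (n + 1) * Real.pi := by rw [pole]; field_simp
    have f1 := mul_le_mul_of_nonneg_left hz.1 hb.le
    have f2 := mul_le_mul_of_nonneg_left hz.2 hb.le
    rw [abs_le, mul_sub]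
    constructor <;> linarith
  have hm0 := midPole_pos hb 0
  have hpre : p.re = pole b n := by simp [hp]
  have hp0 : midPole b 0 ≤ p.re := by
    rw [hpre, midPole, pole]; gcongr; simp; linarith [(Nat.cast_nonneg n : (0 : ℝ) ≤ n)]
  have hd : ∀ z : ℂ, z.re ∈ Set.uIcc (midPole b n) (midPole b (n + 1)) →
      DifferentiableAt ℂ h z := by
    intro z hz
    obtain ⟨hz1, hz2⟩ := hmid z hz
    have hopen : IsOpen {z : ℂ | 0 < z.re} := isOpen_lt continuous_const Complex.continuous_re
    have hcd : DifferentiableOn ℂ (dslope c p) {z : ℂ | 0 < z.re} :=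
      (Complex.differentiableOn_dslope (hopen.mem_nhds (hm0.trans_le hp0))).2 fun T hT =>
        (differentiableAt_scalarNumerator (ne_zero_of_re_pos hT)).differentiableWithinAt
    have hc1 := hcd.differentiableAt (hopen.mem_nhds (hm0.trans_le hz1))
    refine (hc1.const_mul _).mul ?_
    simp_rw [divSin_eq_inv]
    refine DifferentiableAt.inv ((differentiable_sinc _).comp z (by fun_prop)) (sinc_ne_zero ?_)
    intro _
    rw [Complex.re_ofReal_mul, Complex.sub_re, hpre]
    linarith [Real.pi_pos]
  have heq : ∀ z : ℂ, z ≠ p → h z = (c z - c p) * (Complex.sin (b * z))⁻¹ := by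
    intro z hz
    have hzp : z - p ≠ 0 := sub_ne_zero.2 hz
    have e : (b : ℂ) * z = b * (z - p) + ((n + 1 : ℕ) : ℂ) * Real.pi := by
      rw [hp, pole]; push_cast; field_simp; ring
    simp only [hh]
    rw [e, sin_add_nat_mul_pi, mul_inv, ← inv_pow, inv_neg_one, dslope_of_ne _ hz,
      slope_def_field, divSin, if_neg (mul_ne_zero hb0 hzp)]
    field_simp
  have hbd : ∀ z : ℂ, z.re ∈ Set.uIcc (midPole b n) (midPole b (n + 1)) → 1 ≤ b * |z.im| →
      ‖h z‖ ≤ 8 * (b / midPole b 0 ^ 2) * Real.exp (-b * |z.im|) := by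
    intro z hz hzi
    obtain ⟨hz1, -⟩ := hmid z hz
    have hzp : z ≠ p := by
      rintro rfl
      have : p.im = 0 := by simp [hp]
      rw [this, abs_zero, mul_zero] at hzi
      linarith
    rw [heq z hzp, norm_mul]
    have b1 := norm_scalarNumerator_le (m := m) hb hm0 hz1
    have b2 := norm_scalarNumerator_le (m := m) hb hm0 hp0
    have b3 := norm_inv_sin_le hb hzi
    calc _ ≤ (b / midPole b 0 ^ 2 + b / midPole b 0 ^ 2) * (4 * Real.exp (-b * |z.im|)) := by
          gcongr
          exact (norm_sub_le _ _).trans (add_le_add b1 b2)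
      _ = _ := by ring
  have hshift := integral_vertical_shift hb hd hbd
  have hline : ∀ k : ℕ, (midPole b k : ℝ) ≠ pole b n →
      ∫ y : ℝ, h (midPole b k + y * Complex.I) =
        verticalIntegral m b (midPole b k) - (-1) ^ k * (c p * (Real.pi / b)) := by
    intro k hk
    have e1 : ∀ y : ℝ, h (midPole b k + y * Complex.I) =
        scalarIntegrand m b (midPole b k + y * Complex.I) -
          ((-1) ^ k * c p) * ((Real.cosh (b * y))⁻¹ : ℝ) := by
      intro y
      rw [heq, scalarIntegrand_midPole hb, sin_midPole hb, mul_inv, ← inv_pow, inv_neg_one,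
        Complex.ofReal_inv]
      · ring
      · intro h0
        refine hk ?_
        have := congrArg Complex.re h0
        simpa [hp] using this
    have i2 : MeasureTheory.Integrable fun y : ℝ => (((Real.cosh (b * y))⁻¹ : ℝ) : ℂ) :=
      (integrable_inv_cosh_mul hb).ofReal
    simp_rw [e1]
    rw [MeasureTheory.integral_sub (integrable_scalarIntegrand_midPole hb k) (i2.const_mul _), MeasureTheory.integral_const_mul,
      integral_complex_ofReal, integral_inv_cosh_mul hb, verticalIntegral]
    push_cast
    ring
  -- Parity after doubling: a midpoint is never a pole.
  have hk : ∀ k : ℕ, (k : ℝ) + 1 / 2 ≠ n + 1 := by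
    intro k h
    have : ((2 * k + 1 : ℕ) : ℝ) = ((2 * n + 2 : ℕ) : ℝ) := by push_cast; linarith
    have := Nat.cast_injective this
    omega
  have hk' : ∀ k : ℕ, midPole b k ≠ pole b n := by
    intro k h
    rw [midPole, pole, div_left_inj' hb.ne', mul_left_inj' Real.pi_ne_zero] at h
    exact hk k h
  rw [hline n (hk' n), hline (n + 1) (hk' (n + 1))] at hshift
  linear_combination hshift

/-- The pair-production series. -/
noncomputable def pairTerm (m b : ℝ) (n : ℕ) : ℝ :=
  b ^ 2 / (16 * Real.pi ^ 3) *
    ((-1) ^ n * Real.exp (-(m ^ 2 * Real.pi * ((n : ℝ) + 1) / b)) / ((n : ℝ) + 1) ^ 2)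

theorem summable_pairTerm {m b : ℝ} (hb : 0 < b) : Summable (pairTerm m b) := by
  refine Summable.mul_left _ ?_
  have h := (summable_nat_add_iff 1).2 (Real.summable_one_div_nat_pow.2 one_lt_two)
  refine Summable.of_norm_bounded h fun n => ?_
  rw [norm_div, norm_mul, norm_pow, norm_neg, norm_one, one_pow, one_mul,
    Real.norm_of_nonneg (Real.exp_pos _).le, Real.norm_of_nonneg (by positivity)]
  push_cast
  gcongr
  rw [Real.exp_le_one_iff, neg_nonpos]
  positivity

/-- The jumps telescope, and the integral over the moving line tends to 0. -/
theorem hasSum_verticalIntegral {m b : ℝ} (hb : 0 < b) :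
    HasSum (fun n => ((pairTerm m b n : ℝ) : ℂ)) (verticalIntegral m b (midPole b 0) / 2) := by
  have hterm : ∀ n, ((pairTerm m b n : ℝ) : ℂ) =
      verticalIntegral m b (midPole b n) / 2 - verticalIntegral m b (midPole b (n + 1)) / 2 := by
    intro n
    have h := verticalIntegral_midPole_sub (m := m) hb n
    rw [scalarNumerator_pole hb] at h
    have h0 : (b : ℂ) ≠ 0 := by exact_mod_cast hb.ne'
    have h1 : (Real.pi : ℂ) ≠ 0 := by exact_mod_cast Real.pi_ne_zero
    have h2 : (n : ℂ) + 1 ≠ 0 := by exact_mod_cast n.succ_ne_zero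
    rw [← sub_div, h, pairTerm]
    push_cast
    field_simp
  have hs : Summable (fun n => ((pairTerm m b n : ℝ) : ℂ)) :=
    Complex.ofRealCLM.summable (summable_pairTerm hb)
  rw [hs.hasSum_iff_tendsto_nat]
  simp_rw [hterm, Finset.sum_range_sub']
  simpa using ((tendsto_verticalIntegral_midPole (m := m) hb).div_const 2).const_sub
    (verticalIntegral m b (midPole b 0) / 2)

/-! ### Imaginary parts in an electric field -/

-- By reflection, the lower half of a vertical line contributes the conjugate of the upper half.
open ComplexConjugate in
theorem scalarIntegrand_conj (m b : ℝ) (T : ℂ) :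
    scalarIntegrand m b (conj T) = conj (scalarIntegrand m b T) := by
  have h1 : properTimeWeight m (conj T) = conj (properTimeWeight m T) := by
    simp [properTimeWeight, ← Complex.exp_conj, map_ofNat (starRingEnd ℂ) 4]
  have h2 : divSin (b * conj T) = conj (divSin (b * T)) := by
    have e : (b : ℂ) * conj T = conj ((b : ℂ) * T) := by simp
    rw [e]
    unfold divSin
    by_cases h0 : (b : ℂ) * T = 0
    · simp [h0]
    · rw [if_neg h0, if_neg (by simpa using h0), Complex.sin_conj, map_div₀]
  rw [scalarIntegrand, h1, h2, scalarIntegrand, map_mul]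

theorem one_add_two_mul_exp_neg_le (y : ℝ) (hy : 0 ≤ y) : (1 + 2 * y) * Real.exp (-y) ≤ 2 := by
  have h1 : Real.exp y * Real.exp (-y) = 1 := by rw [← Real.exp_add]; simp
  have h2 := Real.add_one_le_exp y
  nlinarith [Real.exp_pos (-y)]

theorem norm_weight_contour_le {m ε ψ r : ℝ} (hε : 0 ≤ ε) (hψ0 : 0 ≤ ψ) (hψ : ψ ≤ Real.pi / 2)
    (hr : 1 ≤ r) : ‖properTimeWeight m (contourPoint ε ψ r)‖ ≤
      Real.exp (-(m ^ 2 * Real.cos ψ) * r) / ‖contourPoint ε ψ r‖ ^ 3 := by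
  have hc : 0 ≤ Real.cos ψ := Real.cos_nonneg_of_mem_Icc ⟨by linarith, hψ⟩
  have hn : r ≤ ‖contourPoint ε ψ r‖ := le_norm_contourPoint hε hψ0 hψ (by linarith)
  have hn0 : 0 < ‖contourPoint ε ψ r‖ := by linarith
  have hpi : 1 ≤ (4 * Real.pi) ^ 2 := one_le_pow₀ (by linarith [Real.pi_gt_three])
  rw [norm_properTimeWeight, contourPoint_re]
  have h0 : 0 ≤ m ^ 2 * ε := by positivity
  calc _ ≤ Real.exp (-(m ^ 2 * Real.cos ψ) * r) / (1 * ‖contourPoint ε ψ r‖ ^ 3) := by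
        gcongr
        nlinarith
    _ = _ := by rw [one_mul]

/-- At φ = π/2 the mass term no longer decays, but T⁻³ and the boundedness of `divSin` in the wedge
still give O(r⁻²). -/
theorem scalarIntegrand_rotate {m b ε φ : ℝ} (hb : 0 < b) (hε : 0 < ε) (hεb : b * ε < Real.pi)
    (hφ0 : 0 < φ) (hφ : φ < Real.pi / 2) :
    contourIntegral ε φ (scalarIntegrand m b) =
      contourIntegral ε (Real.pi / 2) (scalarIntegrand m b) := by
  have hs0 : 0 < Real.sin φ := Real.sin_pos_of_pos_of_lt_pi hφ0 (by linarith [Real.pi_pos])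
  have hψ : ∀ ψ ∈ Set.uIcc φ (Real.pi / 2), 0 < ψ ∧ ψ ≤ Real.pi / 2 ∧ 0 ≤ Real.cos ψ ∧
      Real.sin φ ≤ Real.sin ψ := by
    intro ψ hψ
    rw [Set.uIcc_of_le hφ.le] at hψ
    refine ⟨hφ0.trans_le hψ.1, hψ.2, Real.cos_nonneg_of_mem_Icc ⟨by linarith [hψ.1], hψ.2⟩, ?_⟩
    exact Real.sin_le_sin_of_le_of_le_pi_div_two (by linarith) hψ.2 hψ.1
  -- For r ≥ 1, ε + r cos ψ ≤ (ε + 1) r ≤ κ r sin ψ, so one sector around the imaginary axis serves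
  -- all angles.
  set κ := (ε + 1) / Real.sin φ with hκ
  have hκ0 : 0 ≤ κ := by positivity
  refine contourIntegral_rotate (C := 2 * (1 + κ)) (fun r hr ψ hψ' => ?_) (fun r hr ψ hψ' => ?_)
  · obtain ⟨h1, h2, h3, h4⟩ := hψ ψ hψ'
    refine differentiableAt_scalarIntegrand ?_ (fun h => ?_) hb
    · rw [contourPoint_re]; positivity
    · rw [contourPoint_im] at h
      have hr0 : r = 0 := (mul_eq_zero.1 h).resolve_right (hs0.trans_le h4).ne'
      rw [contourPoint_re, hr0, zero_mul, add_zero, abs_of_pos (by positivity)]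
      exact hεb
  · obtain ⟨h1, h2, h3, h4⟩ := hψ ψ hψ'
    have hr0 : 0 < r := by linarith
    have hn : r ≤ ‖contourPoint ε ψ r‖ := le_norm_contourPoint hε.le h1.le h2 hr0.le
    have him : |((b : ℂ) * contourPoint ε ψ r).im| = b * (r * Real.sin ψ) := by
      rw [Complex.im_ofReal_mul, contourPoint_im, abs_of_nonneg]
      have := hs0.le.trans h4
      positivity
    have hre : |((b : ℂ) * contourPoint ε ψ r).re| = b * (ε + r * Real.cos ψ) := by
      rw [Complex.re_ofReal_mul, contourPoint_re, abs_of_nonneg (by positivity)]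
    have hbound : |((b : ℂ) * contourPoint ε ψ r).re| ≤
        κ * |((b : ℂ) * contourPoint ε ψ r).im| := by
      rw [hre, him]
      have e1 : κ * Real.sin φ = ε + 1 := by rw [hκ]; field_simp
      have e2 : (ε + 1) * r ≤ κ * (r * Real.sin ψ) := by
        rw [← e1]
        calc κ * Real.sin φ * r ≤ κ * Real.sin ψ * r := by gcongr
          _ = _ := by ring
      have e3 : ε + r * Real.cos ψ ≤ (ε + 1) * r := by
        have := Real.cos_le_one ψ
        nlinarith
      calc b * (ε + r * Real.cos ψ) ≤ b * (κ * (r * Real.sin ψ)) := by gcongr; linarith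
        _ = _ := by ring
    have hd := norm_divSin_le hκ0 hbound
    have hd2 : ‖divSin (b * contourPoint ε ψ r)‖ ≤ 2 * (1 + κ) := by
      refine hd.trans ?_
      have := one_add_two_mul_exp_neg_le |((b : ℂ) * contourPoint ε ψ r).im| (abs_nonneg _)
      calc _ = (1 + κ) * ((1 + 2 * |((b : ℂ) * contourPoint ε ψ r).im|) *
            Real.exp (-|((b : ℂ) * contourPoint ε ψ r).im|)) := by ring
        _ ≤ (1 + κ) * 2 := by gcongr
        _ = _ := by ring
    have hw := norm_weight_contour_le (m := m) hε.le h1.le h2 hr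
    have he : Real.exp (-(m ^ 2 * Real.cos ψ) * r) ≤ 1 := by
      rw [Real.exp_le_one_iff]
      have : 0 ≤ m ^ 2 * Real.cos ψ * r := by positivity
      linarith
    rw [scalarIntegrand, norm_mul]
    calc _ ≤ (1 / r ^ 2) * (2 * (1 + κ)) := by
          gcongr
          refine hw.trans ?_
          have : r ^ 2 ≤ ‖contourPoint ε ψ r‖ ^ 3 :=
            (pow_le_pow_right₀ hr (by norm_num)).trans (pow_le_pow_left₀ hr0.le hn 3)
          gcongr
      _ = _ := by ring

/-- On the vertical half-line dT = i dy, so the integral is iJ with imaginary part Re J, while the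
full line gives J plus its conjugate. Hence the imaginary part is half of the vertical integral. -/
theorem contourIntegral_scalarIntegrand_im {m b ε φ : ℝ} (hb : 0 < b) (hε : 0 < ε)
    (hεb : b * ε < Real.pi) (hφ0 : 0 < φ) (hφ : φ < Real.pi / 2) :
    HasSum (pairTerm m b) (contourIntegral ε φ (scalarIntegrand m b)).im := by
  have hmid : b * midPole b 0 < Real.pi := by
    rw [midPole]
    have : b * (((0 : ℕ) + 1 / 2) * Real.pi / b) = Real.pi / 2 := by field_simp; simp
    rw [this]
    linarith [Real.pi_pos]
  obtain ⟨hint, hV⟩ := verticalIntegral_eq_of_lt_pole (m := m) hb hε hεb (midPole_pos hb 0) hmid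
  set J := ∫ y in Set.Ioi (0 : ℝ), scalarIntegrand m b (ε + y * Complex.I) with hJ
  have h1 : contourIntegral ε φ (scalarIntegrand m b) = J * Complex.I := by
    have hI : Complex.exp (Complex.I * ((Real.pi / 2 : ℝ) : ℂ)) = Complex.I := by
      rw [mul_comm]; push_cast; exact Complex.exp_pi_div_two_mul_I
    rw [scalarIntegrand_rotate hb hε hεb hφ0 hφ, contourIntegral, hJ,
      ← MeasureTheory.integral_mul_const]
    simp only [contourPullback, contourPoint, hI]
  have h2 : verticalIntegral m b ε = J + (starRingEnd ℂ) J := by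
    rw [verticalIntegral, ← MeasureTheory.setIntegral_univ, ← Set.Iic_union_Ioi (a := (0 : ℝ)),
      MeasureTheory.setIntegral_union (Set.Iic_disjoint_Ioi le_rfl) measurableSet_Ioi
        hint.integrableOn hint.integrableOn, add_comm, hJ]
    congr 1
    have hneg := integral_comp_neg_Ioi (0 : ℝ)
      (fun y : ℝ => scalarIntegrand m b (ε + y * Complex.I))
    rw [neg_zero] at hneg
    rw [← integral_conj, ← hneg]
    refine MeasureTheory.integral_congr_ae (Eventually.of_forall fun y => ?_)
    dsimp only
    rw [← scalarIntegrand_conj]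
    simp
  have h3 : verticalIntegral m b (midPole b 0) / 2 = ((J.re : ℝ) : ℂ) := by
    rw [← hV, h2, Complex.add_conj]
    push_cast
    ring
  have h4 := hasSum_verticalIntegral (m := m) hb
  rw [h3, Complex.hasSum_ofReal] at h4
  rwa [h1, Complex.mul_I_im]

/-- The part of the spin-1 integrand in an electric field that has no poles on the positive axis. -/
noncomputable def regularIntegrand (m b : ℝ) (T : ℂ) : ℂ :=
  properTimeWeight m T * (4 * (b * T) * Complex.sin (b * T))

/-- Without poles the contour rotates down to the real axis, where the integrand is real. The growth
condition persists because lowering the angle decreases sin and increases cos. -/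
theorem contourIntegral_regularIntegrand_im {m b ε φ : ℝ} (hb : 0 < b) (hε : 0 < ε)
    (hφ0 : 0 ≤ φ) (hφ : φ < Real.pi / 2) (hadm : b * Real.sin φ ≤ m ^ 2 * Real.cos φ) :
    (contourIntegral ε φ (regularIntegrand m b)).im = 0 := by
  have hrot : contourIntegral ε φ (regularIntegrand m b) =
      contourIntegral ε 0 (regularIntegrand m b) := by
    have hψ : ∀ ψ ∈ Set.uIcc φ 0, 0 ≤ ψ ∧ ψ < Real.pi / 2 ∧ 0 ≤ Real.sin ψ ∧
        b * Real.sin ψ ≤ m ^ 2 * Real.cos ψ := by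
      intro ψ hψ
      rw [Set.uIcc_of_ge hφ0] at hψ
      have h1 := Real.sin_le_sin_of_le_of_le_pi_div_two (by linarith [hψ.1]) hφ.le hψ.2
      have h2 := Real.cos_le_cos_of_nonneg_of_le_pi hψ.1 (by linarith [Real.pi_pos]) hψ.2
      have h3 := mul_le_mul_of_nonneg_left h1 hb.le
      have h4 := mul_le_mul_of_nonneg_left h2 (sq_nonneg m)
      exact ⟨hψ.1, hψ.2.trans_lt hφ,
        Real.sin_nonneg_of_nonneg_of_le_pi hψ.1 (by linarith [hψ.2, Real.pi_pos]), by linarith⟩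
    refine contourIntegral_rotate (C := 4 * b) (fun r hr ψ hψ' => ?_) (fun r hr ψ hψ' => ?_)
    · obtain ⟨h1, h2, -, -⟩ := hψ ψ hψ'
      exact (differentiableAt_properTimeWeight m
        (contourPoint_ne_zero hε.le h1 h2 hr (Or.inl hε))).mul (by fun_prop)
    · obtain ⟨h1, h2, h3, h4⟩ := hψ ψ hψ'
      have hr0 : 0 < r := by linarith
      have hn : r ≤ ‖contourPoint ε ψ r‖ := le_norm_contourPoint hε.le h1 h2.le hr0.le
      have hn0 : 0 < ‖contourPoint ε ψ r‖ := by linarith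
      have hsin : ‖Complex.sin (b * contourPoint ε ψ r)‖ ≤ Real.exp (b * Real.sin ψ * r) := by
        have h := norm_cos_le (b * contourPoint ε ψ r - Real.pi / 2)
        rw [Complex.cos_sub_pi_div_two] at h
        have e : ((b : ℂ) * contourPoint ε ψ r - Real.pi / 2).im = b * (r * Real.sin ψ) := by
          rw [Complex.sub_im, Complex.im_ofReal_mul, contourPoint_im]
          simp
        rw [e, abs_of_nonneg (by positivity)] at h
        rwa [mul_assoc, mul_comm (Real.sin ψ)]
      have hw := norm_weight_contour_le (m := m) hε.le h1 h2.le hr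
      have he : Real.exp (-(m ^ 2 * Real.cos ψ) * r) * Real.exp (b * Real.sin ψ * r) ≤ 1 := by
        rw [← Real.exp_add, Real.exp_le_one_iff]
        nlinarith
      rw [regularIntegrand, norm_mul, norm_mul, norm_mul, norm_mul, Complex.norm_real,
        Real.norm_of_nonneg hb.le]
      have h4 : ‖(4 : ℂ)‖ = 4 := by simp
      rw [h4]
      calc _ ≤ Real.exp (-(m ^ 2 * Real.cos ψ) * r) / ‖contourPoint ε ψ r‖ ^ 3 *
            (4 * (b * ‖contourPoint ε ψ r‖) * Real.exp (b * Real.sin ψ * r)) := by gcongr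
        _ = 4 * b / ‖contourPoint ε ψ r‖ ^ 2 *
            (Real.exp (-(m ^ 2 * Real.cos ψ) * r) * Real.exp (b * Real.sin ψ * r)) := by
            field_simp
        _ ≤ 4 * b / r ^ 2 * 1 := by gcongr
        _ = _ := by ring
  have hreal : ∀ r : ℝ, contourPullback ε 0 (regularIntegrand m b) r =
      ((1 / (ε + r) * (Real.exp (-(m ^ 2 * (ε + r))) / (4 * Real.pi * (ε + r)) ^ 2) *
        (4 * (b * (ε + r)) * Real.sin (b * (ε + r))) : ℝ) : ℂ) := by
    intro r
    simp only [contourPullback, contourPoint, regularIntegrand, properTimeWeight]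
    push_cast
    simp
  rw [hrot, contourIntegral]
  simp_rw [hreal]
  rw [integral_complex_ofReal, Complex.ofReal_im]

theorem maxwell_electric (E : Vec3) : Kplus E 0 = 0 ∧ Kminus E 0 = ‖E‖ := by
  have hF : maxwellF E 0 = -(‖E‖ ^ 2 / 2) := by simp [maxwellF]; ring
  have hG : maxwellG E 0 = 0 := by simp [maxwellG]
  have hs : √(maxwellF E 0 ^ 2 + maxwellG E 0 ^ 2) = ‖E‖ ^ 2 / 2 := by
    rw [hG, hF, show (-(‖E‖ ^ 2 / 2)) ^ 2 + (0 : ℝ) ^ 2 = (‖E‖ ^ 2 / 2) ^ 2 by ring,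
      Real.sqrt_sq (by positivity)]
  constructor
  · rw [Kplus, hs, hF]; simp
  · rw [Kminus, hs, hF, show ‖E‖ ^ 2 / 2 - -(‖E‖ ^ 2 / 2) = ‖E‖ ^ 2 by ring,
      Real.sqrt_sq (norm_nonneg _)]

theorem profile_electric_zero (q : ℝ) (E : Vec3) (T : ℂ) :
    profile 0 E 0 (q * T) = -divSin ((q * ‖E‖ : ℝ) * T) := by
  obtain ⟨h1, h2⟩ := maxwell_electric E
  rw [profile, h1, h2, if_pos rfl]
  have : (q : ℂ) * T * (‖E‖ : ℂ) = ((q * ‖E‖ : ℝ) : ℂ) * T := by push_cast; ring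
  simp [divSinh, this]

theorem divSin_mul_sin_sq (z : ℂ) : divSin z * Complex.sin z ^ 2 = z * Complex.sin z := by
  by_cases hz : z = 0
  · simp [hz]
  · by_cases hs : Complex.sin z = 0
    · simp [hs]
    · rw [divSin, if_neg hz]; field_simp

/-- With K₊ = 0 the bracket is -1 - 2 cos 2z = -3 + 4 sin² z. The sin² removes the poles from the
second term, and -3 is the origin of the ratio three between the rates. -/
theorem profile_electric_one (q : ℝ) (E : Vec3) (T : ℂ) :
    profile 1 E 0 (q * T) = -3 * divSin ((q * ‖E‖ : ℝ) * T) +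
      4 * ((q * ‖E‖ : ℝ) * T) * Complex.sin ((q * ‖E‖ : ℝ) * T) := by
  obtain ⟨h1, h2⟩ := maxwell_electric E
  rw [profile, h1, h2, if_neg one_ne_zero]
  have : (q : ℂ) * T * (‖E‖ : ℂ) = ((q * ‖E‖ : ℝ) : ℂ) * T := by push_cast; ring
  rw [this]
  generalize ((q * ‖E‖ : ℝ) : ℂ) * T = z
  have h3 := divSin_mul_sin_sq z
  have h4 := Complex.cos_sq' z
  simp only [Complex.ofReal_zero, mul_zero, divSinh, if_true, Complex.cosh_zero, Complex.cos_two_mul]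
  linear_combination 4 * h3 - 4 * divSin z * h4

theorem effectiveLagrangian_eq {s : ℕ} (hs : s ≤ 1) (m q : ℝ) (E B : Vec3) (ε φ : ℝ) :
    effectiveLagrangian s m q E B ε φ =
      contourIntegral ε φ (fun T => properTimeWeight m T * profile s E B (q * T)) := by
  rw [effectiveLagrangian]
  simp_rw [worldlineFactor_eq_profile s hs]

theorem minkowskiLagrangian_zero_im {m q ε φ : ℝ} {E : Vec3} (hqE : 0 < q * ‖E‖) (hq : 0 < q)
    (hε : 0 < ε) (h : AdmissibleContour 0 m q E 0 ε φ) :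
    HasSum (pairTerm m (q * ‖E‖)) (minkowskiLagrangian 0 m q E 0 ε φ).im := by
  obtain ⟨-, h2, -, h4, h5, -⟩ := h
  rw [(maxwell_electric E).2] at h2 h5
  rw [abs_of_pos hq] at h2
  have e : minkowskiLagrangian 0 m q E 0 ε φ =
      contourIntegral ε φ (scalarIntegrand m (q * ‖E‖)) := by
    rw [minkowskiLagrangian, effectiveLagrangian_eq (by norm_num), contourIntegral, contourIntegral,
      ← MeasureTheory.integral_neg]
    refine MeasureTheory.integral_congr_ae (Eventually.of_forall fun r => ?_)
    simp only [contourPullback, scalarIntegrand, profile_electric_zero]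
    ring
  rw [e]
  exact contourIntegral_scalarIntegrand_im hqE hε (by linarith) (h5 hqE.ne') h4

theorem minkowskiLagrangian_one_im {m q ε φ : ℝ} {E : Vec3} (hm : 0 < m) (hqE : 0 < q * ‖E‖)
    (hq : 0 < q) (hε : 0 < ε) (h : AdmissibleContour 1 m q E 0 ε φ) :
    HasSum (fun n => 3 * pairTerm m (q * ‖E‖) n) (minkowskiLagrangian 1 m q E 0 ε φ).im := by
  have i1 := integrableOn_contourPullback_profile hm le_rfl hε h
  have h0 : AdmissibleContour 0 m q E 0 ε φ := by
    obtain ⟨a1, a2, a3, a4, a5, -⟩ := h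
    exact ⟨a1, a2, a3, a4, a5, by simp⟩
  have i0 := integrableOn_contourPullback_profile hm (Nat.zero_le 1) hε h0
  obtain ⟨-, h2, h3, h4, h5, h6⟩ := h
  have h6 := h6 rfl
  rw [(maxwell_electric E).1, (maxwell_electric E).2, zero_mul, zero_sub, abs_neg,
    abs_of_pos hq] at h6
  rw [(maxwell_electric E).2] at h2 h5
  rw [abs_of_pos hq] at h2
  set b := q * ‖E‖ with hb
  have hadm : b * Real.sin φ ≤ m ^ 2 * Real.cos φ := by
    have := mul_le_mul_of_nonneg_left (le_abs_self (‖E‖ * Real.sin φ)) hq.le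
    rw [hb, mul_assoc]
    linarith
  -- Integrability of both pieces separately is needed to split the spin-1 integral.
  have j0 : MeasureTheory.IntegrableOn (contourPullback ε φ (scalarIntegrand m b))
      (Set.Ioi 0) := by
    refine i0.neg.congr_fun (fun r _ => ?_) measurableSet_Ioi
    simp only [Pi.neg_apply, contourPullback, scalarIntegrand, profile_electric_zero]
    ring
  have j1 : MeasureTheory.IntegrableOn (contourPullback ε φ (regularIntegrand m b))
      (Set.Ioi 0) := by
    refine (i1.add (j0.const_mul 3)).congr_fun (fun r _ => ?_) measurableSet_Ioi
    simp only [Pi.add_apply, contourPullback, scalarIntegrand, regularIntegrand,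
      profile_electric_one]
    ring
  have e : minkowskiLagrangian 1 m q E 0 ε φ =
      3 * contourIntegral ε φ (scalarIntegrand m b) -
        contourIntegral ε φ (regularIntegrand m b) := by
    rw [minkowskiLagrangian, effectiveLagrangian_eq le_rfl, contourIntegral, contourIntegral,
      contourIntegral, ← MeasureTheory.integral_neg, ← MeasureTheory.integral_const_mul,
      ← MeasureTheory.integral_sub (j0.const_mul 3) j1]
    refine MeasureTheory.integral_congr_ae (Eventually.of_forall fun r => ?_)
    simp only [contourPullback, scalarIntegrand, regularIntegrand, profile_electric_one]
    ring
  have him : (minkowskiLagrangian 1 m q E 0 ε φ).im =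
      3 * (contourIntegral ε φ (scalarIntegrand m b)).im := by
    rw [e, Complex.sub_im, contourIntegral_regularIntegrand_im hqE hε h3 h4 hadm]
    simp
  rw [him]
  exact (contourIntegral_scalarIntegrand_im hqE hε (by linarith) (h5 hqE.ne') h4).mul_left 3

/-! ### Trace invariants and assembly -/

theorem trace_sq_eq (E B : Vec3) :
    (fieldStrength E B ^ 2).trace = ((2 * (‖E‖ ^ 2 - ‖B‖ ^ 2) : ℝ) : ℂ) := by
  rw [trace_fieldStrength_sq, ← neg_sub (‖B‖ ^ 2), ← Kplus_sq_sub_Kminus_sq]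
  push_cast
  ring

theorem trace_fieldStrength_pow_four_eq (E B : Vec3) :
    (fieldStrength E B ^ 4).trace =
      ((2 * (‖E‖ ^ 2 - ‖B‖ ^ 2) ^ 2 + 4 * inner ℝ E B ^ 2 : ℝ) : ℂ) := by
  rw [trace_fieldStrength_pow_four, ← neg_sub (‖B‖ ^ 2), ← Kplus_sq_sub_Kminus_sq,
    ← Kplus_sq_mul_Kminus_sq]
  push_cast
  ring

theorem profileQuartic_zero (E B : Vec3) :
    profileQuartic 0 E B = -(1 / 288 * (fieldStrength E B ^ 2).trace ^ 2
      + 1 / 360 * (fieldStrength E B ^ 4).trace) := by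
  rw [profileQuartic, if_pos rfl, trace_fieldStrength_sq, trace_fieldStrength_pow_four]
  ring

theorem profileQuartic_one (E B : Vec3) :
    profileQuartic 1 E B = 5 / 32 * (fieldStrength E B ^ 2).trace ^ 2
      - 27 / 40 * (fieldStrength E B ^ 4).trace := by
  rw [profileQuartic, if_neg one_ne_zero, trace_fieldStrength_sq, trace_fieldStrength_pow_four]
  ring

theorem worldlineFactor_one_isBigO (E B : Vec3) (T : ℂ) :
    (fun q : ℝ => worldlineFactor 1 q (fieldStrength E B) T -
        (-3 + 7 / 4 * (q : ℂ) ^ 2 * T ^ 2 * (fieldStrength E B ^ 2).trace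
          + 5 / 32 * (q : ℂ) ^ 4 * T ^ 4 * (fieldStrength E B ^ 2).trace ^ 2
          - 27 / 40 * (q : ℂ) ^ 4 * T ^ 4 * (fieldStrength E B ^ 4).trace))
      =O[𝓝 0] (fun q : ℝ => q ^ 6) := by
  have hlim : Tendsto (fun q : ℝ => (q : ℂ) * T) (𝓝 0) (𝓝 0) := by
    have : Continuous fun q : ℝ => (q : ℂ) * T := by fun_prop
    simpa using this.tendsto 0
  refine (((profile_taylor 1 E B).comp_tendsto hlim).congr_left fun q => ?_).trans
    (IsBigO.of_bound (‖T‖ ^ 6) (Eventually.of_forall fun q => ?_))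
  · rw [worldlineFactor_eq_profile 1 le_rfl, Function.comp_apply, profileQuartic_one, profileLow,
      if_neg one_ne_zero, trace_fieldStrength_sq]
    ring
  · rw [Function.comp_apply, norm_pow, norm_mul, norm_pow, Complex.norm_real, mul_pow, mul_comm]

end Worldline

theorem mainTheorem6 (m : ℝ) (hm : 0 < m) (E B : Vec3) :
    -- the functional determinants and the modular integral of the worldline path integral exist
    (∀ (q : ℝ) (T θ : ℂ),
      Tendsto (coordDetSliced q (fieldStrength E B) T) atTop
        (𝓝 (coordDet q (fieldStrength E B) T)) ∧
      Tendsto (circleDetSliced (oscMatrix q (fieldStrength E B) T θ)) atTop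
        (𝓝 (circleDet (oscMatrix q (fieldStrength E B) T θ))) ∧
      Tendsto (circleDetSliced (fun _ _ : Fin 1 => Complex.I * θ)) atTop (𝓝 (scalarDet θ))) ∧
    (∀ q : ℝ, Differentiable ℂ (sqrtCoordDet q (fieldStrength E B)) ∧
      sqrtCoordDet q (fieldStrength E B) 0 = 1 ∧
      ∀ T : ℂ, sqrtCoordDet q (fieldStrength E B) T ^ 2 = coordDet q (fieldStrength E B) T) ∧
    (∀ s : ℕ, s ≤ 1 → ∀ (q : ℝ) (T : ℂ), ∀ᶠ Λ : ℝ in atTop,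
      modularAverage s q (fieldStrength E B) T Λ =
        modularIntegral s q (fieldStrength E B) T) ∧
    -- the proper-time integrands for spin 0 (Weisskopf) and spin 1, away from the poles
    (∀ (q : ℝ) (T : ℂ), T ≠ 0 →
      (Complex.sin ((q : ℂ) * T * (Kminus E B : ℂ)) = 0 → q * Kminus E B = 0) →
      (Complex.sinh ((q : ℂ) * T * (Kplus E B : ℂ)) = 0 → q * Kplus E B = 0) →
      worldlineFactor 0 q (fieldStrength E B) T = -weisskopfFactor q E B T ∧
      worldlineFactor 1 q (fieldStrength E B) T =
        weisskopfFactor q E B T * spinOneBracket q E B T) ∧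
    -- the effective Lagrangians for spin 0 and spin 1
    (∀ q ε φ : ℝ, 0 < ε → AdmissibleContour 0 m q E B ε φ →
      MeasureTheory.IntegrableOn (contourPullback ε φ
        (fun T => properTimeWeight m T * weisskopfFactor q E B T)) (Set.Ioi 0) ∧
      effectiveLagrangian 0 m q E B ε φ =
        -contourIntegral ε φ (fun T => properTimeWeight m T * weisskopfFactor q E B T)) ∧
    (∀ q ε φ : ℝ, 0 < ε → AdmissibleContour 1 m q E B ε φ →
      MeasureTheory.IntegrableOn (contourPullback ε φ
        (fun T => properTimeWeight m T * (weisskopfFactor q E B T * spinOneBracket q E B T)))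
        (Set.Ioi 0) ∧
      effectiveLagrangian 1 m q E B ε φ =
        contourIntegral ε φ
          (fun T => properTimeWeight m T * (weisskopfFactor q E B T * spinOneBracket q E B T))) ∧
    -- pair production in a purely electric field
    (B = 0 → ∀ q : ℝ, 0 < q * ‖E‖ → 0 < q → ∀ ε φ ε' φ' : ℝ, 0 < ε → 0 < ε' →
      AdmissibleContour 1 m q E B ε φ → AdmissibleContour 0 m q E B ε' φ' →
      HasSum (fun n : ℕ => 3 * (q * ‖E‖) ^ 2 / (16 * Real.pi ^ 3) *
          ((-1) ^ n * Real.exp (-(m ^ 2 * Real.pi * ((n : ℝ) + 1) / (q * ‖E‖))) /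
            ((n : ℝ) + 1) ^ 2))
        (minkowskiLagrangian 1 m q E B ε φ).im ∧
      pairRate 1 m q E B ε φ =
        -(3 / (8 * Real.pi ^ 3) * (q * ‖E‖) ^ 2 *
          dilog (-Real.exp (-(m ^ 2 * Real.pi / (q * ‖E‖))))) ∧
      pairRate 1 m q E B ε φ = 3 * pairRate 0 m q E B ε' φ') ∧
    -- the perturbative expansion of the spin-1 proper-time integrand
    (∀ T : ℂ, (fun q : ℝ => worldlineFactor 1 q (fieldStrength E B) T -
        (-3 + 7 / 4 * (q : ℂ) ^ 2 * T ^ 2 * (fieldStrength E B ^ 2).trace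
          + 5 / 32 * (q : ℂ) ^ 4 * T ^ 4 * (fieldStrength E B ^ 2).trace ^ 2
          - 27 / 40 * (q : ℂ) ^ 4 * T ^ 4 * (fieldStrength E B ^ 4).trace))
      =O[𝓝 0] (fun q : ℝ => q ^ 6)) ∧
    -- the renormalized effective Lagrangians converge
    (∀ s : ℕ, s ≤ 1 → ∀ q φ : ℝ, AdmissibleContour s m q E B 0 φ →
      MeasureTheory.IntegrableOn (contourPullback 0 φ
        (renormalizedIntegrand s m q (fieldStrength E B))) (Set.Ioi 0)) ∧
    -- the two quadratic and quartic invariants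
    -(fieldStrength E B ^ 2).trace = ((2 * (‖B‖ ^ 2 - ‖E‖ ^ 2) : ℝ) : ℂ) ∧
    (fieldStrength E B ^ 4).trace =
      ((2 * (‖E‖ ^ 2 - ‖B‖ ^ 2) ^ 2 + 4 * inner ℝ E B ^ 2 : ℝ) : ℂ) ∧
    -- light-by-light scattering: weak-field expansions for spin 1 and spin 0
    (∀ φ : ℝ, 0 ≤ φ → φ < Real.pi / 2 → (Kminus E B ≠ 0 → 0 < φ) →
      ((fun q : ℝ => renormalizedMinkowski 1 m q E B φ -
          (1 / 4 * (fieldStrength E B ^ 2).trace + (q : ℂ) ^ 4 / (16 * Real.pi ^ 2 * (m : ℂ) ^ 4) *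
            (-(5 / 32) * (fieldStrength E B ^ 2).trace ^ 2
              + 27 / 40 * (fieldStrength E B ^ 4).trace)))
        =O[𝓝 0] (fun q : ℝ => q ^ 6)) ∧
      ((fun q : ℝ => renormalizedMinkowski 1 m q E B φ -
          ((1 / 2 * (‖E‖ ^ 2 - ‖B‖ ^ 2) + fineStructure q ^ 2 / (40 * m ^ 4) *
            (29 * (‖E‖ ^ 2 - ‖B‖ ^ 2) ^ 2 + 108 * inner ℝ E B ^ 2) : ℝ) : ℂ))
        =O[𝓝 0] (fun q : ℝ => q ^ 6)) ∧
      ((fun q : ℝ => renormalizedMinkowski 0 m q E B φ -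
          (1 / 4 * (fieldStrength E B ^ 2).trace + (q : ℂ) ^ 4 / (16 * Real.pi ^ 2 * (m : ℂ) ^ 4) *
            (1 / 288 * (fieldStrength E B ^ 2).trace ^ 2
              + 1 / 360 * (fieldStrength E B ^ 4).trace)))
        =O[𝓝 0] (fun q : ℝ => q ^ 6)) ∧
      ((fun q : ℝ => renormalizedMinkowski 0 m q E B φ -
          ((1 / 2 * (‖E‖ ^ 2 - ‖B‖ ^ 2) + fineStructure q ^ 2 / (360 * m ^ 4) *
            (7 * (‖E‖ ^ 2 - ‖B‖ ^ 2) ^ 2 + 4 * inner ℝ E B ^ 2) : ℝ) : ℂ))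
        =O[𝓝 0] (fun q : ℝ => q ^ 6))) := by
  refine ⟨fun q T θ => ⟨?_, ?_, ?_⟩, fun q => ⟨?_, ?_, fun T => ?_⟩, fun s hs q T => ?_,
    fun q T _ _ _ => ⟨worldlineFactor_zero q E B T, worldlineFactor_one q E B T⟩, ?_, ?_, ?_,
    fun T => worldlineFactor_one_isBigO E B T, fun s hs q φ h => integrableOn_renormalized hs hm h,
    ?_, ?_, fun φ hφ0 hφ hK => ?_⟩
  · rw [coordDet_eq]; exact tendsto_coordDetSliced q E B T
  · rw [circleDet_oscMatrix]; exact tendsto_circleDetSliced_oscMatrix q E B T θ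
  · rw [scalarDet_eq]; exact tendsto_circleDetSliced_scalar θ
  · rw [sqrtCoordDet_eq]; exact differentiable_sinc_mul_sinhc q E B
  · rw [sqrtCoordDet_eq]; simp [sinc, sinhc]
  · rw [sqrtCoordDet_eq, coordDet_eq]
  · rw [modularIntegral_eq s hs]; exact eventually_modularAverage_eq s hs q E B T
  · intro q ε φ hε h
    have e : (fun T => properTimeWeight m T * weisskopfFactor q E B T) =
        fun T => -(properTimeWeight m T * profile 0 E B (q * T)) := by
      funext T
      rw [← worldlineFactor_eq_profile 0 (by norm_num), worldlineFactor_zero]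
      ring
    have hp : ∀ f : ℂ → ℂ, contourPullback ε φ (fun T => -f T) =
        fun r => -contourPullback ε φ f r := fun f => by
      funext r; simp [contourPullback]
    constructor
    · rw [e, hp]
      exact (integrableOn_contourPullback_profile hm (Nat.zero_le 1) hε h).neg
    · rw [effectiveLagrangian_eq (by norm_num), e, contourIntegral, contourIntegral, hp,
        MeasureTheory.integral_neg, neg_neg]
  · intro q ε φ hε h
    have e : (fun T => properTimeWeight m T *
        (weisskopfFactor q E B T * spinOneBracket q E B T)) =
        fun T => properTimeWeight m T * profile 1 E B (q * T) := by
      funext T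
      rw [← worldlineFactor_eq_profile 1 le_rfl, worldlineFactor_one]
    rw [e]
    exact ⟨integrableOn_contourPullback_profile hm le_rfl hε h, effectiveLagrangian_eq le_rfl ..⟩
  · rintro rfl q hqE hq ε φ ε' φ' hε hε' h1 h0
    have s1 := minkowskiLagrangian_one_im hm hqE hq hε h1
    have s0 := minkowskiLagrangian_zero_im hqE hq hε' h0
    have e10 : (minkowskiLagrangian 1 m q E 0 ε φ).im =
        3 * (minkowskiLagrangian 0 m q E 0 ε' φ').im := s1.unique (s0.mul_left 3)
    refine ⟨?_, ?_, ?_⟩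
    · convert s1 using 2 with n
      rw [pairTerm]
      ring
    · rw [pairRate, ← s1.tsum_eq, dilog, ← tsum_mul_left, ← tsum_mul_left, ← tsum_neg]
      refine tsum_congr fun n => ?_
      -- The dilogarithm has sign (-1)^(n+1) where `pairTerm` has (-1)^n; this accounts for the
      -- overall minus sign.
      rw [neg_pow, ← Real.exp_nat_mul, pairTerm,
        show ((n + 1 : ℕ) : ℝ) * -(m ^ 2 * Real.pi / (q * ‖E‖)) =
          -(m ^ 2 * Real.pi * ((n : ℝ) + 1) / (q * ‖E‖)) by push_cast; ring]
      ring
    · rw [pairRate, pairRate, e10]; ring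
  · rw [trace_sq_eq]
    push_cast
    ring
  · exact trace_fieldStrength_pow_four_eq E B
  · have r1 := renormalizedMinkowski_isBigO (s := 1) le_rfl (E := E) (B := B) hm hφ0 hφ hK
    have r0 := renormalizedMinkowski_isBigO (s := 0) (by norm_num) (E := E) (B := B) hm hφ0 hφ hK
    refine ⟨?_, ?_, ?_, ?_⟩
    · refine r1.congr_left fun q => ?_
      rw [profileQuartic_one]
      ring
    · refine r1.congr_left fun q => ?_
      rw [profileQuartic_one, trace_sq_eq, trace_fieldStrength_pow_four_eq, fineStructure]
      push_cast
      ring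
    · refine r0.congr_left fun q => ?_
      rw [profileQuartic_zero]
      ring
    · refine r0.congr_left fun q => ?_
      rw [profileQuartic_zero, trace_sq_eq, trace_fieldStrength_pow_four_eq, fineStructure]
      push_cast
      ring
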